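/- Let $F$ be a non-archimedean local field with ring of integers $\mathcal O$, maximal ideal $\mathcal P$ and uniformizer $\pi$. Let $V=F^4$ with basis $e_1,e_2,f_1,f_2$ and the alternating form with $\langle e_1,f_2\rangle=\langle e_2,f_1\rangle=1$ and all other products $\langle e_i,f_j\rangle$, $\langle e_i,e_j\rangle$, $\langle f_i,f_j\rangle$ zero; let $G=\mathrm{GSp}_4(F)$ be its group of similitudes, $Z$ the group of scalar matrices, and $G_0=\{g\in G:\operatorname{ord}_\pi\det g\equiv 0 \bmod 4\}$. The building $X$ of $\mathrm{Sp}_4(F)$. A lattice (finitely generated $\mathcal O$-submodule spanning $V$) $L\subset V$ is primitive if $\langle L,L\rangle\subset\mathcal O$ and the form induced on $L/\pi L$ is nondegenerate; $L'$ is incident to the primitive lattice $L$ if $\pi L\subset L'\subset L$ and $\langle L',L'\rangle\subset\mathcal P$. The vertices of $X$ are the homothety classes of primitive lattices and of lattices incident to primitive ones; two distinct vertices are joined by an edge if they are represented by lattices $L',L''$, one contained in the other, with $\pi L\subset L',L''\subset L$ for some primitive $L$. A symplectic basis $(u_1,u_2,w_1,w_2)$ of $V$ (one with the same products as $e_1,e_2,f_1,f_2$)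 determines the apartment of the vertices $[\mathcal O\pi^{a_1}u_1+\mathcal O\pi^{a_2}u_2+\mathcal O\pi^{b_1}w_1+\mathcal O\pi^{b_2}w_2]$, realized in the Euclidean plane by the points $(b_2-a_1,\,b_1-a_2)$. An edge path in $X$ is geodesic if in some apartment it runs along a straight line without turning back. Let $\Gamma$ be a discrete, torsion-free, cocompact subgroup of $\mathrm{PGSp}_4(F)=G/Z$ contained in $G_0/Z$, and let $X_\Gamma=\Gamma\backslash X$. A cycle in (the $1$-skeleton of) $X_\Gamma$ is a closed path of $n\ge 1$ directed edges of $X_\Gamma$, with a starting point; $n$ is its length. It is primitive if it is not obtained by repeating another cycle more than once, and tailless geodesic if it and all cycles obtained from it by shifting the starting vertex lift to geodesic paths in $X$. Put $$Z(X_\Gamma,u)=\prod_{[C]}\bigl(1-u^{l([C])}\bigr)^{-1},$$ where $[C]$ runs over the classes, under shifting the starting vertex, of primitive tailless geodesic cycles in $X_\Gamma$ and $l([C])$ is the length of $C$. Let $P_1$ (resp. $P_2$) be the Siegel (resp. Klingen) congruence subgroup, that is, the group of the elements of $\mathrm{GSp}_4(\mathcal O)$ that are block upper triangular modulo $\mathcal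 P$ with diagonal blocks of sizes $2,2$ (resp. $1,2,1$). Put $d_1=\mathrm{diag}(1,1,\pi,\pi)$ and $d_2=\mathrm{diag}(1,\pi,\pi,\pi^2)$, and let $L_{P_i}$ be the operator on the space of complex-valued functions on $\Gamma\backslash G/P_iZ$ given by $$L_{P_i}f(\Gamma gP_iZ)=\sum_{hP_i\in P_id_iP_i/P_i}f(\Gamma ghP_iZ),$$ where $\Gamma$ acts through its preimage in $G$. **Theorem.** The sets $\Gamma\backslash G/P_1Z$ and $\Gamma\backslash G/P_2Z$ are finite, and $Z(X_\Gamma,u)$ is a rational function of $u$: for all complex $u$ with $|u|$ sufficiently small, the product $Z(X_\Gamma,u)$ converges unconditionally, both determinants below are nonzero, and $$Z(X_\Gamma,u)=\frac{1}{\det(I-L_{P_1}u)\,\det(I-L_{P_2}u^2)}.$$ -/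

import Mathlib

open scoped ValuativeRel

noncomputable section

namespace Sp4Zeta

/-! ### The groups -/

/-- The matrix of the alternating form on `F⁴`, in the ordered basis `e₁, e₂, f₁, f₂`. -/
def J (F : Type*) [Field F] : Matrix (Fin 4) (Fin 4) F :=
  !![0, 0, 0, 1; 0, 0, 1, 0; 0, -1, 0, 0; -1, 0, 0, 0]

/-- The alternating form `⟨x, y⟩ = xᵗ J y` on `V = F⁴`, so `⟨e₁, f₂⟩ = ⟨e₂, f₁⟩ = 1`. -/
def form {F : Type*} [Field F] (x y : Fin 4 → F) : F :=
  dotProduct x ((J F).mulVec y)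

/-- The group `GSp₄(F)` of symplectic similitudes. -/
def GSp4 (F : Type*) [Field F] : Subgroup (GL (Fin 4) F) where
  carrier := {g | ∃ c : Fˣ, (g : Matrix (Fin 4) (Fin 4) F).transpose * J F *
    (g : Matrix (Fin 4) (Fin 4) F) = (c : F) • J F}
  mul_mem' := by
    rintro a b ⟨c, hc⟩ ⟨d, hd⟩
    refine ⟨c * d, ?_⟩
    have h : ((a * b : GL (Fin 4) F) : Matrix (Fin 4) (Fin 4) F).transpose * J F *
        ((a * b : GL (Fin 4) F) : Matrix (Fin 4) (Fin 4) F) =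
        (b : Matrix (Fin 4) (Fin 4) F).transpose *
          ((a : Matrix (Fin 4) (Fin 4) F).transpose * J F * (a : Matrix (Fin 4) (Fin 4) F)) *
          (b : Matrix (Fin 4) (Fin 4) F) := by
      simp only [Units.val_mul, Matrix.transpose_mul, Matrix.mul_assoc]
    rw [h, hc, Matrix.mul_smul, Matrix.smul_mul, hd, smul_smul, Units.val_mul]
  one_mem' := ⟨1, by simp⟩
  inv_mem' := by
    rintro a ⟨c, hc⟩
    refine ⟨c⁻¹, ?_⟩
    have h1 : (a : Matrix (Fin 4) (Fin 4) F) * ((a⁻¹ : GL (Fin 4) F) : Matrix _ _ F) = 1 := by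
      rw [← Units.val_mul]; simp
    have h2 : ((a⁻¹ : GL (Fin 4) F) : Matrix (Fin 4) (Fin 4) F).transpose *
        (a : Matrix (Fin 4) (Fin 4) F).transpose = 1 := by
      rw [← Matrix.transpose_mul, h1, Matrix.transpose_one]
    have h3 : J F = (c : F) • (((a⁻¹ : GL (Fin 4) F) : Matrix (Fin 4) (Fin 4) F).transpose * J F *
        ((a⁻¹ : GL (Fin 4) F) : Matrix (Fin 4) (Fin 4) F)) := by
      calc J F = (((a⁻¹ : GL (Fin 4) F) : Matrix (Fin 4) (Fin 4) F).transpose *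
            (a : Matrix (Fin 4) (Fin 4) F).transpose) * J F *
            ((a : Matrix (Fin 4) (Fin 4) F) * ((a⁻¹ : GL (Fin 4) F) : Matrix _ _ F)) := by
              rw [h1, h2]; simp
        _ = ((a⁻¹ : GL (Fin 4) F) : Matrix (Fin 4) (Fin 4) F).transpose *
            ((a : Matrix (Fin 4) (Fin 4) F).transpose * J F * (a : Matrix (Fin 4) (Fin 4) F)) *
            ((a⁻¹ : GL (Fin 4) F) : Matrix _ _ F) := by
              simp only [Matrix.mul_assoc]
        _ = _ := by rw [hc, Matrix.mul_smul, Matrix.smul_mul]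
    conv_rhs => rw [h3]
    rw [smul_smul, ← Units.val_mul]
    simp

/-- The scalar matrix `diag(z, z, z, z)`. -/
def scalarGL {F : Type*} [Field F] (z : Fˣ) : GL (Fin 4) F :=
  Units.map (Matrix.scalar (Fin 4)).toMonoidHom z

/-- The subgroup `Z` of scalar matrices, the center of `GSp₄(F)`. -/
def Z (F : Type*) [Field F] : Subgroup (GSp4 F) where
  carrier := {g | ∃ z : Fˣ, (g : GL (Fin 4) F) = scalarGL z}
  mul_mem' := by
    rintro a b ⟨z, hz⟩ ⟨w, hw⟩
    exact ⟨z * w, by simp [scalarGL, hz, hw]⟩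
  one_mem' := ⟨1, by simp [scalarGL]⟩
  inv_mem' := by
    rintro a ⟨z, hz⟩
    exact ⟨z⁻¹, by simp [scalarGL, hz]⟩

instance (F : Type*) [Field F] : (Z F).Normal where
  conj_mem := by
    rintro n ⟨z, hz⟩ g
    refine ⟨z, ?_⟩
    have hc : (g : GL (Fin 4) F) * scalarGL z = scalarGL z * (g : GL (Fin 4) F) := by
      apply Units.ext
      exact ((Matrix.scalar_commute (z : F) (fun r => Commute.all _ r)
        ((g : GL (Fin 4) F) : Matrix (Fin 4) (Fin 4) F)).eq).symm
    rw [Subgroup.coe_mul, Subgroup.coe_mul, hz, hc, Subgroup.coe_inv, mul_assoc, mul_inv_cancel,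
      mul_one]

/-- `PGSp₄(F) = GSp₄(F) / Z`, with the quotient topology. -/
abbrev PGSp4 (F : Type*) [Field F] := GSp4 F ⧸ Z F

/-- The full preimage in `GSp₄(F)` of a subgroup of `PGSp₄(F)`. -/
def preim {F : Type*} [Field F] (Γ : Subgroup (PGSp4 F)) : Subgroup (GSp4 F) :=
  Γ.comap (QuotientGroup.mk' (Z F))

section LocalField

variable {F : Type*} [Field F] [ValuativeRel F]

/-- `ϖ` is a uniformizer of `F`. -/
def IsUniformizer (ϖ : Fˣ) : Prop := ∃ p : 𝒪[F], Irreducible p ∧ (p : F) = (ϖ : F)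

/-- The subgroup `G₀` of `GSp₄(F)` of the elements whose determinant has order divisible by `4`. -/
def G0 (ϖ : Fˣ) : Subgroup (GSp4 F) where
  carrier := {g | ∃ (k : ℤ) (u : 𝒪[F]ˣ),
    Matrix.GeneralLinearGroup.det (g : GL (Fin 4) F) =
      ϖ ^ (4 * k) * Units.map (algebraMap 𝒪[F] F).toMonoidHom u}
  mul_mem' := by
    rintro a b ⟨k, u, h⟩ ⟨l, v, h'⟩
    refine ⟨k + l, u * v, ?_⟩
    rw [Subgroup.coe_mul, map_mul, h, h', map_mul, mul_add, zpow_add]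
    exact mul_mul_mul_comm _ _ _ _
  one_mem' := ⟨0, 1, by simp⟩
  inv_mem' := by
    rintro a ⟨k, u, h⟩
    refine ⟨-k, u⁻¹, ?_⟩
    rw [Subgroup.coe_inv, map_inv, h, map_inv, mul_inv, mul_neg, zpow_neg]

/-- The subgroup of the elements of `GSp₄(𝒪) = GSp₄(F) ∩ GL₄(𝒪)` whose reduction modulo the
maximal ideal is block upper triangular with respect to `b` (the `(i, j)` entry vanishes
whenever `b j < b i`). -/
def parahoric (b : Fin 4 → ℕ) : Subgroup (GSp4 F) where
  carrier := {g | ∃ h : GL (Fin 4) 𝒪[F],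
    Matrix.GeneralLinearGroup.map (algebraMap 𝒪[F] F) h = (g : GL (Fin 4) F) ∧
    (Matrix.GeneralLinearGroup.map (IsLocalRing.residue 𝒪[F]) h :
      Matrix (Fin 4) (Fin 4) 𝓀[F]).BlockTriangular b}
  mul_mem' := by
    rintro x y ⟨h, hx, hb⟩ ⟨k, hy, hb'⟩
    refine ⟨h * k, by rw [map_mul, hx, hy, Subgroup.coe_mul], ?_⟩
    rw [map_mul, Units.val_mul]
    exact hb.mul hb'
  one_mem' := ⟨1, by simp, by
    rw [map_one, Units.val_one]
    exact Matrix.blockTriangular_one⟩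
  inv_mem' := by
    rintro x ⟨h, hx, hb⟩
    refine ⟨h⁻¹, by rw [map_inv, hx, Subgroup.coe_inv], ?_⟩
    rw [map_inv, Matrix.coe_units_inv]
    let : Invertible (Matrix.GeneralLinearGroup.map (IsLocalRing.residue 𝒪[F]) h :
      Matrix (Fin 4) (Fin 4) 𝓀[F]) := Units.invertible _
    exact Matrix.blockTriangular_inv_of_blockTriangular hb

/-- The Siegel congruence subgroup: lower left `2 × 2` block zero modulo the maximal ideal. -/
def P1 (F : Type*) [Field F] [ValuativeRel F] : Subgroup (GSp4 F) := parahoric ![0, 0, 1, 1]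

/-- The Klingen congruence subgroup: block upper triangular with blocks of sizes `1, 2, 1` modulo
the maximal ideal. -/
def P2 (F : Type*) [Field F] [ValuativeRel F] : Subgroup (GSp4 F) := parahoric ![0, 1, 1, 2]

/-! ### The edge adjacency operators -/

/-- An invertible diagonal matrix. -/
def diagGL {F : Type*} [Field F] (a : Fin 4 → Fˣ) : GL (Fin 4) F where
  val := Matrix.diagonal fun i => (a i : F)
  inv := Matrix.diagonal fun i => ((a i)⁻¹ : Fˣ)
  val_inv := by simp [Matrix.diagonal_mul_diagonal]
  inv_val := by simp [Matrix.diagonal_mul_diagonal]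

/-- `diag(1, 1, t, t)`. -/
def d1 {F : Type*} [Field F] (t : Fˣ) : GSp4 F :=
  ⟨diagGL ![1, 1, t, t], t, by
    ext i j
    fin_cases i <;> fin_cases j <;>
      simp [diagGL, J, Matrix.mul_apply, Fin.sum_univ_four]⟩

/-- `diag(1, t, t, t²)`. -/
def d2 {F : Type*} [Field F] (t : Fˣ) : GSp4 F :=
  ⟨diagGL ![1, t, t, t ^ 2], t ^ 2, by
    ext i j
    fin_cases i <;> fin_cases j <;>
      simp [diagGL, J, Matrix.mul_apply, Fin.sum_univ_four, pow_two]⟩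

/-- The double coset space `Γ \ G / H Z`, where `G = GSp₄(F)`. -/
abbrev CosetSpace (Γ : Subgroup (PGSp4 F)) (H : Subgroup (GSp4 F)) : Type _ :=
  DoubleCoset.Quotient (preim Γ : Set (GSp4 F)) ((H ⊔ Z F : Subgroup (GSp4 F)) : Set (GSp4 F))

/-- The map `G / H → Γ \ G / H Z`, `x H ↦ Γ g x H Z`. -/
def translate (Γ : Subgroup (PGSp4 F)) (H : Subgroup (GSp4 F)) (g : GSp4 F) :
    GSp4 F ⧸ H → CosetSpace Γ H :=
  Quotient.lift (fun x => DoubleCoset.mk (preim Γ) (H ⊔ Z F) (g * x)) (by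
    intro x y hxy
    rw [DoubleCoset.eq]
    have h := QuotientGroup.leftRel_apply.mp hxy
    exact ⟨1, one_mem _, x⁻¹ * y, (le_sup_left : H ≤ H ⊔ Z F) h, by group⟩)

theorem translate_mul_left (Γ : Subgroup (PGSp4 F)) (H : Subgroup (GSp4 F)) (g γ : GSp4 F)
    (hγ : γ ∈ preim Γ) (x : GSp4 F ⧸ H) : translate Γ H (γ * g) x = translate Γ H g x := by
  induction x using QuotientGroup.induction_on with
  | _ x =>
    refine Eq.symm ((DoubleCoset.eq _ _ _ _).mpr ⟨γ, hγ, 1, one_mem _, ?_⟩)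
    simp [mul_assoc]

theorem translate_mul_center (Γ : Subgroup (PGSp4 F)) (H : Subgroup (GSp4 F)) (g z : GSp4 F)
    (hz : z ∈ Z F) (x : GSp4 F ⧸ H) : translate Γ H (g * z) x = translate Γ H g x := by
  induction x using QuotientGroup.induction_on with
  | _ x =>
    refine Eq.symm ((DoubleCoset.eq _ _ _ _).mpr ⟨1, one_mem _, x⁻¹ * z * x,
      (le_sup_right : Z F ≤ H ⊔ Z F) ?_, by group⟩)
    simpa using (inferInstance : (Z F).Normal).conj_mem z hz x⁻¹

theorem translate_mul_right (Γ : Subgroup (PGSp4 F)) (H : Subgroup (GSp4 F)) (g : GSp4 F)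
    (h : H) (x : GSp4 F ⧸ H) :
    translate Γ H (g * h) x = translate Γ H g (h • x) := by
  induction x using QuotientGroup.induction_on with
  | _ x =>
    change DoubleCoset.mk (preim Γ) (H ⊔ Z F) (g * h * x) =
      DoubleCoset.mk (preim Γ) (H ⊔ Z F) (g * (h * x))
    rw [mul_assoc]

/-- The linear functional `f ↦ ∑ f(Γ g gᵢ H Z)` on `C(Γ \ G / H Z)`, where `gᵢ H` runs over the
left cosets contained in `H d H`, that is, over the `H`-orbit of `d H` in `G / H`. The sum is
taken in the space of linear functionals; `H d H / H` is finite in the cases of interest. -/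
def heckeRow (Γ : Subgroup (PGSp4 F)) (H : Subgroup (GSp4 F)) (d : GSp4 F) (g : GSp4 F) :
    (CosetSpace Γ H → ℂ) →ₗ[ℂ] ℂ :=
  ∑ᶠ x : MulAction.orbit H (d : GSp4 F ⧸ H), LinearMap.proj (translate Γ H g x)

theorem heckeRow_mul_right (Γ : Subgroup (PGSp4 F)) (H : Subgroup (GSp4 F)) (d g : GSp4 F)
    (h : H) : heckeRow Γ H d (g * h) = heckeRow Γ H d g := by
  have key := finsum_comp_equiv
    (MulAction.toPerm h : Equiv.Perm (MulAction.orbit H (d : GSp4 F ⧸ H)))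
    (f := fun x => (LinearMap.proj (translate Γ H g x) : (CosetSpace Γ H → ℂ) →ₗ[ℂ] ℂ))
  refine Eq.trans (finsum_congr fun x => ?_) key
  rw [translate_mul_right]
  rfl

/-- The Hecke operator on `C(Γ \ G / H Z)` attached to the double coset `H d H`:
`(L f)(Γ g H Z) = ∑ f(Γ g gᵢ H Z)`, the sum over the cosets `gᵢ H` contained in `H d H`. -/
def heckeOp (Γ : Subgroup (PGSp4 F)) (H : Subgroup (GSp4 F)) (d : GSp4 F) :
    (CosetSpace Γ H → ℂ) →ₗ[ℂ] (CosetSpace Γ H → ℂ) :=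
  LinearMap.pi fun s => Quotient.lift (heckeRow Γ H d) (by
    intro g g' hgg'
    obtain ⟨γ, hγ, k, hk, rfl⟩ := DoubleCoset.rel_iff.mp hgg'
    obtain ⟨h, hh, z, hz, rfl⟩ := Subgroup.mem_sup_of_normal_right.mp hk
    have e1 : heckeRow Γ H d (γ * g * (h * z)) = heckeRow Γ H d (g * h) := by
      refine finsum_congr fun x => ?_
      rw [← mul_assoc, translate_mul_center _ _ _ _ hz, mul_assoc, translate_mul_left _ _ _ _ hγ]
    rw [e1]
    exact (heckeRow_mul_right Γ H d g ⟨h, hh⟩).symm) s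

/-- The adjacency operator `L_{P₁}` on `C(Γ \ G / P₁ Z)`. -/
def LP1 (Γ : Subgroup (PGSp4 F)) (ϖ : Fˣ) :
    (CosetSpace Γ (P1 F) → ℂ) →ₗ[ℂ] (CosetSpace Γ (P1 F) → ℂ) := heckeOp Γ (P1 F) (d1 ϖ)

/-- The adjacency operator `L_{P₂}` on `C(Γ \ G / P₂ Z)`. -/
def LP2 (Γ : Subgroup (PGSp4 F)) (ϖ : Fˣ) :
    (CosetSpace Γ (P2 F) → ℂ) →ₗ[ℂ] (CosetSpace Γ (P2 F) → ℂ) := heckeOp Γ (P2 F) (d2 ϖ)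

/-! ### The building of `Sp₄(F)` -/

/-- The lattices in `V = F⁴`. -/
def VLattice (F : Type*) [Field F] [ValuativeRel F] : Type _ :=
  {L : Submodule 𝒪[F] (Fin 4 → F) // L.FG ∧ Submodule.span F (L : Set (Fin 4 → F)) = ⊤}

/-- The `𝒪`-linear map `x ↦ g x` on `V`. -/
def actMap (g : GL (Fin 4) F) : (Fin 4 → F) →ₗ[𝒪[F]] (Fin 4 → F) :=
  (Matrix.mulVecLin (g : Matrix (Fin 4) (Fin 4) F)).restrictScalars 𝒪[F]

/-- `GL₄(F)` acts on lattices by `L ↦ g L`. -/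
instance : MulAction (GL (Fin 4) F) (VLattice F) where
  smul g L := ⟨L.1.map (actMap g), L.2.1.map _, by
    have h1 : Submodule.span F ((L.1.map (actMap g) : Submodule 𝒪[F] (Fin 4 → F)) :
        Set (Fin 4 → F)) = (Submodule.span F (L.1 : Set (Fin 4 → F))).map
          (Matrix.mulVecLin (g : Matrix (Fin 4) (Fin 4) F)) := by
      rw [Submodule.map_span]; rfl
    rw [h1, L.2.2, Submodule.map_top, LinearMap.range_eq_top]
    intro y
    refine ⟨((g⁻¹ : GL (Fin 4) F) : Matrix (Fin 4) (Fin 4) F).mulVec y, ?_⟩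
    rw [Matrix.mulVecLin_apply, Matrix.mulVec_mulVec, ← Units.val_mul, mul_inv_cancel,
      Units.val_one, Matrix.one_mulVec]⟩
  one_smul L := by
    apply Subtype.ext
    change L.1.map (actMap 1) = L.1
    have h : actMap (1 : GL (Fin 4) F) = LinearMap.id := by
      ext1; simp [actMap]
    rw [h, Submodule.map_id]
  mul_smul g h L := by
    apply Subtype.ext
    change L.1.map (actMap (g * h)) = (L.1.map (actMap h)).map (actMap g)
    rw [← Submodule.map_comp]
    congr 1
    ext1
    simp [actMap]

/-- Homothety of lattices: `L' = α L` for some `α ∈ Fˣ`. -/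
def homothety (F : Type*) [Field F] [ValuativeRel F] : Setoid (VLattice F) where
  r L L' := ∃ α : Fˣ, L' = scalarGL α • L
  iseqv :=
    { refl := fun L => ⟨1, by simp [scalarGL]⟩
      symm := by
        rintro L L' ⟨α, rfl⟩
        refine ⟨α⁻¹, ?_⟩
        have h : scalarGL α⁻¹ = (scalarGL α)⁻¹ := map_inv _ _
        rw [h, inv_smul_smul]
      trans := by
        rintro L L' L'' ⟨α, rfl⟩ ⟨β, rfl⟩
        refine ⟨β * α, ?_⟩
        have h : scalarGL (β * α) = scalarGL β * scalarGL α := map_mul _ _ _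
        rw [h, mul_smul] }

/-- Homothety classes of lattices in `V`. -/
def LatticeClass (F : Type*) [Field F] [ValuativeRel F] : Type _ := Quotient (homothety F)

/-- The homothety class `[L]`. -/
def VLattice.cls (L : VLattice F) : LatticeClass F := Quotient.mk (homothety F) L

theorem scalarGL_comm {F : Type*} [Field F] (g : GL (Fin 4) F) (z : Fˣ) :
    g * scalarGL z = scalarGL z * g := by
  apply Units.ext
  exact ((Matrix.scalar_commute (z : F) (fun r => Commute.all _ r)
    (g : Matrix (Fin 4) (Fin 4) F)).eq).symm

/-- `GL₄(F)` acts on homothety classes by `g [L] = [g L]`. -/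
instance : MulAction (GL (Fin 4) F) (LatticeClass F) where
  smul g := Quotient.map (fun L => g • L) (by
    rintro L L' ⟨α, rfl⟩
    exact ⟨α, by rw [← mul_smul, ← mul_smul, scalarGL_comm]⟩)
  one_smul v := by
    induction v using Quotient.inductionOn with
    | _ L => exact congrArg VLattice.cls (one_smul _ L)
  mul_smul g h v := by
    induction v using Quotient.inductionOn with
    | _ L => exact congrArg VLattice.cls (mul_smul g h L)

/-- `L` is primitive: `⟨L, L⟩ ⊆ 𝒪` and the form induced on `L / πL` is nondegenerate. -/
def IsPrimitive (L : VLattice F) : Prop :=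
  (∀ x ∈ L.1, ∀ y ∈ L.1, form x y ∈ 𝒪[F]) ∧
  ∀ x ∈ L.1, (∀ y ∈ L.1, ∃ c ∈ 𝓂[F], (c : F) = form x y) → x ∈ 𝓂[F] • L.1

/-- `πL ⊆ L' ⊆ L`. -/
def Between (L' L : VLattice F) : Prop := 𝓂[F] • L.1 ≤ L'.1 ∧ L'.1 ≤ L.1

/-- `L'` is incident to the primitive lattice `L`: `πL ⊆ L' ⊆ L` and `⟨L', L'⟩` is contained in
the maximal ideal of `𝒪`. -/
def Incident (L' L : VLattice F) : Prop :=
  IsPrimitive L ∧ Between L' L ∧ ∀ x ∈ L'.1, ∀ y ∈ L'.1, ∃ c ∈ 𝓂[F], (c : F) = form x y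

/-- The vertices of the building `X` of `Sp₄(F)`: homothety classes of primitive lattices and of
lattices incident to primitive ones. -/
def Vertex (F : Type*) [Field F] [ValuativeRel F] : Type _ :=
  {v : LatticeClass F // ∃ L : VLattice F, L.cls = v ∧ (IsPrimitive L ∨ ∃ L₀, Incident L L₀)}

/-- Two (distinct) vertices are joined by an edge of `X` if they are represented by lattices
`L', L''`, one contained in the other, with `πL ⊆ L', L'' ⊆ L` for some primitive `L`. -/
def Adj (v w : Vertex F) : Prop :=
  v ≠ w ∧ ∃ L' L'' L : VLattice F, L'.cls = v.1 ∧ L''.cls = w.1 ∧ (L'.1 ≤ L''.1 ∨ L''.1 ≤ L'.1) ∧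
    IsPrimitive L ∧ Between L' L ∧ Between L'' L

/-- The directed edges of `X`. -/
def DEdge (F : Type*) [Field F] [ValuativeRel F] : Type _ :=
  {e : Vertex F × Vertex F // Adj e.1 e.2}

/-! ### Apartments and geodesics -/

/-- `b = (u₁, u₂, w₁, w₂)` is a symplectic basis of `V`. -/
def IsSymplecticBasis (b : Fin 4 → Fin 4 → F) : Prop :=
  ∀ i j, form (b i) (b j) = J F i j

/-- `HasCoord ϖ b v a` says that `v` lies in the apartment of the symplectic basis
`b = (u₁, u₂, w₁, w₂)` and
`v = [𝒪 ϖ^{a₁} u₁ + 𝒪 ϖ^{a₂} u₂ + 𝒪 ϖ^{b₁} w₁ + 𝒪 ϖ^{b₂} w₂]` with `a = (a₁, a₂, b₁, b₂)`. -/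
def HasCoord (ϖ : Fˣ) (b : Fin 4 → Fin 4 → F) (v : Vertex F) (a : Fin 4 → ℤ) : Prop :=
  ∃ L : VLattice F, L.cls = v.1 ∧
    L.1 = Submodule.span 𝒪[F] (Set.range fun i => ((ϖ ^ a i : Fˣ) : F) • b i)

/-- The position of the vertex `[a₁, a₂, b₁, b₂]` in the Euclidean plane underlying the apartment,
in Cartesian coordinates (scaled so that the legs of a chamber have length `1`). It depends
only on the homothety class, and e.g. the chamber `[0,0,0,0], [0,1,1,1], [0,0,1,1]` is the
isosceles right triangle `(0,0), (1,0), (1,1)`. -/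
def position (a : Fin 4 → ℤ) : ℤ × ℤ := (a 3 - a 0, a 2 - a 1)

/-- The vertices `v 0, …, v n` are the successive vertices of a path that runs along a straight
line, without turning back, in some apartment of `X`. -/
def IsStraight (ϖ : Fˣ) (n : ℕ) (v : ℕ → Vertex F) : Prop :=
  ∃ b : Fin 4 → Fin 4 → F, IsSymplecticBasis b ∧
  ∃ a : ℕ → Fin 4 → ℤ, (∀ i ≤ n, HasCoord ϖ b (v i) (a i)) ∧
  ∃ d : ℤ × ℤ, d ≠ 0 ∧ ∀ i < n, ∃ k : ℕ, 0 < k ∧ position (a (i + 1)) = position (a i) + k • d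

/-! ### The quotient `X_Γ` and its zeta function -/

/-- `Γ`-equivalence of vertices of `X`. -/
def vertexRel (Γ : Subgroup (PGSp4 F)) : Setoid (Vertex F) where
  r v w := ∃ g ∈ preim Γ, (g : GL (Fin 4) F) • v.1 = w.1
  iseqv :=
    { refl := fun v => ⟨1, one_mem _, by simp⟩
      symm := by
        rintro v w ⟨g, hg, h⟩
        exact ⟨g⁻¹, inv_mem hg, by rw [← h, Subgroup.coe_inv, inv_smul_smul]⟩
      trans := by
        rintro u v w ⟨g, hg, h⟩ ⟨k, hk, h'⟩
        exact ⟨k * g, mul_mem hk hg, by rw [Subgroup.coe_mul, mul_smul, h, h']⟩ }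

/-- `Γ`-equivalence of directed edges of `X`. -/
def edgeRel (Γ : Subgroup (PGSp4 F)) : Setoid (DEdge F) where
  r e e' := ∃ g ∈ preim Γ, (g : GL (Fin 4) F) • e.1.1.1 = e'.1.1.1 ∧
    (g : GL (Fin 4) F) • e.1.2.1 = e'.1.2.1
  iseqv :=
    { refl := fun e => ⟨1, one_mem _, by simp⟩
      symm := by
        rintro v w ⟨g, hg, h1, h2⟩
        exact ⟨g⁻¹, inv_mem hg, by rw [← h1, Subgroup.coe_inv, inv_smul_smul],
          by rw [← h2, Subgroup.coe_inv, inv_smul_smul]⟩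
      trans := by
        rintro u v w ⟨g, hg, h1, h2⟩ ⟨k, hk, h1', h2'⟩
        exact ⟨k * g, mul_mem hk hg, by rw [Subgroup.coe_mul, mul_smul, h1, h1'],
          by rw [Subgroup.coe_mul, mul_smul, h2, h2']⟩ }

/-- The vertices of `X_Γ = Γ \ X`. -/
def QVertex (Γ : Subgroup (PGSp4 F)) : Type _ := Quotient (vertexRel Γ)

/-- The directed edges of `X_Γ = Γ \ X`. Distinct edges may have the same end points. -/
def QEdge (Γ : Subgroup (PGSp4 F)) : Type _ := Quotient (edgeRel Γ)

/-- The initial vertex of a directed edge of `X_Γ`. -/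
def QEdge.src {Γ : Subgroup (PGSp4 F)} : QEdge Γ → QVertex Γ :=
  Quotient.map (fun e => e.1.1) (by rintro e e' ⟨g, hg, h1, -⟩; exact ⟨g, hg, h1⟩)

/-- The terminal vertex of a directed edge of `X_Γ`. -/
def QEdge.tgt {Γ : Subgroup (PGSp4 F)} : QEdge Γ → QVertex Γ :=
  Quotient.map (fun e => e.1.2) (by rintro e e' ⟨g, hg, -, h2⟩; exact ⟨g, hg, h2⟩)

/-- The list `c = (e₁, …, eₙ)` of directed edges of `X_Γ` is a cycle (with starting point and
orientation): `n ≥ 1` and the end of every edge is the start of the (cyclically) next one. -/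
def IsCycle {Γ : Subgroup (PGSp4 F)} (c : List (QEdge Γ)) : Prop :=
  c ≠ [] ∧ (c : Cycle (QEdge Γ)).Chain fun e e' => e.tgt = e'.src

/-- The edge path `c` in `X_Γ` lifts to a geodesic path in `X`. -/
def IsGeodesic (ϖ : Fˣ) {Γ : Subgroup (PGSp4 F)} (c : List (QEdge Γ)) : Prop :=
  ∃ v : ℕ → Vertex F,
    (∀ (i : ℕ) (hi : i < c.length), ∃ h : Adj (v i) (v (i + 1)),
      c.get ⟨i, hi⟩ = (Quotient.mk (edgeRel Γ) ⟨(v i, v (i + 1)), h⟩ : QEdge Γ)) ∧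
    IsStraight ϖ c.length v

/-- A tailless geodesic cycle: a cycle that is geodesic, also after any shift of its starting
vertex. -/
def IsTaillessGeodesicCycle (ϖ : Fˣ) {Γ : Subgroup (PGSp4 F)} (c : List (QEdge Γ)) : Prop :=
  IsCycle c ∧ ∀ k : ℕ, IsGeodesic ϖ (c.rotate k)

/-- A cycle is primitive if it is not obtained by repeating a cycle more than once. -/
def IsPrimitiveCycle {Γ : Subgroup (PGSp4 F)} (c : List (QEdge Γ)) : Prop :=
  ¬ ∃ (d : List (QEdge Γ)) (m : ℕ), 2 ≤ m ∧ IsCycle d ∧ c = (List.replicate m d).flatten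

/-- The equivalence classes `[C]` (under shifting the starting vertex) of primitive tailless
geodesic cycles in the `1`-skeleton of `X_Γ`. -/
def PrimeCycle (ϖ : Fˣ) (Γ : Subgroup (PGSp4 F)) : Type _ :=
  {C : Cycle (QEdge Γ) // ∃ c : List (QEdge Γ), (c : Cycle (QEdge Γ)) = C ∧
    IsTaillessGeodesicCycle ϖ c ∧ IsPrimitiveCycle c}

/-- The Euler factor `(1 - u^{l([C])})⁻¹` where `l([C])` is the number of edges. -/
def eulerFactor (ϖ : Fˣ) (Γ : Subgroup (PGSp4 F)) (u : ℂ) (C : PrimeCycle ϖ Γ) : ℂ :=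
  (1 - u ^ C.1.length)⁻¹

/-- The zeta function `Z(X_Γ, u) = ∏_{[C]} (1 - u^{l([C])})⁻¹`. -/
def zeta (ϖ : Fˣ) (Γ : Subgroup (PGSp4 F)) (u : ℂ) : ℂ :=
  ∏' C : PrimeCycle ϖ Γ, eulerFactor ϖ Γ u C

end LocalField

end Sp4Zeta

end

/-!
The zeta function is that of a finite directed graph, whose vertices are the directed edges of
`X_Γ` and whose arrows are the geodesic steps, and the two determinants are the blocks of its
adjacency matrix.

**Geodesics are walks.** A straight edge path in an apartment runs either along hypotenuses or along
legs of chambers. Up to the Weyl group and translations it is one of the lines `lineC ϖ τ g`, with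
`τ : Bool` the direction and `g` a similitude whose columns span the apartment
(`Straight3.isLine3`). That being geodesic is a local property, a relation `GeoStep` between
successive edges, rests on `exists_splice`: two lines through a common edge can be spliced at that
edge. For if `g` and `h` define the two lines, then up to scalars `g⁻¹ h` stabilizes the edge, and
by the Iwahori factorization (`exists_siegelU`, `exists_klingenU`) it is a product `u p` of an element
`u` of the opposite unipotent radical and an element `p` of the parabolic subgroup. The first
stabilizes the line before the edge, the second the line after it, so `g u` defines the spliced
line. Consequently the tailless geodesic cycles of `X_Γ` are exactly the closed walks of `GeoStep`
(`isTaillessGeodesicCycle_iff`). Loops, which are not geodesic after repetition, are excluded since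
`Γ` preserves the volume of lattices modulo `4`, up to homothety.

**Primes of a finite graph.** For a relation `T` on a finite type, the trace of `A ^ n`, for `A` the
`0`-`1` matrix of `T`, counts closed walks of length `n`. A closed walk is a power of a unique
primitive one, which has as many rotations as letters, and exponentiating the sum of
`tr (A ^ n) u ^ n / n` gives the Euler product over primitive walks up to rotation
(`exists_hasProd_primeWalk`).

**Hecke operators.** The congruence subgroup `P₁` or `P₂`, times the center, is the stabilizer of
the first edge of a line (`edge_eq_iff`), so `Γ \ G / P Z` is a set of directed edges of `X_Γ`: the
hypotenuses for `P₁` and the legs that start at a special vertex for `P₂`. It is finite because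
`Γ` is cocompact. The cosets in `P₁ d₁ P₁ / P₁` correspond to the continuations of a hypotenuse by
one step, those in `P₂ d₂ P₂ / P₂` to the continuations of a leg by two steps (`card_fiber_false`,
`card_fiber_true`). Modulo `Γ` they stay distinct since `Γ`, being discrete and torsion-free, acts
freely on the vertices (`mem_Z_of_fixes`). A leg that starts at a special vertex is followed by one
that ends at a special vertex and conversely, so the adjacency matrix has the diagonal blocks
`L_{P₁}` and `(0, B; C, 0)` with `B C = L_{P₂}`, and the determinant of `1 - u A` is
`det (1 - u L_{P₁}) det (1 - u² B C)`.
-/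

open scoped ValuativeRel

noncomputable section

namespace Sp4Zeta

open ValuativeRel
open scoped Matrix

set_option linter.unusedSectionVars false

/-! ### Traces of powers and the determinant -/

section Det

open Polynomial

variable {n : Type*} [Fintype n] [DecidableEq n]

theorem det_sub_scalar_eq_prod_roots (A : Matrix n n ℂ) (t : ℂ) :
    (A - Matrix.scalar n t).det = (A.charpoly.roots.map fun x => x - t).prod := by
  have h1 : (Matrix.scalar n t - A).det = A.charpoly.eval t := by
    rw [Matrix.eval_charpoly]
  have h2 : A.charpoly.eval t = (A.charpoly.roots.map fun x => t - x).prod := by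
    conv_lhs => rw [(IsAlgClosed.splits A.charpoly).eq_prod_roots_of_monic A.charpoly_monic]
    rw [eval_multiset_prod, Multiset.map_map]
    simp
  have hc : Multiset.card A.charpoly.roots = Fintype.card n := by
    rw [← (IsAlgClosed.splits A.charpoly).natDegree_eq_card_roots,
      Matrix.charpoly_natDegree_eq_dim]
  have h3 : (A.charpoly.roots.map fun x => x - t).prod =
      (-1) ^ (Multiset.card A.charpoly.roots) * (A.charpoly.roots.map fun x => t - x).prod := by
    have : (A.charpoly.roots.map fun x => x - t) =
        (A.charpoly.roots.map fun x => t - x).map Neg.neg := by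
      rw [Multiset.map_map]; simp
    rw [this, Multiset.prod_map_neg]; simp
  rw [h3, ← h2, ← h1, ← neg_sub, Matrix.det_neg, hc]

theorem det_aeval_eq_prod_roots (A : Matrix n n ℂ) (p : ℂ[X]) :
    (aeval A p).det = (A.charpoly.roots.map fun x => p.eval x).prod := by
  have hc : Multiset.card A.charpoly.roots = Fintype.card n := by
    rw [← (IsAlgClosed.splits A.charpoly).natDegree_eq_card_roots,
      Matrix.charpoly_natDegree_eq_dim]
  have key : ∀ s : Multiset ℂ, (aeval A (s.map fun a => X - C a).prod).det =
      (A.charpoly.roots.map fun x => ((s.map fun a => X - C a).prod).eval x).prod := by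
    intro s
    induction s using Multiset.induction_on with
    | empty => simp
    | cons a s ih =>
      simp only [Multiset.map_cons, Multiset.prod_cons, map_mul, Matrix.det_mul, ih, eval_mul,
        Multiset.prod_map_mul, map_sub, aeval_X, aeval_C, eval_sub, eval_X, eval_C]
      congr 1
      exact det_sub_scalar_eq_prod_roots A a
  have hp : p = C p.leadingCoeff * (p.roots.map fun a => X - C a).prod :=
    (IsAlgClosed.splits p).eq_prod_roots
  rw [hp]
  simp only [map_mul, Matrix.det_mul, key, eval_mul, Multiset.prod_map_mul, aeval_C, eval_C]
  congr 1
  rw [Multiset.map_const', Multiset.prod_replicate, hc]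
  simp [Matrix.algebraMap_eq_diagonal, Matrix.det_diagonal]

theorem det_one_sub_smul_eq_prod_roots (A : Matrix n n ℂ) (u : ℂ) :
    (1 - u • A).det = (A.charpoly.roots.map fun x => 1 - u * x).prod := by
  have := det_aeval_eq_prod_roots A (1 - C u * X)
  simpa [Algebra.smul_def] using this

/-- The trace is read off as the coefficient of `X` in `det (1 + X Aᵏ)`. -/
theorem trace_pow_eq_sum_roots (A : Matrix n n ℂ) (k : ℕ) :
    (A ^ k).trace = (A.charpoly.roots.map fun x => x ^ k).sum := by
  have h1 : ∀ t : ℂ, (1 + t • A ^ k).det = (A.charpoly.roots.map fun x => 1 + t * x ^ k).prod := by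
    intro t
    have := det_aeval_eq_prod_roots A (1 + C t * X ^ k)
    simpa [Algebra.smul_def] using this
  have h2 : (1 + (X : ℂ[X]) • (A ^ k).map C).det =
      (A.charpoly.roots.map fun x => 1 + X * C (x ^ k)).prod := by
    apply Polynomial.funext
    intro t
    rw [eval_multiset_prod, Multiset.map_map]
    have e : eval t ((1 + (X : ℂ[X]) • (A ^ k).map C).det) = (1 + t • A ^ k).det := by
      rw [← coe_evalRingHom, RingHom.map_det]
      congr 1
      ext i j
      by_cases hij : i = j <;> simp [hij, mul_comm t]
    rw [e, h1]
    simp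
  have h3 : ∀ s : Multiset ℂ, ((s.map fun x => 1 + X * C x).prod).coeff 0 = 1 ∧
      ((s.map fun x => (1 : ℂ[X]) + X * C x).prod).coeff 1 = s.sum := by
    intro s
    induction s using Multiset.induction_on with
    | empty => simp [coeff_one]
    | cons a s ih =>
      obtain ⟨i0, i1⟩ := ih
      simp only [Multiset.map_cons, Multiset.prod_cons, Multiset.sum_cons]
      refine ⟨?_, ?_⟩
      · rw [mul_coeff_zero, i0]; simp
      · rw [add_mul, one_mul, coeff_add, i1, mul_assoc, coeff_X_mul, coeff_C_mul, i0]; ring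
  have h4 := congrArg (fun p => coeff p 1) h2
  simp only [Matrix.coeff_det_one_add_X_smul_one] at h4
  rw [h4]
  have := (h3 (A.charpoly.roots.map fun x => x ^ k)).2
  rw [Multiset.map_map] at this
  exact this

/-- For small `u`, the power series `∑ tr(Aᵏ) uᵏ / k` is a logarithm of `1 / det (1 - u A)`. -/
theorem exists_log_det_one_sub_smul (A : Matrix n n ℂ) :
    ∃ r : ℝ, 0 < r ∧ ∀ u : ℂ, ‖u‖ < r → (1 - u • A).det ≠ 0 ∧
      ∃ S : ℂ, HasSum (fun k : ℕ => (A ^ k).trace * u ^ k / k) S ∧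
        Complex.exp S = ((1 - u • A).det)⁻¹ := by
  obtain ⟨M, hM0, hM⟩ : ∃ M : ℝ, 0 < M ∧ ∀ x ∈ A.charpoly.roots, ‖x‖ < M := by
    refine ⟨(A.charpoly.roots.map fun x => ‖x‖).sum + 1, ?_, fun x hx => ?_⟩
    · have : 0 ≤ (A.charpoly.roots.map fun x => ‖x‖).sum :=
        Multiset.sum_nonneg (by simp only [Multiset.mem_map]; rintro _ ⟨x, -, rfl⟩; positivity)
      linarith
    · have : ‖x‖ ≤ (A.charpoly.roots.map fun x => ‖x‖).sum :=
        Multiset.single_le_sum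
          (by simp only [Multiset.mem_map]; rintro _ ⟨x, -, rfl⟩; positivity) _ (Multiset.mem_map_of_mem _ hx)
      linarith
  refine ⟨M⁻¹, inv_pos.mpr hM0, fun u hu => ?_⟩
  have hsmall : ∀ x ∈ A.charpoly.roots, ‖u * x‖ < 1 := by
    intro x hx
    rw [norm_mul]
    calc ‖u‖ * ‖x‖ ≤ ‖u‖ * M := by gcongr; exact (hM x hx).le
      _ < M⁻¹ * M := by gcongr
      _ = 1 := inv_mul_cancel₀ hM0.ne'
  rw [det_one_sub_smul_eq_prod_roots]
  simp only [trace_pow_eq_sum_roots]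
  have key : ∀ s : Multiset ℂ, (∀ x ∈ s, ‖u * x‖ < 1) →
      (s.map fun x => 1 - u * x).prod ≠ 0 ∧
      ∃ S : ℂ, HasSum (fun k : ℕ => (s.map fun x => x ^ k).sum * u ^ k / k) S ∧
        Complex.exp S = ((s.map fun x => 1 - u * x).prod)⁻¹ := by
    intro s
    induction s using Multiset.induction_on with
    | empty => exact fun _ => ⟨by simp, 0, by simp [hasSum_zero], by simp⟩
    | cons a s ih =>
      intro hs
      obtain ⟨h0, S, hS, hexp⟩ := ih fun x hx => hs x (Multiset.mem_cons_of_mem hx)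
      have ha := hs a (Multiset.mem_cons_self a s)
      have hne : 1 - u * a ≠ 0 := by
        intro h
        rw [sub_eq_zero] at h
        rw [← h] at ha
        simp at ha
      refine ⟨by simpa [hne] using h0, -Complex.log (1 - u * a) + S, ?_, ?_⟩
      · convert! (Complex.hasSum_taylorSeries_neg_log ha).add hS using 2 with k
        rw [Multiset.map_cons, Multiset.sum_cons, mul_pow]
        ring
      · rw [Complex.exp_add, Complex.exp_neg, Complex.exp_log hne, hexp, Multiset.map_cons,
          Multiset.prod_cons, mul_inv]
  exact key _ hsmall

end Det

/-! ### Rotations of words and closed walks -/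

section Walks

variable {α : Type*}

theorem iterate_rotate_one (c : List α) (i : ℕ) : (fun l : List α => l.rotate 1)^[i] c = c.rotate i := by
  induction i with
  | zero => simp
  | succ i ih => rw [Function.iterate_succ_apply', ih, List.rotate_rotate]

theorem rotate_flatten_replicate (d : List α) (k i : ℕ) :
    (List.replicate k d).flatten.rotate i = (List.replicate k (d.rotate i)).flatten := by
  induction i generalizing d with
  | zero => simp
  | succ i ih =>
    rw [add_comm i 1, ← List.rotate_rotate, ← List.rotate_rotate, ← ih]
    congr 1
    cases d with
    | nil => simp
    | cons a t =>
      have h : ∀ k, t ++ (List.replicate k (a :: t)).flatten ++ [a] =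
          (List.replicate (k + 1) (t ++ [a])).flatten := by
        intro k
        induction k with
        | zero => simp
        | succ k ih =>
          rw [List.replicate_succ (n := k + 1), List.flatten_cons, ← ih]
          simp [List.replicate_succ]
      cases k with
      | zero => simp
      | succ k =>
        rw [List.replicate_succ, List.flatten_cons, List.cons_append, List.rotate_cons_succ,
          List.rotate_zero, List.rotate_cons_succ, List.rotate_zero]
        exact h k

theorem length_flatten_replicate (d : List α) (k : ℕ) :
    (List.replicate k d).flatten.length = k * d.length := by
  simp

theorem flatten_replicate_inj {d d' : List α} {k : ℕ} (hl : d.length = d'.length)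
    (h : (List.replicate (k + 1) d).flatten = (List.replicate (k + 1) d').flatten) : d = d' := by
  simp only [List.replicate_succ, List.flatten_cons] at h
  exact (List.append_inj h hl).1

theorem eq_flatten_replicate_of_append_comm {a : List α} (k : ℕ) {b : List α}
    (hl : b.length = k * a.length) (h : a ++ b = b ++ a) :
    b = (List.replicate k a).flatten := by
  induction k generalizing b with
  | zero => simpa using hl
  | succ k ih =>
    have hle : a.length ≤ b.length := by rw [hl]; nlinarith
    obtain ⟨b', rfl⟩ := List.prefix_of_prefix_length_le (l₃ := a ++ b) ⟨b, rfl⟩ ⟨a, h.symm⟩ hle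
    rw [List.append_assoc] at h
    rw [List.replicate_succ, List.flatten_cons, ← ih (by simp at hl; linarith)
      (List.append_cancel_left h)]

/-- The least period of a word under rotation. -/
noncomputable abbrev rotPeriod (c : List α) : ℕ :=
  Function.minimalPeriod (fun l : List α => l.rotate 1) c

theorem isPeriodicPt_rotate_iff (c : List α) (i : ℕ) :
    Function.IsPeriodicPt (fun l : List α => l.rotate 1) i c ↔ c.rotate i = c := by
  rw [Function.IsPeriodicPt, Function.IsFixedPt, iterate_rotate_one]

theorem rotPeriod_dvd_length (c : List α) : rotPeriod c ∣ c.length :=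
  Function.IsPeriodicPt.minimalPeriod_dvd ((isPeriodicPt_rotate_iff c _).mpr c.rotate_length)

theorem rotPeriod_pos {c : List α} (hc : c ≠ []) : 0 < rotPeriod c :=
  Function.IsPeriodicPt.minimalPeriod_pos (List.length_pos_iff.mpr hc)
    ((isPeriodicPt_rotate_iff c _).mpr c.rotate_length)

theorem rotPeriod_flatten_replicate (d : List α) (k : ℕ) :
    rotPeriod (List.replicate (k + 1) d).flatten = rotPeriod d := by
  apply Nat.dvd_antisymm <;> apply Function.IsPeriodicPt.minimalPeriod_dvd <;>
    rw [isPeriodicPt_rotate_iff]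
  · rw [rotate_flatten_replicate, (isPeriodicPt_rotate_iff d _).mp
      (Function.isPeriodicPt_minimalPeriod _ _)]
  · have h := (isPeriodicPt_rotate_iff _ _).mp (Function.isPeriodicPt_minimalPeriod
      (fun l : List α => l.rotate 1) (List.replicate (k + 1) d).flatten)
    rw [rotate_flatten_replicate] at h
    exact flatten_replicate_inj (by simp) h

/-- A word is primitive if it is not a proper power of another word. -/
def IsPrimitiveWord (c : List α) : Prop :=
  ¬ ∃ (d : List α) (m : ℕ), 2 ≤ m ∧ d ≠ [] ∧ c = (List.replicate m d).flatten

theorem eq_flatten_replicate_take_rotPeriod (c : List α) (hc : c ≠ []) :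
    ∃ k, c = (List.replicate (k + 1) (c.take (rotPeriod c))).flatten ∧
      (c.take (rotPeriod c)).length = rotPeriod c := by
  set r := rotPeriod c with hr
  have hr0 : 0 < r := rotPeriod_pos hc
  obtain ⟨k, hk⟩ := rotPeriod_dvd_length c
  rw [← hr] at hk
  have hk0 : k ≠ 0 := by
    rintro rfl
    exact hc (List.length_eq_zero_iff.mp (by simpa using hk))
  obtain ⟨k, rfl⟩ := Nat.exists_eq_succ_of_ne_zero hk0
  have hrl : r ≤ c.length := by rw [hk]; nlinarith
  have hlen : (c.take r).length = r := by simp [hrl]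
  refine ⟨k, ?_, hlen⟩
  have hrot : c.rotate r = c :=
    (isPeriodicPt_rotate_iff c _).mp (Function.isPeriodicPt_minimalPeriod _ _)
  rw [List.rotate_eq_drop_append_take hrl] at hrot
  have hb := eq_flatten_replicate_of_append_comm (a := c.take r) (b := c.drop r) k
    (by rw [hlen, List.length_drop, hk, Nat.succ_eq_add_one, mul_add, mul_one, mul_comm]; omega)
    (by rw [hrot, List.take_append_drop])
  rw [List.replicate_succ, List.flatten_cons, ← hb, List.take_append_drop]

theorem isPrimitiveWord_iff {c : List α} (hc : c ≠ []) :
    IsPrimitiveWord c ↔ rotPeriod c = c.length := by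
  constructor
  · intro h
    obtain ⟨k, hk, hl⟩ := eq_flatten_replicate_take_rotPeriod c hc
    have hk0 : k = 0 := by
      by_contra hk0
      refine h ⟨_, k + 1, by omega, ?_, hk⟩
      rw [← List.length_pos_iff, hl]
      exact rotPeriod_pos hc
    subst hk0
    have := congrArg List.length hk
    rw [length_flatten_replicate, hl] at this
    omega
  · rintro h ⟨d, m, hm, hd, rfl⟩
    obtain ⟨k, rfl⟩ : ∃ k, m = k + 1 := ⟨m - 1, by omega⟩
    rw [rotPeriod_flatten_replicate, length_flatten_replicate] at h
    have h1 := Nat.le_of_dvd (List.length_pos_iff.mpr hd) (rotPeriod_dvd_length d)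
    have h2 := List.length_pos_iff.mpr hd
    nlinarith

/-- The closed walks of the relation `T`: nonempty words whose cyclically consecutive letters are
related. -/
def IsClosedWalk (T : α → α → Prop) (c : List α) : Prop := c ≠ [] ∧ (c : Cycle α).Chain T

theorem isClosedWalk_iff_getElem (T : α → α → Prop) (w : List α) :
    IsClosedWalk T w ↔ w ≠ [] ∧ ∀ (i : ℕ) (hi : i < w.length),
      T w[i] (w[(i + 1) % w.length]'(Nat.mod_lt _ (by omega))) := by
  refine and_congr_right fun hc => ?_
  obtain ⟨a, l, rfl⟩ := List.exists_cons_of_ne_nil hc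
  rw [Cycle.chain_coe_cons, List.isChain_iff_getElem]
  have e : ∀ (i : ℕ) (hi : i < (a :: l).length),
      (a :: (l ++ [a]))[i + 1]'(by simp at hi ⊢; omega) =
        (a :: l)[(i + 1) % (a :: l).length]'(Nat.mod_lt _ (by omega)) := by
    intro i hi
    simp only [List.length_cons] at hi
    rcases Nat.lt_or_ge (i + 1) (l.length + 1) with h | h
    · simp [Nat.mod_eq_of_lt h, show i < l.length by omega]
    · obtain rfl : i = l.length := by omega
      simp
  have e' : ∀ (i : ℕ) (hi : i < (a :: l).length),
      (a :: (l ++ [a]))[i]'(by simp at hi ⊢; omega) = (a :: l)[i] := by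
    intro i hi
    simp only [← List.cons_append]
    rw [List.getElem_append_left]
  constructor
  · intro h i hi
    have := h i (by simp at hi ⊢; omega)
    rwa [e i hi, e' i hi] at this
  · intro h i hi
    have hi' : i < (a :: l).length := by simp at hi ⊢; omega
    have := h i hi'
    rwa [← e i hi', ← e' i hi'] at this

theorem getElem_flatten_replicate (d : List α) (k i : ℕ)
    (hi : i < (List.replicate k d).flatten.length) :
    (List.replicate k d).flatten[i] = d[i % d.length]'(Nat.mod_lt _ (by
      rw [length_flatten_replicate] at hi
      exact Nat.pos_of_ne_zero fun h => by simp [h] at hi)) := by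
  induction k generalizing i with
  | zero => simp at hi
  | succ k ih =>
    simp only [List.replicate_succ, List.flatten_cons]
    rw [List.getElem_append]
    split_ifs with h
    · simp [Nat.mod_eq_of_lt h]
    · rw [ih]
      congr 1
      exact (Nat.mod_eq_sub_mod (not_lt.mp h)).symm

theorem isClosedWalk_flatten_replicate_iff (T : α → α → Prop) (d : List α) (k : ℕ) :
    IsClosedWalk T (List.replicate (k + 1) d).flatten ↔ IsClosedWalk T d := by
  rw [isClosedWalk_iff_getElem, isClosedWalk_iff_getElem]
  have hne : (List.replicate (k + 1) d).flatten ≠ [] ↔ d ≠ [] := by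
    simp
  rw [hne]
  refine and_congr_right fun hd => ?_
  have hl := List.length_pos_iff.mpr hd
  have hlen := length_flatten_replicate d (k + 1)
  constructor
  · intro h i hi
    have := h i (by rw [hlen]; nlinarith)
    rw [getElem_flatten_replicate, getElem_flatten_replicate] at this
    convert this using 2
    · exact (Nat.mod_eq_of_lt hi).symm
    · rw [hlen, Nat.mod_mul_left_mod]
  · intro h i hi
    rw [getElem_flatten_replicate, getElem_flatten_replicate]
    convert h (i % d.length) (Nat.mod_lt _ hl) using 2
    rw [hlen, Nat.mod_mul_left_mod, Nat.mod_add_mod]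

end Walks

/-! ### Counting closed walks -/

section Count

variable {α : Type*} [Fintype α] [DecidableEq α]

open Classical in
/-- The `0`-`1` matrix of a relation. -/
noncomputable def relMatrix (T : α → α → Prop) : Matrix α α ℂ := fun x y => if T x y then 1 else 0

instance finite_list_length (n : ℕ) (P : List α → Prop) :
    Finite {c : List α // c.length = n ∧ P c} :=
  ((List.finite_length_eq α n).subset fun _ h => h.1 : {c : List α | c.length = n ∧ P c}.Finite)

/-- Powers of the matrix of a relation count its walks; `l` lists the interior vertices. -/
theorem relMatrix_pow_apply (T : α → α → Prop) (n : ℕ) (x y : α) :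
    (relMatrix T ^ (n + 1)) x y =
      Nat.card {l : List α // l.length = n ∧ (x :: (l ++ [y])).IsChain T} := by
  induction n generalizing x with
  | zero =>
    by_cases h : T x y
    · have : Unique {l : List α // l.length = 0 ∧ (x :: (l ++ [y])).IsChain T} :=
        { default := ⟨[], by simp [h]⟩
          uniq := by rintro ⟨l, hl, -⟩; exact Subtype.ext (List.length_eq_zero_iff.mp hl) }
      rw [Nat.card_unique]
      simp [relMatrix, h]
    · have : IsEmpty {l : List α // l.length = 0 ∧ (x :: (l ++ [y])).IsChain T} := by
        refine ⟨?_⟩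
        rintro ⟨l, hl, hc⟩
        obtain rfl := List.length_eq_zero_iff.mp hl
        exact h (by simpa using hc)
      rw [Nat.card_of_isEmpty]
      simp [relMatrix, h]
  | succ n ih =>
    rw [pow_succ', Matrix.mul_apply]
    simp only [ih]
    let e : {l : List α // l.length = n + 1 ∧ (x :: (l ++ [y])).IsChain T} ≃
        Σ z : {z // T x z}, {l : List α // l.length = n ∧ (z.1 :: (l ++ [y])).IsChain T} :=
      { toFun := fun l => match l with
          | ⟨[], h⟩ => absurd h.1 (by simp)
          | ⟨z :: l, h⟩ => ⟨⟨z, (List.isChain_cons_cons.mp h.2).1⟩,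
              ⟨l, by simpa using h.1, (List.isChain_cons_cons.mp h.2).2⟩⟩
        invFun := fun p => ⟨p.1.1 :: p.2.1, by simp [p.2.2.1],
          List.isChain_cons_cons.mpr ⟨p.1.2, p.2.2.2⟩⟩
        left_inv := by
          rintro ⟨_ | ⟨z, l⟩, h⟩
          · exact absurd h.1 (by simp)
          · rfl
        right_inv := by rintro ⟨⟨z, hz⟩, ⟨l, hl⟩⟩; rfl }
    classical
    rw [Nat.card_congr e, Nat.card_sigma]
    push_cast
    have h := Finset.sum_subtype (F := inferInstance) (Finset.univ.filter fun z => T x z) (p := fun z => T x z)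
      (by simp)
      (fun z => (Nat.card {l : List α // l.length = n ∧ (z :: (l ++ [y])).IsChain T} : ℂ))
    rw [← h, Finset.sum_filter]
    exact Finset.sum_congr rfl fun z _ => by simp only [relMatrix]; split_ifs <;> simp

theorem trace_relMatrix_pow (T : α → α → Prop) (n : ℕ) :
    (relMatrix T ^ (n + 1)).trace =
      Nat.card {c : List α // c.length = n + 1 ∧ IsClosedWalk T c} := by
  let e : {c : List α // c.length = n + 1 ∧ IsClosedWalk T c} ≃
      Σ x : α, {l : List α // l.length = n ∧ (x :: (l ++ [x])).IsChain T} :=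
    { toFun := fun l => match l with
        | ⟨[], h⟩ => absurd h.1 (by simp)
        | ⟨x :: l, h⟩ => ⟨x, ⟨l, by simpa using h.1, h.2.2⟩⟩
      invFun := fun p => ⟨p.1 :: p.2.1, by simp [p.2.2.1], by simp, p.2.2.2⟩
      left_inv := by
        rintro ⟨_ | ⟨z, l⟩, h⟩
        · exact absurd h.1 (by simp)
        · rfl
      right_inv := by rintro ⟨x, ⟨l, hl⟩⟩; rfl }
  rw [Nat.card_congr e, Nat.card_sigma, Matrix.trace]
  push_cast
  exact Finset.sum_congr rfl fun x _ => relMatrix_pow_apply T n x x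

end Count

/-! ### The Euler product over primitive closed walks -/

section Euler

variable {α : Type*}

/-- The classes, under rotation, of primitive closed walks of `T`. -/
abbrev PrimeWalk (T : α → α → Prop) : Type _ :=
  {C : Cycle α // ∃ c : List α, (c : Cycle α) = C ∧ IsClosedWalk T c ∧ IsPrimitiveWord c}

theorem IsClosedWalk.of_coe_eq {T : α → α → Prop} {c c' : List α} (h : (c : Cycle α) = c')
    (hc : IsClosedWalk T c) : IsClosedWalk T c' := by
  refine ⟨fun h' => hc.1 ?_, h ▸ hc.2⟩
  subst h'
  simpa using h

theorem rotPeriod_rotate (c : List α) (i : ℕ) : rotPeriod (c.rotate i) = rotPeriod c := by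
  by_cases hc : c = []
  · simp [hc]
  · rw [rotPeriod, ← iterate_rotate_one]
    exact Function.minimalPeriod_apply_iterate (Function.mk_mem_periodicPts
      (List.length_pos_iff.mpr hc) ((isPeriodicPt_rotate_iff c _).mpr c.rotate_length)) i

theorem IsPrimitiveWord.of_coe_eq {c c' : List α} (hc0 : c ≠ []) (h : (c : Cycle α) = c')
    (hc : IsPrimitiveWord c) : IsPrimitiveWord c' := by
  obtain ⟨i, rfl⟩ := Cycle.coe_eq_coe.mp h
  rw [isPrimitiveWord_iff (by simpa using hc0), rotPeriod_rotate, List.length_rotate]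
  exact (isPrimitiveWord_iff hc0).mp hc

/-- A primitive word of length `n` has exactly `n` rotations. -/
theorem card_rotations {c : List α} (hc0 : c ≠ []) (hc : IsPrimitiveWord c) :
    Nat.card {c' : List α // (c' : Cycle α) = c} = c.length := by
  have hp := (isPrimitiveWord_iff hc0).mp hc
  have e : Function.Bijective (fun i : Fin c.length =>
      (⟨c.rotate i, Cycle.coe_eq_coe.mpr ((List.IsRotated.forall c i))⟩ :
        {c' : List α // (c' : Cycle α) = c})) := by
    constructor
    · intro i j hij
      have := congrArg Subtype.val hij
      dsimp only at this
      rw [← iterate_rotate_one, ← iterate_rotate_one] at this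
      exact Fin.ext (Function.iterate_injOn_Iio_minimalPeriod
        (show (i : ℕ) < rotPeriod c by rw [hp]; exact i.2)
        (show (j : ℕ) < rotPeriod c by rw [hp]; exact j.2) this)
    · rintro ⟨c', hc'⟩
      obtain ⟨i, hi⟩ := Cycle.coe_eq_coe.mp hc'.symm
      have hl := List.length_pos_iff.mpr hc0
      refine ⟨⟨i % c.length, Nat.mod_lt _ hl⟩, Subtype.ext ?_⟩
      simp [List.rotate_mod, hi]
  rw [← Nat.card_congr (Equiv.ofBijective _ e), Nat.card_fin]

/-- Every closed walk is, in a unique way, a power of a primitive closed walk. -/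
noncomputable def powEquiv (T : α → α → Prop) :
    {d : List α // IsClosedWalk T d ∧ IsPrimitiveWord d} × ℕ ≃ {c : List α // IsClosedWalk T c} :=
  Equiv.ofBijective
    (fun p => ⟨(List.replicate (p.2 + 1) p.1.1).flatten,
      (isClosedWalk_flatten_replicate_iff T _ _).mpr p.1.2.1⟩) (by
    constructor
    · rintro ⟨⟨d, hd, hdp⟩, k⟩ ⟨⟨d', hd', hdp'⟩, k'⟩ h
      have h := congrArg Subtype.val h
      dsimp only at h
      have hl : d.length = d'.length := by
        rw [← (isPrimitiveWord_iff hd.1).mp hdp, ← (isPrimitiveWord_iff hd'.1).mp hdp',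
          ← rotPeriod_flatten_replicate d k, h, rotPeriod_flatten_replicate]
      have h' := congrArg List.length h
      rw [length_flatten_replicate, length_flatten_replicate, hl] at h'
      have hk := Nat.eq_of_mul_eq_mul_right (List.length_pos_iff.mpr hd'.1) h'
      obtain rfl : k = k' := by omega
      obtain rfl := flatten_replicate_inj hl h
      rfl
    · rintro ⟨c, hc⟩
      obtain ⟨k, hk, hl⟩ := eq_flatten_replicate_take_rotPeriod c hc.1
      have hd : IsClosedWalk T (c.take (rotPeriod c)) :=
        (isClosedWalk_flatten_replicate_iff T _ k).mp (hk ▸ hc)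
      refine ⟨⟨⟨c.take (rotPeriod c), hd, (isPrimitiveWord_iff hd.1).mpr ?_⟩, k⟩,
        Subtype.ext hk.symm⟩
      rw [hl, ← rotPeriod_flatten_replicate _ k, ← hk])

theorem powEquiv_length (T : α → α → Prop)
    (p : {d : List α // IsClosedWalk T d ∧ IsPrimitiveWord d} × ℕ) :
    (powEquiv T p).1.length = (p.2 + 1) * p.1.1.length :=
  length_flatten_replicate _ _

/-- Primitive closed walks, sorted by their classes under rotation. -/
def primeEquiv (T : α → α → Prop) :
    (Σ C : PrimeWalk T, {d : List α // (d : Cycle α) = C.1}) ≃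
      {d : List α // IsClosedWalk T d ∧ IsPrimitiveWord d} where
  toFun p := ⟨p.2.1, by
    obtain ⟨⟨C, c, rfl, h1, h2⟩, d, hd⟩ := p
    exact ⟨h1.of_coe_eq hd.symm, h2.of_coe_eq h1.1 hd.symm⟩⟩
  invFun d := ⟨⟨d.1, d.1, rfl, d.2⟩, d.1, rfl⟩
  left_inv := by rintro ⟨⟨C, hC⟩, d, hd⟩; dsimp only at hd; subst hd; rfl
  right_inv _ := rfl

/-- The sum of `u ^ |c| / |c|` over all closed walks `c`, given the sum over their lengths. -/
theorem hasSum_closedWalk [Finite α] [DecidableEq α] [Fintype α] (T : α → α → Prop) {u S : ℂ}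
    (hS : HasSum (fun k : ℕ => (relMatrix T ^ k).trace * u ^ k / k) S)
    {S' : ℂ} (hS' : HasSum (fun k : ℕ => (relMatrix T ^ k).trace * (‖u‖ : ℂ) ^ k / k) S') :
    HasSum (fun c : {c : List α // IsClosedWalk T c} => u ^ c.1.length / c.1.length) S := by
  have hfin : ∀ n, Finite {c : {c : List α // IsClosedWalk T c} // c.1.length = n} := fun n =>
    Finite.of_injective (fun c => (⟨c.1.1, c.2, c.1.2⟩ :
      {c : List α // c.length = n ∧ IsClosedWalk T c})) fun a b h =>
        Subtype.ext (Subtype.ext (Subtype.mk.inj h))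
  have hcard : ∀ n, Nat.card {c : {c : List α // IsClosedWalk T c} // c.1.length = n} =
      Nat.card {c : List α // c.length = n ∧ IsClosedWalk T c} := fun n =>
    Nat.card_congr
      { toFun := fun c => ⟨c.1.1, c.2, c.1.2⟩
        invFun := fun c => ⟨⟨c.1, c.2.2⟩, c.2.1⟩
        left_inv := fun _ => rfl
        right_inv := fun _ => rfl }
  have hfib : ∀ (z : ℂ) (n : ℕ),
      HasSum (fun c : {c : {c : List α // IsClosedWalk T c} // c.1.length = n} =>
        z ^ c.1.1.length / c.1.1.length) ((relMatrix T ^ n).trace * z ^ n / n) := by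
    intro z n
    have := Fintype.ofFinite {c : {c : List α // IsClosedWalk T c} // c.1.length = n}
    convert! hasSum_fintype _
    rw [Finset.sum_congr rfl (g := fun _ => z ^ n / n) fun c _ => by rw [c.2], Finset.sum_const,
      Finset.card_univ, ← Nat.card_eq_fintype_card, hcard, nsmul_eq_mul]
    cases n with
    | zero => simp
    | succ n => rw [trace_relMatrix_pow]; ring
  let e := Equiv.sigmaFiberEquiv (fun c : {c : List α // IsClosedWalk T c} => c.1.length)
  rw [← e.hasSum_iff]
  refine HasSum.sigma_of_hasSum hS (fun n => hfib u n) ?_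
  apply Summable.of_norm
  rw [summable_sigma_of_nonneg (fun _ => norm_nonneg _)]
  have hn : ∀ x : (Σ n, {c : {c : List α // IsClosedWalk T c} // c.1.length = n}),
      ((‖((fun c : {c : List α // IsClosedWalk T c} => u ^ c.1.length / c.1.length) ∘ e) x‖ : ℝ) : ℂ)
        = (‖u‖ : ℂ) ^ x.2.1.1.length / x.2.1.1.length := by
    intro x
    simp [e]
  refine ⟨fun n => Summable.of_finite, ?_⟩
  rw [← Complex.summable_ofReal]
  refine hS'.summable.congr fun n => ?_
  rw [← (hfib ‖u‖ n).tsum_eq, Complex.ofReal_tsum]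
  exact (tsum_congr fun c => hn ⟨n, c⟩).symm

/-- The Euler product over the prime closed walks of a relation on a finite set. -/
theorem exists_hasProd_primeWalk [DecidableEq α] [Fintype α] (T : α → α → Prop) :
    ∃ r : ℝ, 0 < r ∧ ∀ u : ℂ, ‖u‖ < r → (1 - u • relMatrix T).det ≠ 0 ∧
      HasProd (fun C : PrimeWalk T => (1 - u ^ C.1.length)⁻¹) ((1 - u • relMatrix T).det)⁻¹ := by
  obtain ⟨r, hr, h⟩ := exists_log_det_one_sub_smul (relMatrix T)
  refine ⟨min r 1, lt_min hr one_pos, fun u hu => ?_⟩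
  have hu1 : ‖u‖ < 1 := hu.trans_le (min_le_right _ _)
  obtain ⟨hne, S, hS, hexp⟩ := h u (hu.trans_le (min_le_left _ _))
  obtain ⟨-, S', hS', -⟩ := h ‖u‖ (by simpa using hu.trans_le (min_le_left _ _))
  refine ⟨hne, ?_⟩
  have h1 := hasSum_closedWalk T hS hS'
  have hpow : ∀ n : ℕ, n ≠ 0 → ‖u ^ n‖ < 1 := fun n hn => by
    rw [norm_pow]; exact pow_lt_one₀ (norm_nonneg _) hu1 hn
  -- Sum first over the powers of a primitive closed walk, then over its rotations.
  rw [← (powEquiv T).hasSum_iff] at h1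
  have h2 : HasSum (fun d : {d : List α // IsClosedWalk T d ∧ IsPrimitiveWord d} =>
      -Complex.log (1 - u ^ d.1.length) / d.1.length) S := by
    refine h1.prod_fiberwise fun d => ?_
    have hl : d.1.length ≠ 0 := (List.length_pos_iff.mpr d.2.1.1).ne'
    have h3 := Complex.hasSum_taylorSeries_neg_log (hpow _ hl)
    rw [← hasSum_nat_add_iff' 1] at h3
    have h4 := h3.div_const (d.1.length : ℂ)
    simp only [Finset.range_one, Finset.sum_singleton, Nat.cast_zero, div_zero, sub_zero] at h4
    convert! h4 using 2 with k
    simp only [Function.comp_apply]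
    rw [powEquiv_length, ← pow_mul, mul_comm (k + 1), Nat.cast_mul]
    field_simp
  rw [← (primeEquiv T).hasSum_iff] at h2
  have h3 : HasSum (fun C : PrimeWalk T => -Complex.log (1 - u ^ C.1.length)) S := by
    refine h2.sigma fun C => ?_
    obtain ⟨C, c, rfl, hc, hp⟩ := C
    have hl : c.length ≠ 0 := (List.length_pos_iff.mpr hc.1).ne'
    have hcard := card_rotations hc.1 hp
    have hfin : Finite {d : List α // (d : Cycle α) = c} :=
      Nat.finite_of_card_ne_zero (by rw [hcard]; exact hl)
    have := Fintype.ofFinite {d : List α // (d : Cycle α) = c}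
    convert! hasSum_fintype _
    rw [Finset.sum_congr rfl (g := fun _ => -Complex.log (1 - u ^ c.length) / c.length)]
    · rw [Finset.sum_const, Finset.card_univ, ← Nat.card_eq_fintype_card, hcard, nsmul_eq_mul,
        mul_div_cancel₀ _ (by exact_mod_cast hl)]
      rfl
    · rintro ⟨d, hd⟩ -
      have : d.length = c.length := by
        have := congrArg Cycle.length hd
        simpa using this
      simp [primeEquiv, this]
  rw [← hexp]
  convert! h3.cexp using 2 with C
  obtain ⟨C, c, rfl, hc, hp⟩ := C
  have hl : c.length ≠ 0 := (List.length_pos_iff.mpr hc.1).ne'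
  have hne : 1 - u ^ c.length ≠ 0 := by
    intro h0
    rw [sub_eq_zero] at h0
    have := hpow _ hl
    rw [← h0] at this
    simp at this
  change _ = Complex.exp (-Complex.log (1 - u ^ c.length))
  rw [Complex.exp_neg, Complex.exp_log hne]
  rfl

end Euler

/-! ### The valuation and the uniformizer -/

section Uniformizer

variable {F : Type*} [Field F] [ValuativeRel F] {ϖ : Fˣ}

local notation "ν" => valuation F

theorem IsUniformizer.val_lt_one (hϖ : IsUniformizer ϖ) : ν (ϖ : F) < 1 := by
  obtain ⟨p, hp, hpϖ⟩ := hϖ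
  rw [← hpϖ]
  rcases lt_or_eq_of_le (show ν (p : F) ≤ 1 from p.2) with h | h
  · exact h
  · exfalso
    apply hp.not_isUnit
    rw [(Valuation.integer.integers (ν)).isUnit_iff_valuation_eq_one]
    exact h

theorem val_unit_ne_zero (x : Fˣ) : ν (x : F) ≠ 0 := (Valuation.ne_zero_iff _).mpr x.ne_zero

theorem val_unit_pos (x : Fˣ) : 0 < ν (x : F) := zero_lt_iff.mpr (val_unit_ne_zero x)

theorem IsUniformizer.zpow_le_iff (hϖ : IsUniformizer ϖ) {a b : ℤ} :
    ν (ϖ : F) ^ a ≤ ν (ϖ : F) ^ b ↔ b ≤ a :=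
  zpow_le_zpow_iff_right_of_lt_one₀ (val_unit_pos ϖ) hϖ.val_lt_one

theorem IsUniformizer.zpow_lt_iff (hϖ : IsUniformizer ϖ) {a b : ℤ} :
    ν (ϖ : F) ^ a < ν (ϖ : F) ^ b ↔ b < a :=
  zpow_lt_zpow_iff_right_of_lt_one₀ (val_unit_pos ϖ) hϖ.val_lt_one

theorem IsUniformizer.zpow_inj (hϖ : IsUniformizer ϖ) {a b : ℤ} :
    ν (ϖ : F) ^ a = ν (ϖ : F) ^ b ↔ a = b := by
  constructor
  · intro h
    exact le_antisymm (hϖ.zpow_le_iff.mp h.ge) (hϖ.zpow_le_iff.mp h.le)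
  · rintro rfl; rfl

variable [TopologicalSpace F] [IsNonarchimedeanLocalField F]

theorem IsUniformizer.val_le_of_lt_one (hϖ : IsUniformizer ϖ) {x : F} (hx : ν x < 1) :
    ν x ≤ ν (ϖ : F) := by
  obtain ⟨p, hp, hpϖ⟩ := hϖ
  have hm : (⟨x, hx.le⟩ : 𝒪[F]) ∈ IsLocalRing.maximalIdeal 𝒪[F] := by
    rw [IsLocalRing.mem_maximalIdeal, mem_nonunits_iff,
      (Valuation.integer.integers (ν)).isUnit_iff_valuation_eq_one]
    exact hx.ne
  rw [hp.maximalIdeal_eq, Ideal.mem_span_singleton] at hm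
  obtain ⟨y, hy⟩ := hm
  have hy := congrArg (fun z : 𝒪[F] => (z : F)) hy
  simp only [Subring.coe_mul] at hy
  rw [hy, map_mul, hpϖ]
  exact mul_le_of_le_one_right' y.2

theorem IsUniformizer.exists_zpow (hϖ : IsUniformizer ϖ) (x : Fˣ) :
    ∃ m : ℤ, ν (x : F) = ν (ϖ : F) ^ m := by
  obtain ⟨p, hp, hpϖ⟩ := hϖ
  have key : ∀ x : F, x ≠ 0 → ν x ≤ 1 → ∃ m : ℤ, ν x = ν (ϖ : F) ^ m := by
    intro x hx0 hx
    obtain ⟨n, u, hu⟩ := IsDiscreteValuationRing.eq_unit_mul_pow_irreducible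
      (x := (⟨x, hx⟩ : 𝒪[F])) (by simpa [Subtype.ext_iff] using hx0) hp
    have hu' := congrArg (fun z : 𝒪[F] => (z : F)) hu
    simp only [Subring.coe_mul, Subring.coe_pow] at hu'
    refine ⟨n, ?_⟩
    have h1 : ν ((u : 𝒪[F]) : F) = 1 :=
      (Valuation.integer.integers (ν)).isUnit_iff_valuation_eq_one.mp u.isUnit
    rw [hu', map_mul, h1, one_mul, map_pow, hpϖ, zpow_natCast]
  rcases le_total (ν (x : F)) 1 with h | h
  · exact key x x.ne_zero h
  · obtain ⟨m, hm⟩ := key ((x : F)⁻¹) (inv_ne_zero x.ne_zero) (by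
      rw [map_inv₀]; exact inv_le_one_of_one_le₀ h)
    refine ⟨-m, ?_⟩
    rw [zpow_neg, ← hm, map_inv₀, inv_inv]

end Uniformizer

open Classical in
/-- The order of `x` with respect to the uniformizer `ϖ`. -/
def ord {F : Type*} [Field F] [ValuativeRel F] (ϖ x : Fˣ) : ℤ :=
  Classical.epsilon fun m : ℤ => valuation F (x : F) = valuation F (ϖ : F) ^ m

section Ord

variable {F : Type*} [Field F] [ValuativeRel F] {ϖ : Fˣ}
  [TopologicalSpace F] [IsNonarchimedeanLocalField F]

local notation "ν" => valuation F

theorem IsUniformizer.val_eq (hϖ : IsUniformizer ϖ) (x : Fˣ) :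
    ν (x : F) = ν (ϖ : F) ^ ord ϖ x :=
  Classical.epsilon_spec (hϖ.exists_zpow x)

theorem IsUniformizer.ord_eq (hϖ : IsUniformizer ϖ) {x : Fˣ} {m : ℤ}
    (h : ν (x : F) = ν (ϖ : F) ^ m) : ord ϖ x = m := by
  rw [hϖ.val_eq x] at h
  exact hϖ.zpow_inj.mp h

theorem IsUniformizer.ord_mul (hϖ : IsUniformizer ϖ) (x y : Fˣ) :
    ord ϖ (x * y) = ord ϖ x + ord ϖ y :=
  hϖ.ord_eq (by rw [Units.val_mul, map_mul, hϖ.val_eq x, hϖ.val_eq y,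
    zpow_add₀ (val_unit_ne_zero ϖ)])

theorem IsUniformizer.ord_zpow (hϖ : IsUniformizer ϖ) (m : ℤ) : ord ϖ (ϖ ^ m) = m :=
  hϖ.ord_eq (by rw [Units.val_zpow_eq_zpow_val, map_zpow₀])

theorem IsUniformizer.ord_one (hϖ : IsUniformizer ϖ) : ord ϖ 1 = 0 := by
  have := hϖ.ord_zpow 0
  simpa using this

theorem IsUniformizer.ord_inv (hϖ : IsUniformizer ϖ) (x : Fˣ) : ord ϖ x⁻¹ = -ord ϖ x := by
  have := hϖ.ord_mul x x⁻¹
  rw [mul_inv_cancel, hϖ.ord_one] at this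
  linarith

theorem IsUniformizer.ord_eq_zero_iff (hϖ : IsUniformizer ϖ) (x : Fˣ) :
    ord ϖ x = 0 ↔ ν (x : F) = 1 := by
  rw [hϖ.val_eq x]
  constructor
  · intro h; rw [h, zpow_zero]
  · intro h; exact hϖ.zpow_inj.mp (by rw [h, zpow_zero])

end Ord

/-! ### Scalar matrices -/

section Scalar

variable {F : Type*} [Field F]

theorem scalarGL_apply (z : Fˣ) (i j : Fin 4) :
    (scalarGL z : Matrix (Fin 4) (Fin 4) F) i j = if i = j then (z : F) else 0 := by
  simp [scalarGL, Matrix.diagonal_apply]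

theorem scalarGL_inv (z : Fˣ) : (scalarGL z)⁻¹ = scalarGL z⁻¹ := (map_inv _ _).symm

theorem scalarGL_mul (z w : Fˣ) : scalarGL (z * w) = scalarGL z * scalarGL w := map_mul _ _ _

theorem det_scalarGL_mul (z : Fˣ) (g : GL (Fin 4) F) :
    ((scalarGL z * g : GL (Fin 4) F) : Matrix (Fin 4) (Fin 4) F).det =
      (z : F) ^ 4 * (g : Matrix (Fin 4) (Fin 4) F).det := by
  rw [Units.val_mul, Matrix.det_mul]
  congr 1
  simp [scalarGL]

end Scalar

/-! ### Integral matrices -/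

section Integral

variable {F : Type*} [Field F] [ValuativeRel F]

local notation "ν" => valuation F

/-- A matrix with entries in the ring of integers. -/
def IntM (M : Matrix (Fin 4) (Fin 4) F) : Prop := ∀ i j, ν (M i j) ≤ 1

theorem val_sum_le {ι : Type*} (s : Finset ι) (f : ι → F) {b : ValueGroupWithZero F}
    (h : ∀ i ∈ s, ν (f i) ≤ b) : ν (∑ i ∈ s, f i) ≤ b :=
  Valuation.map_sum_le _ h

theorem val_mul_le_one {x y : F} (hx : ν x ≤ 1) (hy : ν y ≤ 1) : ν (x * y) ≤ 1 := by
  rw [map_mul]; exact mul_le_one' hx hy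

theorem IntM.mul {M N : Matrix (Fin 4) (Fin 4) F} (hM : IntM M) (hN : IntM N) : IntM (M * N) := by
  intro i j
  rw [Matrix.mul_apply]
  exact val_sum_le _ _ fun k _ => val_mul_le_one (hM i k) (hN k j)

theorem IntM.one : IntM (1 : Matrix (Fin 4) (Fin 4) F) := by
  intro i j
  rw [Matrix.one_apply]
  split_ifs <;> simp

theorem IntM.mulVec {M : Matrix (Fin 4) (Fin 4) F} (hM : IntM M) {x : Fin 4 → F}
    (hx : ∀ i, ν (x i) ≤ 1) (i : Fin 4) : ν ((M *ᵥ x) i) ≤ 1 := by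
  rw [Matrix.mulVec, dotProduct]
  exact val_sum_le _ _ fun k _ => val_mul_le_one (hM i k) (hx k)

theorem intM_of_mulVec {M : Matrix (Fin 4) (Fin 4) F}
    (h : ∀ x : Fin 4 → F, (∀ i, ν (x i) ≤ 1) → ∀ i, ν ((M *ᵥ x) i) ≤ 1) : IntM M := by
  intro i j
  have := h (Pi.single j 1) (fun k => by
    by_cases hk : k = j
    · subst hk; simp
    · simp [hk]) i
  simpa using this

theorem IntM.val_det_le {M : Matrix (Fin 4) (Fin 4) F} (hM : IntM M) : ν M.det ≤ 1 := by
  rw [Matrix.det_apply]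
  refine val_sum_le _ _ fun σ _ => ?_
  have h : ν (∏ i, M (σ i) i) ≤ 1 := by
    rw [map_prod]; exact Finset.prod_le_one' fun i _ => hM _ _
  rcases Int.units_eq_one_or (Equiv.Perm.sign σ) with h' | h' <;> rw [h']
  · simpa using h
  · simpa using h

/-- `GL₄(𝒪)`, as a subgroup of `GL₄(F)`. -/
def K (F : Type*) [Field F] [ValuativeRel F] : Subgroup (GL (Fin 4) F) where
  carrier := {g | IntM (g : Matrix (Fin 4) (Fin 4) F) ∧
    IntM ((g⁻¹ : GL (Fin 4) F) : Matrix (Fin 4) (Fin 4) F)}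
  mul_mem' := by
    rintro a b ⟨ha, ha'⟩ ⟨hb, hb'⟩
    refine ⟨ha.mul hb, ?_⟩
    rw [mul_inv_rev]
    exact hb'.mul ha'
  one_mem' := ⟨IntM.one, by rw [inv_one]; exact IntM.one⟩
  inv_mem' := by
    rintro a ⟨ha, ha'⟩
    exact ⟨ha', by rwa [inv_inv]⟩

theorem mem_K {g : GL (Fin 4) F} : g ∈ K F ↔ IntM (g : Matrix (Fin 4) (Fin 4) F) ∧
    IntM ((g⁻¹ : GL (Fin 4) F) : Matrix (Fin 4) (Fin 4) F) := Iff.rfl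

theorem val_det_of_mem_K {g : GL (Fin 4) F} (hg : g ∈ K F) :
    ν (g : Matrix (Fin 4) (Fin 4) F).det = 1 := by
  have h1 := hg.1.val_det_le
  have h2 := hg.2.val_det_le
  have h : ν (g : Matrix (Fin 4) (Fin 4) F).det *
      ν ((g⁻¹ : GL (Fin 4) F) : Matrix (Fin 4) (Fin 4) F).det = 1 := by
    rw [← map_mul, ← Matrix.det_mul, ← Units.val_mul, mul_inv_cancel, Units.val_one,
      Matrix.det_one, map_one]
  refine le_antisymm h1 ?_
  rw [← h]
  exact mul_le_of_le_one_right' h2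

theorem scalarGL_mem_K {z : Fˣ} (hz : ν (z : F) = 1) : scalarGL z ∈ K F := by
  rw [mem_K, scalarGL_inv]
  constructor <;> intro i j <;> rw [scalarGL_apply] <;> split_ifs <;> simp [hz]

end Integral

/-! ### Lattices and their homothety classes -/

section Lattices

variable {F : Type*} [Field F] [ValuativeRel F]

local notation "ν" => valuation F

theorem mem_span_single_iff (x : Fin 4 → F) :
    x ∈ Submodule.span 𝒪[F] (Set.range fun i : Fin 4 => (Pi.single i (1 : F) : Fin 4 → F)) ↔
      ∀ i, ν (x i) ≤ 1 := by
  constructor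
  · intro h
    induction h using Submodule.span_induction with
    | mem x hx =>
      obtain ⟨j, rfl⟩ := hx
      intro i
      by_cases hij : i = j
      · subst hij; simp
      · simp [hij]
    | zero => simp
    | add x y _ _ hx hy => exact fun i => (Valuation.map_add _ _ _).trans (max_le (hx i) (hy i))
    | smul a x _ hx =>
      intro i
      exact val_mul_le_one a.2 (hx i)
  · intro h
    have hx : x = ∑ i, (⟨x i, h i⟩ : 𝒪[F]) • (Pi.single i (1 : F) : Fin 4 → F) := by
      ext j
      simp [Finset.sum_apply, Pi.single_apply, Subring.smul_def]
    rw [hx]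
    exact Submodule.sum_mem _ fun i _ => Submodule.smul_mem _ _ (Submodule.subset_span ⟨i, rfl⟩)

/-- The standard lattice `𝒪⁴`. -/
def stdLat (F : Type*) [Field F] [ValuativeRel F] : VLattice F :=
  ⟨Submodule.span 𝒪[F] (Set.range fun i : Fin 4 => (Pi.single i (1 : F) : Fin 4 → F)),
    Submodule.fg_span (Set.finite_range _), by
      rw [Submodule.span_span_of_tower, eq_top_iff]
      intro x _
      have hx : x = ∑ i, x i • (Pi.single i (1 : F) : Fin 4 → F) := by
        ext j
        simp [Finset.sum_apply, Pi.single_apply]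
      rw [hx]
      exact Submodule.sum_mem _ fun i _ =>
        Submodule.smul_mem _ _ (Submodule.subset_span ⟨i, rfl⟩)⟩

/-- The lattice `g 𝒪⁴`. -/
def lat (g : GL (Fin 4) F) : VLattice F := g • stdLat F

theorem smul_lat (g h : GL (Fin 4) F) : g • lat h = lat (g * h) := (mul_smul g h _).symm

theorem mem_smul_iff (g : GL (Fin 4) F) (L : VLattice F) (x : Fin 4 → F) :
    x ∈ (g • L).1 ↔ ((g⁻¹ : GL (Fin 4) F) : Matrix (Fin 4) (Fin 4) F) *ᵥ x ∈ L.1 := by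
  change x ∈ L.1.map (actMap g) ↔ _
  rw [Submodule.mem_map]
  constructor
  · rintro ⟨y, hy, rfl⟩
    change ((g⁻¹ : GL (Fin 4) F) : Matrix (Fin 4) (Fin 4) F) *ᵥ
      ((g : Matrix (Fin 4) (Fin 4) F) *ᵥ y) ∈ _
    rwa [Matrix.mulVec_mulVec, ← Units.val_mul, inv_mul_cancel, Units.val_one, Matrix.one_mulVec]
  · intro h
    refine ⟨_, h, ?_⟩
    change (g : Matrix (Fin 4) (Fin 4) F) *ᵥ
      (((g⁻¹ : GL (Fin 4) F) : Matrix (Fin 4) (Fin 4) F) *ᵥ x) = _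
    rw [Matrix.mulVec_mulVec, ← Units.val_mul, mul_inv_cancel, Units.val_one, Matrix.one_mulVec]

theorem mem_lat (g : GL (Fin 4) F) (x : Fin 4 → F) :
    x ∈ (lat g).1 ↔ ∀ i, ν ((((g⁻¹ : GL (Fin 4) F) : Matrix (Fin 4) (Fin 4) F) *ᵥ x) i) ≤ 1 := by
  rw [lat, mem_smul_iff]
  exact mem_span_single_iff _

theorem mulVec_mem_lat (g : GL (Fin 4) F) (x : Fin 4 → F) :
    (g : Matrix (Fin 4) (Fin 4) F) *ᵥ x ∈ (lat g).1 ↔ ∀ i, ν (x i) ≤ 1 := by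
  rw [mem_lat, Matrix.mulVec_mulVec, ← Units.val_mul, inv_mul_cancel, Units.val_one,
    Matrix.one_mulVec]

theorem lat_le_iff (g h : GL (Fin 4) F) :
    (lat g).1 ≤ (lat h).1 ↔ IntM ((h⁻¹ * g : GL (Fin 4) F) : Matrix (Fin 4) (Fin 4) F) := by
  constructor
  · intro H
    refine intM_of_mulVec fun x hx => ?_
    have := H ((mulVec_mem_lat g x).mpr hx)
    rwa [mem_lat, Matrix.mulVec_mulVec, ← Units.val_mul] at this
  · intro H x hx
    rw [mem_lat] at hx ⊢
    have := H.mulVec hx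
    rwa [Matrix.mulVec_mulVec, ← Units.val_mul, mul_assoc, mul_inv_cancel, mul_one] at this

theorem lat_eq_iff (g h : GL (Fin 4) F) : lat g = lat h ↔ h⁻¹ * g ∈ K F := by
  rw [mem_K, mul_inv_rev, inv_inv, ← lat_le_iff, ← lat_le_iff]
  exact ⟨fun H => ⟨by rw [H], by rw [H]⟩, fun H => Subtype.ext (le_antisymm H.1 H.2)⟩

theorem cls_eq_iff (L L' : VLattice F) : L.cls = L'.cls ↔ ∃ α : Fˣ, L' = scalarGL α • L :=
  Quotient.eq (r := homothety F)

theorem smul_cls (g : GL (Fin 4) F) (L : VLattice F) : g • L.cls = (g • L).cls := rfl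

theorem cls_lat_eq_iff (g h : GL (Fin 4) F) :
    (lat g).cls = (lat h).cls ↔ ∃ α : Fˣ, scalarGL α * (g⁻¹ * h) ∈ K F := by
  rw [cls_eq_iff]
  constructor
  · rintro ⟨α, hα⟩
    rw [smul_lat, lat_eq_iff] at hα
    refine ⟨α⁻¹, ?_⟩
    have : scalarGL α⁻¹ * (g⁻¹ * h) = (scalarGL α * g)⁻¹ * h := by
      rw [mul_inv_rev, scalarGL_inv, ← mul_assoc, scalarGL_comm]
    rw [this]
    exact hα
  · rintro ⟨α, hα⟩
    refine ⟨α⁻¹, ?_⟩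
    rw [smul_lat, lat_eq_iff]
    have : scalarGL α * (g⁻¹ * h) = (scalarGL α⁻¹ * g)⁻¹ * h := by
      rw [mul_inv_rev, scalarGL_inv, inv_inv, ← mul_assoc, scalarGL_comm]
    rwa [this] at hα

theorem lat_mul_K (g k : GL (Fin 4) F) (hk : k ∈ K F) : lat (g * k) = lat g := by
  rw [lat_eq_iff]; simpa using hk

end Lattices

/-! ### Diagonal matrices and similitudes -/

section Similitudes

variable {F : Type*} [Field F]

/-- The diagonal matrix with entries `ϖ ^ a i`. -/
def D (ϖ : Fˣ) (a : Fin 4 → ℤ) : GL (Fin 4) F := diagGL fun i => ϖ ^ a i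

theorem D_add (ϖ : Fˣ) (a b : Fin 4 → ℤ) : D ϖ (a + b) = D ϖ a * D ϖ b := by
  apply Units.ext
  simp [D, diagGL, Matrix.diagonal_mul_diagonal, zpow_add₀ ϖ.ne_zero]

theorem D_zero (ϖ : Fˣ) : D ϖ 0 = 1 := by
  apply Units.ext
  simp [D, diagGL]

theorem D_neg (ϖ : Fˣ) (a : Fin 4 → ℤ) : D ϖ (-a) = (D ϖ a)⁻¹ := by
  rw [eq_inv_iff_mul_eq_one, ← D_add, neg_add_cancel, D_zero]

theorem D_const (ϖ : Fˣ) (k : ℤ) : D ϖ (fun _ => k) = scalarGL (ϖ ^ k) := by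
  apply Units.ext
  ext i j
  rw [scalarGL_apply]
  simp [D, diagGL, Matrix.diagonal_apply]

theorem D_mul_apply (ϖ : Fˣ) (a b : Fin 4 → ℤ) (g : GL (Fin 4) F) (i j : Fin 4) :
    ((D ϖ a * g * D ϖ b : GL (Fin 4) F) : Matrix (Fin 4) (Fin 4) F) i j =
      (ϖ : F) ^ (a i + b j) * (g : Matrix (Fin 4) (Fin 4) F) i j := by
  simp only [D, diagGL, Units.val_mul, Matrix.mul_diagonal, Matrix.diagonal_mul,
    Units.val_zpow_eq_zpow_val]
  rw [zpow_add₀ ϖ.ne_zero]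
  ring

theorem D_apply (ϖ : Fˣ) (a : Fin 4 → ℤ) (i j : Fin 4) :
    (D ϖ a : Matrix (Fin 4) (Fin 4) F) i j = if i = j then (ϖ : F) ^ a i else 0 := by
  simp [D, diagGL, Matrix.diagonal_apply]

/-- The similitude factor of an element of `GSp₄(F)`. -/
def mu (g : GSp4 F) : Fˣ := g.2.choose

theorem mu_spec (g : GSp4 F) : ((g : GL (Fin 4) F) : Matrix (Fin 4) (Fin 4) F)ᵀ * J F *
    ((g : GL (Fin 4) F) : Matrix (Fin 4) (Fin 4) F) = (mu g : F) • J F := g.2.choose_spec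

theorem J_mul_J : J F * J F = -1 := by
  ext i j
  fin_cases i <;> fin_cases j <;> simp [J, Matrix.mul_apply, Fin.sum_univ_four]

theorem mu_unique {g : GSp4 F} {c : Fˣ} (h : ((g : GL (Fin 4) F) : Matrix (Fin 4) (Fin 4) F)ᵀ *
    J F * ((g : GL (Fin 4) F) : Matrix (Fin 4) (Fin 4) F) = (c : F) • J F) : mu g = c := by
  rw [mu_spec] at h
  have := congrFun (congrFun h 0) 3
  exact Units.ext (by simpa [J] using this)

theorem mu_mul (g h : GSp4 F) : mu (g * h) = mu g * mu h := by
  apply mu_unique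
  have e : ((g * h : GSp4 F) : GL (Fin 4) F) = g * h := rfl
  rw [e, Units.val_mul, Matrix.transpose_mul]
  calc _ = ((h : GL (Fin 4) F) : Matrix (Fin 4) (Fin 4) F)ᵀ *
      (((g : GL (Fin 4) F) : Matrix (Fin 4) (Fin 4) F)ᵀ * J F *
        ((g : GL (Fin 4) F) : Matrix (Fin 4) (Fin 4) F)) *
        ((h : GL (Fin 4) F) : Matrix (Fin 4) (Fin 4) F) := by simp only [Matrix.mul_assoc]
    _ = _ := by rw [mu_spec, Matrix.mul_smul, Matrix.smul_mul, mu_spec, smul_smul, Units.val_mul]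

theorem mu_one : mu (1 : GSp4 F) = 1 := mu_unique (by simp)

theorem mu_inv (g : GSp4 F) : mu g⁻¹ = (mu g)⁻¹ := by
  rw [eq_inv_iff_mul_eq_one, ← mu_mul, inv_mul_cancel, mu_one]

theorem form_mulVec (g : GSp4 F) (x y : Fin 4 → F) :
    form (((g : GL (Fin 4) F) : Matrix (Fin 4) (Fin 4) F) *ᵥ x)
      (((g : GL (Fin 4) F) : Matrix (Fin 4) (Fin 4) F) *ᵥ y) = (mu g : F) * form x y := by
  unfold form
  rw [Matrix.mulVec_mulVec, ← Matrix.vecMul_transpose, ← Matrix.dotProduct_mulVec,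
    Matrix.mulVec_mulVec, ← Matrix.mul_assoc, mu_spec, Matrix.smul_mulVec, dotProduct_smul,
    smul_eq_mul]

theorem form_eq (x y : Fin 4 → F) :
    form x y = x 0 * y 3 + x 1 * y 2 - x 2 * y 1 - x 3 * y 0 := by
  simp [form, J, dotProduct, Matrix.mulVec, Fin.sum_univ_four]
  ring

/-- The signs occurring in the matrix of the alternating form. -/
def sgn (i : Fin 4) : ℤˣ := if i < 2 then 1 else -1

theorem inv_apply (g : GSp4 F) (r c : Fin 4) :
    (((g⁻¹ : GSp4 F) : GL (Fin 4) F) : Matrix (Fin 4) (Fin 4) F) r c =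
      (mu g : F)⁻¹ * ((sgn r * sgn c : ℤˣ) : ℤ) *
        ((g : GL (Fin 4) F) : Matrix (Fin 4) (Fin 4) F) (Fin.rev c) (Fin.rev r) := by
  have h : (((g⁻¹ : GSp4 F) : GL (Fin 4) F) : Matrix (Fin 4) (Fin 4) F) =
      (mu g : F)⁻¹ • (-(J F * ((g : GL (Fin 4) F) : Matrix (Fin 4) (Fin 4) F)ᵀ * J F)) := by
    have h1 : ((mu g : F)⁻¹ • (-(J F * ((g : GL (Fin 4) F) : Matrix (Fin 4) (Fin 4) F)ᵀ * J F))) *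
        ((g : GL (Fin 4) F) : Matrix (Fin 4) (Fin 4) F) = 1 := by
      rw [Matrix.smul_mul, Matrix.neg_mul, Matrix.mul_assoc, Matrix.mul_assoc,
        ← Matrix.mul_assoc (_)ᵀ, mu_spec, Matrix.mul_smul, J_mul_J]
      simp
    have h2 := congrArg (fun M => M * ((g⁻¹ : GL (Fin 4) F) : Matrix (Fin 4) (Fin 4) F)) h1
    simp only [Matrix.mul_assoc] at h2
    rw [← Units.val_mul, mul_inv_cancel, Units.val_one, Matrix.mul_one, Matrix.one_mul] at h2
    rw [Subgroup.coe_inv, ← h2, Matrix.mul_assoc]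
  rw [h]
  simp only [Matrix.smul_apply, Matrix.neg_apply, Matrix.mul_apply, Fin.sum_univ_four,
    Matrix.transpose_apply]
  fin_cases r <;> fin_cases c <;> simp [J, sgn, Fin.rev]

theorem det_sq (g : GSp4 F) :
    ((g : GL (Fin 4) F) : Matrix (Fin 4) (Fin 4) F).det ^ 2 = (mu g : F) ^ 4 := by
  have h := congrArg Matrix.det (mu_spec g)
  rw [Matrix.det_mul, Matrix.det_mul, Matrix.det_transpose, Matrix.det_smul] at h
  have hJ : (J F).det ≠ 0 := by
    intro h0
    have := congrArg Matrix.det (J_mul_J (F := F))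
    rw [Matrix.det_mul, h0, Matrix.det_neg] at this
    norm_num at this
  simp only [Fintype.card_fin] at h
  apply mul_right_cancel₀ hJ
  rw [← h]; ring

/-- A diagonal similitude. -/
def DG (ϖ : Fˣ) (a : Fin 4 → ℤ) (h : a 0 + a 3 = a 1 + a 2) : GSp4 F :=
  ⟨D ϖ a, ϖ ^ (a 0 + a 3), by
    ext i j
    fin_cases i <;> fin_cases j <;>
      simp [D, diagGL, J, Matrix.mul_apply, Fin.sum_univ_four, ← zpow_add₀, h, add_comm]⟩

theorem mu_DG (ϖ : Fˣ) (a : Fin 4 → ℤ) (h : a 0 + a 3 = a 1 + a 2) :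
    mu (DG ϖ a h) = ϖ ^ (a 0 + a 3) := mu_unique (by
    ext i j
    fin_cases i <;> fin_cases j <;>
      simp [DG, D, diagGL, J, Matrix.mul_apply, Fin.sum_univ_four, ← zpow_add₀, h, add_comm])

theorem scalarGL_mem (z : Fˣ) : scalarGL z ∈ GSp4 F :=
  ⟨z ^ 2, by
    ext i j
    fin_cases i <;> fin_cases j <;>
      simp [scalarGL, J, pow_two]⟩

/-- The scalar matrices in `GSp₄(F)`. -/
def scalarG (z : Fˣ) : GSp4 F := ⟨scalarGL z, scalarGL_mem z⟩

theorem mu_scalarG (z : Fˣ) : mu (scalarG z) = z ^ 2 := mu_unique (by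
    ext i j
    fin_cases i <;> fin_cases j <;>
      simp [scalarG, scalarGL, J, pow_two])

theorem mem_Z {g : GSp4 F} : g ∈ Z F ↔ ∃ z, g = scalarG z :=
  exists_congr fun z => (Subtype.ext_iff (a1 := g) (a2 := scalarG z)).symm

theorem scalarG_mem_Z (z : Fˣ) : scalarG z ∈ Z F := ⟨z, rfl⟩

end Similitudes

/-! ### Vertices and edges in a standard apartment -/

section Apartment

variable {F : Type*} [Field F] [ValuativeRel F] [TopologicalSpace F] [IsNonarchimedeanLocalField F]
  {ϖ : Fˣ}

local notation "ν" => valuation F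

/-- The order of the similitude factor. -/
def simOrd (ϖ : Fˣ) (g : GSp4 F) : ℤ := ord ϖ (mu g)

/-- The lattice `g · diag(ϖ ^ a) · 𝒪⁴`. -/
def plat (ϖ : Fˣ) (g : GL (Fin 4) F) (a : Fin 4 → ℤ) : VLattice F := lat (g * D ϖ a)

theorem intM_D (hϖ : IsUniformizer ϖ) (a : Fin 4 → ℤ) :
    IntM (D ϖ a : Matrix (Fin 4) (Fin 4) F) ↔ ∀ i, 0 ≤ a i := by
  constructor
  · intro h i
    have := h i i
    rw [D_apply, if_pos rfl, map_zpow₀, ← zpow_zero (ν (ϖ : F)), hϖ.zpow_le_iff] at this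
    exact this
  · intro h i j
    rw [D_apply]
    split_ifs
    · rw [map_zpow₀, ← zpow_zero (ν (ϖ : F)), hϖ.zpow_le_iff]
      exact h i
    · simp

theorem plat_le_iff (hϖ : IsUniformizer ϖ) (g : GL (Fin 4) F) (a b : Fin 4 → ℤ) :
    (plat ϖ g a).1 ≤ (plat ϖ g b).1 ↔ ∀ i, b i ≤ a i := by
  rw [plat, plat, lat_le_iff]
  have : (g * D ϖ b)⁻¹ * (g * D ϖ a) = D ϖ (-b + a) := by
    rw [D_add, D_neg]; group
  rw [this, intM_D hϖ]
  simp only [Pi.add_apply, Pi.neg_apply]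
  exact forall_congr' fun i => by constructor <;> intro h <;> linarith

theorem smul_plat (hϖ : IsUniformizer ϖ) (α : Fˣ) (g : GL (Fin 4) F) (a : Fin 4 → ℤ) :
    scalarGL α • plat ϖ g a = plat ϖ g (fun i => a i + ord ϖ α) := by
  rw [plat, plat, smul_lat, lat_eq_iff]
  have e : (fun i => a i + ord ϖ α) = a + fun _ => ord ϖ α := rfl
  have : (g * D ϖ fun i => a i + ord ϖ α)⁻¹ * (scalarGL α * (g * D ϖ a)) =
      scalarGL (α * (ϖ ^ ord ϖ α)⁻¹) := by
    rw [e, D_add, D_const, ← scalarGL_comm (g * D ϖ a), ← mul_assoc g, mul_inv_rev, mul_assoc,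
      inv_mul_cancel_left, scalarGL_inv, ← scalarGL_mul, mul_comm]
  rw [this]
  apply scalarGL_mem_K
  rw [← hϖ.ord_eq_zero_iff, hϖ.ord_mul, hϖ.ord_inv, hϖ.ord_zpow, add_neg_cancel]

theorem exists_eq_plat (hϖ : IsUniformizer ϖ) {g : GL (Fin 4) F} {a : Fin 4 → ℤ} {L : VLattice F}
    (h : L.cls = (plat ϖ g a).cls) : ∃ k : ℤ, L = plat ϖ g (fun i => a i + k) := by
  obtain ⟨α, hα⟩ := (cls_eq_iff _ _).mp h.symm
  exact ⟨ord ϖ α, by rw [hα, smul_plat hϖ]⟩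

theorem cls_plat_add (hϖ : IsUniformizer ϖ) (g : GL (Fin 4) F) (a : Fin 4 → ℤ) (k : ℤ) :
    (plat ϖ g (fun i => a i + k)).cls = (plat ϖ g a).cls := by
  rw [eq_comm, cls_eq_iff]
  exact ⟨ϖ ^ k, by rw [smul_plat hϖ, hϖ.ord_zpow]⟩

theorem cls_plat_eq_iff (hϖ : IsUniformizer ϖ) (g : GL (Fin 4) F) (a b : Fin 4 → ℤ) :
    (plat ϖ g a).cls = (plat ϖ g b).cls ↔ ∃ k : ℤ, ∀ i, a i = b i + k := by
  constructor
  · intro h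
    obtain ⟨k, hk⟩ := exists_eq_plat hϖ h
    refine ⟨k, fun i => le_antisymm ?_ ?_⟩
    · exact (plat_le_iff hϖ g _ _).mp (le_of_eq (congrArg Subtype.val hk.symm)) i
    · exact (plat_le_iff hϖ g _ _).mp (le_of_eq (congrArg Subtype.val hk)) i
  · rintro ⟨k, hk⟩
    rw [← cls_plat_add hϖ g b k]
    congr 2
    exact funext hk

theorem exists_mem_maximalIdeal_iff (hϖ : IsUniformizer ϖ) (z : F) :
    (∃ c ∈ IsLocalRing.maximalIdeal 𝒪[F], (c : F) = z) ↔ ν z ≤ ν (ϖ : F) := by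
  constructor
  · rintro ⟨c, hc, rfl⟩
    apply hϖ.val_le_of_lt_one
    refine lt_of_le_of_ne c.2 fun h => ?_
    rw [IsLocalRing.mem_maximalIdeal, mem_nonunits_iff,
      (Valuation.integer.integers (ν)).isUnit_iff_valuation_eq_one] at hc
    exact hc h
  · intro h
    have h1 : ν z < 1 := h.trans_lt hϖ.val_lt_one
    refine ⟨⟨z, h1.le⟩, ?_, rfl⟩
    rw [IsLocalRing.mem_maximalIdeal, mem_nonunits_iff,
      (Valuation.integer.integers (ν)).isUnit_iff_valuation_eq_one]
    exact h1.ne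

theorem mem_maximalIdeal_smul_iff (hϖ : IsUniformizer ϖ) (N : Submodule 𝒪[F] (Fin 4 → F))
    (x : Fin 4 → F) :
    x ∈ IsLocalRing.maximalIdeal 𝒪[F] • N ↔ (ϖ : F)⁻¹ • x ∈ N := by
  obtain ⟨p, hp, hpϖ⟩ := hϖ
  rw [hp.maximalIdeal_eq, Submodule.ideal_span_singleton_smul,
    Submodule.mem_smul_pointwise_iff_exists]
  have hsmul : ∀ y : Fin 4 → F, p • y = (ϖ : F) • y := by
    intro y
    rw [← hpϖ]; rfl
  constructor
  · rintro ⟨y, hy, rfl⟩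
    rwa [hsmul, smul_smul, inv_mul_cancel₀ ϖ.ne_zero, one_smul]
  · intro h
    exact ⟨_, h, by rw [hsmul, smul_smul, mul_inv_cancel₀ ϖ.ne_zero, one_smul]⟩

theorem maximalIdeal_smul_plat (hϖ : IsUniformizer ϖ) (g : GL (Fin 4) F) (a : Fin 4 → ℤ) :
    IsLocalRing.maximalIdeal 𝒪[F] • (plat ϖ g a).1 = (plat ϖ g (fun i => a i + 1)).1 := by
  have h1 := smul_plat hϖ ϖ g a
  rw [show ord ϖ ϖ = 1 by simpa using hϖ.ord_zpow 1] at h1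
  rw [← h1]
  ext x
  rw [mem_maximalIdeal_smul_iff hϖ, mem_smul_iff, scalarGL_inv]
  have : ((scalarGL ϖ⁻¹ : GL (Fin 4) F) : Matrix (Fin 4) (Fin 4) F) *ᵥ x = (ϖ : F)⁻¹ • x := by
    ext i
    simp [scalarGL, Matrix.mulVec_diagonal]
  rw [this]

theorem form_plat (g : GSp4 F) (a : Fin 4 → ℤ) (x y : Fin 4 → F) :
    form ((((g : GL (Fin 4) F) * D ϖ a : GL (Fin 4) F) : Matrix (Fin 4) (Fin 4) F) *ᵥ x)
      ((((g : GL (Fin 4) F) * D ϖ a : GL (Fin 4) F) : Matrix (Fin 4) (Fin 4) F) *ᵥ y) =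
      (mu g : F) * ((ϖ : F) ^ (a 0 + a 3) * (x 0 * y 3 - x 3 * y 0) +
        (ϖ : F) ^ (a 1 + a 2) * (x 1 * y 2 - x 2 * y 1)) := by
  rw [Units.val_mul, ← Matrix.mulVec_mulVec, ← Matrix.mulVec_mulVec, form_mulVec]
  congr 1
  rw [form_eq, zpow_add₀ ϖ.ne_zero, zpow_add₀ ϖ.ne_zero]
  simp only [D, diagGL, Matrix.mulVec_diagonal, Units.val_zpow_eq_zpow_val]
  ring

theorem mem_plat_iff (g : GL (Fin 4) F) (a : Fin 4 → ℤ) (x : Fin 4 → F) :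
    x ∈ (plat ϖ g a).1 ↔ ∃ x' : Fin 4 → F, (∀ i, ν (x' i) ≤ 1) ∧
      x = ((g * D ϖ a : GL (Fin 4) F) : Matrix (Fin 4) (Fin 4) F) *ᵥ x' := by
  constructor
  · intro h
    refine ⟨_, (mem_lat _ _).mp h, ?_⟩
    rw [Matrix.mulVec_mulVec, ← Units.val_mul, mul_inv_cancel, Units.val_one, Matrix.one_mulVec]
  · rintro ⟨x', hx', rfl⟩
    exact (mulVec_mem_lat _ _).mpr hx'

/-- The basis vectors of the lattice `plat ϖ g a`. -/
def bvec (ϖ : Fˣ) (g : GL (Fin 4) F) (a : Fin 4 → ℤ) (i : Fin 4) : Fin 4 → F :=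
  ((g * D ϖ a : GL (Fin 4) F) : Matrix (Fin 4) (Fin 4) F) *ᵥ Pi.single i 1

theorem val_single_le (i j : Fin 4) : ν ((Pi.single i (1 : F) : Fin 4 → F) j) ≤ 1 := by
  by_cases h : j = i
  · subst h; simp
  · simp [h]

theorem bvec_mem (g : GL (Fin 4) F) (a : Fin 4 → ℤ) (i : Fin 4) :
    bvec ϖ g a i ∈ (plat ϖ g a).1 :=
  (mem_plat_iff _ _ _).mpr ⟨_, val_single_le i, rfl⟩

theorem smul_bvec_mem_iff (g : GL (Fin 4) F) (a : Fin 4 → ℤ) (i : Fin 4) (c : F) :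
    c • bvec ϖ g a i ∈ (plat ϖ g a).1 ↔ ν c ≤ 1 := by
  rw [bvec, ← Matrix.mulVec_smul, plat, mulVec_mem_lat]
  constructor
  · intro h
    simpa using h i
  · intro h j
    rw [Pi.smul_apply, smul_eq_mul]
    exact val_mul_le_one h (val_single_le i j)

theorem val_mu_mul (hϖ : IsUniformizer ϖ) (g : GSp4 F) (k : ℤ) :
    ν ((mu g : F) * (ϖ : F) ^ k) = ν (ϖ : F) ^ (simOrd ϖ g + k) := by
  rw [map_mul, map_zpow₀, hϖ.val_eq (mu g), zpow_add₀ (val_unit_ne_zero ϖ)]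
  rfl

theorem form_bvec_zero (hϖ : IsUniformizer ϖ) (g : GSp4 F) (a : Fin 4 → ℤ) (x : Fin 4 → F) :
    ν (form (bvec ϖ (g : GL (Fin 4) F) a 0)
      ((((g : GL (Fin 4) F) * D ϖ a : GL (Fin 4) F) : Matrix (Fin 4) (Fin 4) F) *ᵥ x)) =
      ν (ϖ : F) ^ (simOrd ϖ g + (a 0 + a 3)) * ν (x 3) := by
  rw [bvec, form_plat, ← val_mu_mul hϖ, ← map_mul]
  simp [mul_assoc]

theorem form_bvec_one (hϖ : IsUniformizer ϖ) (g : GSp4 F) (a : Fin 4 → ℤ) (x : Fin 4 → F) :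
    ν (form (bvec ϖ (g : GL (Fin 4) F) a 1)
      ((((g : GL (Fin 4) F) * D ϖ a : GL (Fin 4) F) : Matrix (Fin 4) (Fin 4) F) *ᵥ x)) =
      ν (ϖ : F) ^ (simOrd ϖ g + (a 1 + a 2)) * ν (x 2) := by
  rw [bvec, form_plat, ← val_mu_mul hϖ, ← map_mul]
  simp [mul_assoc]

theorem form_bvec_two (hϖ : IsUniformizer ϖ) (g : GSp4 F) (a : Fin 4 → ℤ) (x : Fin 4 → F) :
    ν (form (bvec ϖ (g : GL (Fin 4) F) a 2)
      ((((g : GL (Fin 4) F) * D ϖ a : GL (Fin 4) F) : Matrix (Fin 4) (Fin 4) F) *ᵥ x)) =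
      ν (ϖ : F) ^ (simOrd ϖ g + (a 1 + a 2)) * ν (x 1) := by
  rw [bvec, form_plat, ← val_mu_mul hϖ, ← map_mul]
  simp [mul_assoc, Valuation.map_neg]

theorem form_bvec_three (hϖ : IsUniformizer ϖ) (g : GSp4 F) (a : Fin 4 → ℤ) (x : Fin 4 → F) :
    ν (form (bvec ϖ (g : GL (Fin 4) F) a 3)
      ((((g : GL (Fin 4) F) * D ϖ a : GL (Fin 4) F) : Matrix (Fin 4) (Fin 4) F) *ᵥ x)) =
      ν (ϖ : F) ^ (simOrd ϖ g + (a 0 + a 3)) * ν (x 0) := by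
  rw [bvec, form_plat, ← val_mu_mul hϖ, ← map_mul]
  simp [mul_assoc, Valuation.map_neg]

theorem form_plat_le_iff (hϖ : IsUniformizer ϖ) (g : GSp4 F) (a : Fin 4 → ℤ) (k : ℤ) :
    (∀ x ∈ (plat ϖ (g : GL (Fin 4) F) a).1, ∀ y ∈ (plat ϖ (g : GL (Fin 4) F) a).1,
      ν (form x y) ≤ ν (ϖ : F) ^ k) ↔
      k ≤ simOrd ϖ g + (a 0 + a 3) ∧ k ≤ simOrd ϖ g + (a 1 + a 2) := by
  constructor
  · intro h
    have h0 := h _ (bvec_mem (ϖ := ϖ) _ a 0) _ (bvec_mem (ϖ := ϖ) _ a 3)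
    have h1 := h _ (bvec_mem (ϖ := ϖ) _ a 1) _ (bvec_mem (ϖ := ϖ) _ a 2)
    rw [bvec.eq_1 ϖ _ a 3, form_bvec_zero hϖ] at h0
    rw [bvec.eq_1 ϖ _ a 2, form_bvec_one hϖ] at h1
    simp only [Pi.single_eq_same, map_one, mul_one, hϖ.zpow_le_iff] at h0 h1
    exact ⟨h0, h1⟩
  · rintro ⟨h0, h1⟩ x hx y hy
    obtain ⟨x, hx', rfl⟩ := (mem_plat_iff _ _ _).mp hx
    obtain ⟨y, hy', rfl⟩ := (mem_plat_iff _ _ _).mp hy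
    have key : ∀ l : ℤ, k ≤ simOrd ϖ g + l → ∀ z : F, ν z ≤ 1 →
        ν ((mu g : F) * ((ϖ : F) ^ l * z)) ≤ ν (ϖ : F) ^ k := by
      intro l hl z hz
      rw [← mul_assoc, map_mul, val_mu_mul hϖ]
      exact (mul_le_of_le_one_right' hz).trans (hϖ.zpow_le_iff.mpr hl)
    rw [form_plat, mul_add]
    refine (Valuation.map_add _ _ _).trans (max_le (key _ h0 _ ?_) (key _ h1 _ ?_)) <;>
      exact (Valuation.map_sub _ _ _).trans
        (max_le (val_mul_le_one (hx' _) (hy' _)) (val_mul_le_one (hx' _) (hy' _)))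

theorem smul_inv_bvec_notMem (hϖ : IsUniformizer ϖ) (g : GL (Fin 4) F) (a : Fin 4 → ℤ)
    (i : Fin 4) : (ϖ : F)⁻¹ • bvec ϖ g a i ∉ (plat ϖ g a).1 := by
  rw [smul_bvec_mem_iff, map_inv₀, not_le]
  exact (one_lt_inv₀ (val_unit_pos ϖ)).mpr hϖ.val_lt_one

/-- A lattice of the standard apartment is primitive if and only if it is self-dual. -/
theorem isPrimitive_plat_iff (hϖ : IsUniformizer ϖ) (g : GSp4 F) (a : Fin 4 → ℤ) :
    IsPrimitive (plat ϖ (g : GL (Fin 4) F) a) ↔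
      simOrd ϖ g + (a 0 + a 3) = 0 ∧ simOrd ϖ g + (a 1 + a 2) = 0 := by
  have hint := form_plat_le_iff hϖ g a 0
  rw [zpow_zero] at hint
  unfold IsPrimitive
  simp only [exists_mem_maximalIdeal_iff hϖ, mem_maximalIdeal_smul_iff hϖ]
  rw [show (∀ x ∈ (plat ϖ (g : GL (Fin 4) F) a).1, ∀ y ∈ (plat ϖ (g : GL (Fin 4) F) a).1,
    form x y ∈ 𝒪[F]) ↔ _ from hint]
  constructor
  · rintro ⟨⟨h0, h1⟩, h⟩
    constructor
    · by_contra hne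
      refine smul_inv_bvec_notMem hϖ _ a 0 (h _ (bvec_mem _ a 0) fun y hy => ?_)
      obtain ⟨y, hy', rfl⟩ := (mem_plat_iff _ _ _).mp hy
      rw [form_bvec_zero hϖ]
      refine (mul_le_of_le_one_right' (hy' 3)).trans ?_
      rw [← zpow_one (ν (ϖ : F)), ← zpow_mul, hϖ.zpow_le_iff]
      omega
    · by_contra hne
      refine smul_inv_bvec_notMem hϖ _ a 1 (h _ (bvec_mem _ a 1) fun y hy => ?_)
      obtain ⟨y, hy', rfl⟩ := (mem_plat_iff _ _ _).mp hy
      rw [form_bvec_one hϖ]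
      refine (mul_le_of_le_one_right' (hy' 2)).trans ?_
      rw [← zpow_one (ν (ϖ : F)), ← zpow_mul, hϖ.zpow_le_iff]
      omega
  · rintro ⟨h0, h1⟩
    refine ⟨⟨h0.ge, h1.ge⟩, fun x hx h => ?_⟩
    obtain ⟨x, hx', rfl⟩ := (mem_plat_iff _ _ _).mp hx
    rw [← Matrix.mulVec_smul, plat, mulVec_mem_lat]
    have sym : ∀ i, ν (form (bvec ϖ (g : GL (Fin 4) F) a i)
        ((((g : GL (Fin 4) F) * D ϖ a : GL (Fin 4) F) : Matrix (Fin 4) (Fin 4) F) *ᵥ x)) ≤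
        ν (ϖ : F) := by
      intro i
      have := h _ (bvec_mem _ a i)
      rw [← Valuation.map_neg] at this
      convert this using 2
      rw [form_eq, form_eq]; ring
    have e0 := sym 0
    have e1 := sym 1
    have e2 := sym 2
    have e3 := sym 3
    rw [form_bvec_zero hϖ, h0, zpow_zero, one_mul] at e0
    rw [form_bvec_one hϖ, h1, zpow_zero, one_mul] at e1
    rw [form_bvec_two hϖ, h1, zpow_zero, one_mul] at e2
    rw [form_bvec_three hϖ, h0, zpow_zero, one_mul] at e3
    have fin : ∀ z : F, ν z ≤ ν (ϖ : F) → ν ((ϖ : F)⁻¹ * z) ≤ 1 := by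
      intro z hz
      rw [map_mul, map_inv₀, inv_mul_le_iff₀ (val_unit_pos ϖ), mul_one]
      exact hz
    intro i
    rw [Pi.smul_apply, smul_eq_mul]
    fin_cases i
    · exact fin _ e3
    · exact fin _ e2
    · exact fin _ e1
    · exact fin _ e0

/-- If `L'` is incident to a primitive lattice, no basis vector of `L'` pairs `L'` into the third
power of the maximal ideal. -/
theorem Incident.false_of_bvec (hϖ : IsUniformizer ϖ) {g : GL (Fin 4) F} {a : Fin 4 → ℤ}
    {L₀ : VLattice F} (h : Incident (plat ϖ g a) L₀) (i : Fin 4)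
    (hi : ∀ y ∈ (plat ϖ g a).1, ν (form (bvec ϖ g a i) y) ≤ ν (ϖ : F) ^ (3 : ℤ)) : False := by
  obtain ⟨⟨-, hprim⟩, ⟨hb1, hb2⟩, -⟩ := h
  simp only [exists_mem_maximalIdeal_iff hϖ, mem_maximalIdeal_smul_iff hϖ] at hprim
  have form_smul_left : ∀ (c : F) (x y : Fin 4 → F), form (c • x) y = c * form x y := by
    intro c x y
    simp only [form_eq, Pi.smul_apply, smul_eq_mul]; ring
  have form_smul_right : ∀ (c : F) (x y : Fin 4 → F), form x (c • y) = c * form x y := by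
    intro c x y
    simp only [form_eq, Pi.smul_apply, smul_eq_mul]; ring
  have hmul : ∀ y ∈ L₀.1, (ϖ : F) • y ∈ (plat ϖ g a).1 := by
    intro y hy
    apply hb1
    rw [mem_maximalIdeal_smul_iff hϖ, smul_smul, inv_mul_cancel₀ ϖ.ne_zero, one_smul]
    exact hy
  have step : ∀ x ∈ L₀.1, (∀ y ∈ (plat ϖ g a).1, ν (form x y) ≤ ν (ϖ : F) ^ (2 : ℤ)) →
      (ϖ : F)⁻¹ • x ∈ L₀.1 := by
    intro x hx hxy
    refine hprim x hx fun y hy => ?_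
    have := hxy _ (hmul y hy)
    rw [form_smul_right, map_mul, zpow_two, mul_le_mul_iff_right₀ (val_unit_pos ϖ)] at this
    exact this
  have h1 := step _ (hb2 (bvec_mem g a i)) fun y hy =>
    (hi y hy).trans (hϖ.zpow_le_iff.mpr (by norm_num))
  have h2 := step _ h1 fun y hy => by
    rw [form_smul_left, map_mul, map_inv₀, inv_mul_le_iff₀ (val_unit_pos ϖ)]
    refine (hi y hy).trans (le_of_eq ?_)
    rw [show (3 : ℤ) = 1 + 2 by norm_num, zpow_add₀ (val_unit_ne_zero ϖ), zpow_one]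
  have h3 := hmul _ h2
  rw [smul_smul, mul_inv_cancel₀ ϖ.ne_zero, one_smul] at h3
  exact smul_inv_bvec_notMem hϖ _ _ _ h3

theorem Incident.simOrd_plat (hϖ : IsUniformizer ϖ) {g : GSp4 F} {a : Fin 4 → ℤ}
    {L₀ : VLattice F} (h : Incident (plat ϖ (g : GL (Fin 4) F) a) L₀) :
    (1 ≤ simOrd ϖ g + (a 0 + a 3) ∧ 1 ≤ simOrd ϖ g + (a 1 + a 2)) ∧
      simOrd ϖ g + (a 0 + a 3) ≤ 2 ∧ simOrd ϖ g + (a 1 + a 2) ≤ 2 := by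
  refine ⟨?_, ?_, ?_⟩
  · rw [← form_plat_le_iff hϖ, zpow_one]
    intro x hx y hy
    exact (exists_mem_maximalIdeal_iff hϖ _).mp (h.2.2 x hx y hy)
  · by_contra hlt
    refine h.false_of_bvec hϖ 0 fun y hy => ?_
    obtain ⟨y, hy', rfl⟩ := (mem_plat_iff _ _ _).mp hy
    rw [form_bvec_zero hϖ]
    exact (mul_le_of_le_one_right' (hy' 3)).trans (hϖ.zpow_le_iff.mpr (by omega))
  · by_contra hlt
    refine h.false_of_bvec hϖ 1 fun y hy => ?_
    obtain ⟨y, hy', rfl⟩ := (mem_plat_iff _ _ _).mp hy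
    rw [form_bvec_one hϖ]
    exact (mul_le_of_le_one_right' (hy' 2)).trans (hϖ.zpow_le_iff.mpr (by omega))

theorem between_plat_iff (hϖ : IsUniformizer ϖ) (g : GL (Fin 4) F) (a b : Fin 4 → ℤ) :
    Between (plat ϖ g a) (plat ϖ g b) ↔ ∀ i, b i ≤ a i ∧ a i ≤ b i + 1 := by
  unfold Between
  rw [maximalIdeal_smul_plat hϖ, plat_le_iff hϖ, plat_le_iff hϖ]
  exact ⟨fun h i => ⟨h.2 i, h.1 i⟩, fun h => ⟨fun i => (h i).2, fun i => (h i).1⟩⟩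

/-- Two nested lattices of an apartment that look incident to a common primitive lattice are. -/
theorem exists_isPrimitive_between (hϖ : IsUniformizer ϖ) (g : GSp4 F) (a b : Fin 4 → ℤ)
    (hab : ∀ i, a i ≤ b i ∧ b i ≤ a i + 1)
    (hs : 1 ≤ simOrd ϖ g + (a 0 + a 3)) (ht : 1 ≤ simOrd ϖ g + (a 1 + a 2))
    (hs' : simOrd ϖ g + (b 0 + b 3) ≤ 2) (ht' : simOrd ϖ g + (b 1 + b 2) ≤ 2) :
    ∃ c, IsPrimitive (plat ϖ (g : GL (Fin 4) F) c) ∧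
      Between (plat ϖ (g : GL (Fin 4) F) a) (plat ϖ (g : GL (Fin 4) F) c) ∧
      Between (plat ϖ (g : GL (Fin 4) F) b) (plat ϖ (g : GL (Fin 4) F) c) := by
  have arith : ∀ m p q p' q' : ℤ, p ≤ p' → p' ≤ p + 1 → q ≤ q' → q' ≤ q + 1 → 1 ≤ m + (p + q) →
      m + (p' + q') ≤ 2 → ∃ r s, m + (r + s) = 0 ∧ r ≤ p ∧ p' ≤ r + 1 ∧ s ≤ q ∧ q' ≤ s + 1 := by
    intro m p q p' q' h1 h2 h3 h4 h5 h6
    by_cases h7 : m + (p + q) = 2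
    · exact ⟨p - 1, q - 1, by omega, by omega, by omega, by omega, by omega⟩
    · by_cases h8 : p' = p
      · exact ⟨p - 1, q, by omega, by omega, by omega, by omega, by omega⟩
      · exact ⟨p, q - 1, by omega, by omega, by omega, by omega, by omega⟩
  obtain ⟨c0, c3, h1, h2, h3, h4, h5⟩ := arith _ _ _ _ _ (hab 0).1 (hab 0).2 (hab 3).1 (hab 3).2
    hs hs'
  obtain ⟨c1, c2, k1, k2, k3, k4, k5⟩ := arith _ _ _ _ _ (hab 1).1 (hab 1).2 (hab 2).1 (hab 2).2
    ht ht'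
  refine ⟨![c0, c1, c2, c3], (isPrimitive_plat_iff hϖ _ _).mpr ⟨h1, k1⟩,
    (between_plat_iff hϖ _ _ _).mpr ?_, (between_plat_iff hϖ _ _ _).mpr ?_⟩
  · intro i
    have := hab i
    fin_cases i <;> simp at this ⊢ <;> omega
  · intro i
    have := hab i
    fin_cases i <;> simp at this ⊢ <;> omega

/-- The condition on the exponents `a` for `g · diag(ϖ ^ a) · 𝒪⁴` to represent a vertex, where
`m` is the order of the similitude factor of `g`. The division is division with floor. -/
def VCond (m : ℤ) (a : Fin 4 → ℤ) : Prop := (m + (a 0 + a 3) - 1) / 2 = (m + (a 1 + a 2) - 1) / 2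

theorem vCond_of_vertex (hϖ : IsUniformizer ϖ) {g : GSp4 F} {a : Fin 4 → ℤ} {v : Vertex F}
    (h : v.1 = (plat ϖ (g : GL (Fin 4) F) a).cls) : VCond (simOrd ϖ g) a := by
  obtain ⟨L, hL, hL'⟩ := v.2
  obtain ⟨k, rfl⟩ := exists_eq_plat hϖ (hL.trans h)
  unfold VCond
  rcases hL' with hp | ⟨L₀, hi⟩
  · rw [isPrimitive_plat_iff hϖ] at hp
    omega
  · have := hi.simOrd_plat hϖ
    omega

theorem exists_shift {m : ℤ} {a : Fin 4 → ℤ} (h : VCond m a) : ∃ k : ℤ,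
    (1 ≤ m + ((a 0 + k) + (a 3 + k)) ∧ m + ((a 0 + k) + (a 3 + k)) ≤ 2) ∧
      1 ≤ m + ((a 1 + k) + (a 2 + k)) ∧ m + ((a 1 + k) + (a 2 + k)) ≤ 2 := by
  unfold VCond at h
  refine ⟨-((m + (a 0 + a 3) - 1) / 2), ?_⟩
  omega

theorem exists_vertex (hϖ : IsUniformizer ϖ) {g : GSp4 F} {a : Fin 4 → ℤ}
    (h : VCond (simOrd ϖ g) a) : ∃ L : VLattice F,
      L.cls = (plat ϖ (g : GL (Fin 4) F) a).cls ∧ (IsPrimitive L ∨ ∃ L₀, Incident L L₀) := by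
  obtain ⟨k, ⟨h1, h2⟩, h3, h4⟩ := exists_shift h
  refine ⟨plat ϖ (g : GL (Fin 4) F) (fun i => a i + k), cls_plat_add hϖ _ _ _, Or.inr ?_⟩
  obtain ⟨c, hc, hb, -⟩ := exists_isPrimitive_between hϖ g (fun i => a i + k) (fun i => a i + k)
    (fun i => ⟨le_rfl, by linarith⟩) h1 h3 h2 h4
  refine ⟨_, hc, hb, ?_⟩
  simp only [exists_mem_maximalIdeal_iff hϖ]
  have := (form_plat_le_iff hϖ g (fun i => a i + k) 1).mpr ⟨h1, h3⟩
  rwa [zpow_one] at this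

theorem Adj.symm {v w : Vertex F} (h : Adj v w) : Adj w v := by
  obtain ⟨hne, L', L'', L, h1, h2, h3, h4, h5, h6⟩ := h
  exact ⟨hne.symm, L'', L', L, h2, h1, h3.symm, h4, h6, h5⟩

theorem Adj.exists_coords (hϖ : IsUniformizer ϖ) {g : GL (Fin 4) F} {a b : Fin 4 → ℤ}
    {v w : Vertex F} (hv : v.1 = (plat ϖ g a).cls) (hw : w.1 = (plat ϖ g b).cls) (h : Adj v w) :
    ∃ k : ℤ, ∀ i, a i ≤ b i + k ∧ b i + k ≤ a i + 1 := by
  obtain ⟨-, L', L'', L, h1, h2, h3, -, ⟨h5, h5'⟩, h6, h6'⟩ := h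
  obtain ⟨k, rfl⟩ := exists_eq_plat hϖ (h1.trans hv)
  obtain ⟨l, rfl⟩ := exists_eq_plat hϖ (h2.trans hw)
  rcases h3 with h3 | h3
  · have h7 := (Submodule.smul_mono (le_refl (IsLocalRing.maximalIdeal 𝒪[F])) h6').trans h5
    rw [maximalIdeal_smul_plat hϖ, plat_le_iff hϖ] at h7
    rw [plat_le_iff hϖ] at h3
    exact ⟨l - k + 1, fun i => by have := h3 i; have := h7 i; constructor <;> linarith⟩
  · have h7 := (Submodule.smul_mono (le_refl (IsLocalRing.maximalIdeal 𝒪[F])) h5').trans h6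
    rw [maximalIdeal_smul_plat hϖ, plat_le_iff hϖ] at h7
    rw [plat_le_iff hϖ] at h3
    exact ⟨l - k, fun i => by have := h3 i; have := h7 i; constructor <;> linarith⟩

/-- Two vertices whose exponents differ by `0` or `1` are joined by an edge: up to scaling, both
lattices lie between some primitive lattice `L` and `ϖ L`. -/
theorem adj_of_coords (hϖ : IsUniformizer ϖ) {g : GSp4 F} {a b : Fin 4 → ℤ}
    {v w : Vertex F} (hv : v.1 = (plat ϖ (g : GL (Fin 4) F) a).cls)
    (hw : w.1 = (plat ϖ (g : GL (Fin 4) F) b).cls)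
    (hab : ∀ i, a i ≤ b i ∧ b i ≤ a i + 1) (hne : ¬ ∃ k : ℤ, ∀ i, a i = b i + k) : Adj v w := by
  have hvw : v ≠ w := by
    rintro rfl
    exact hne ((cls_plat_eq_iff hϖ _ _ _).mp (hv.symm.trans hw))
  have ha := vCond_of_vertex hϖ hv
  have hb := vCond_of_vertex hϖ hw
  obtain ⟨k, ⟨h1, h2⟩, h3, h4⟩ := exists_shift ha
  unfold VCond at ha hb
  have hab0 := hab 0
  have hab1 := hab 1
  have hab2 := hab 2
  have hab3 := hab 3
  by_cases hc : simOrd ϖ g + (b 0 + k + (b 3 + k)) ≤ 2 ∧ simOrd ϖ g + (b 1 + k + (b 2 + k)) ≤ 2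
  · obtain ⟨c, hc1, hc2, hc3⟩ := exists_isPrimitive_between hϖ g (fun i => a i + k)
      (fun i => b i + k) (fun i => by have := hab i; constructor <;> linarith) h1 h3 hc.1 hc.2
    refine ⟨hvw, _, _, _, ?_, ?_, Or.inr ?_, hc1, hc2, hc3⟩
    · rw [cls_plat_add hϖ, hv]
    · rw [cls_plat_add hϖ, hw]
    · rw [plat_le_iff hϖ]
      intro i; have := hab i; linarith
  · obtain ⟨c, hc1, hc2, hc3⟩ := exists_isPrimitive_between hϖ g (fun i => b i + (k - 1))
      (fun i => a i + k) (fun i => by have := hab i; constructor <;> linarith)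
      (by omega) (by omega) h2 h4
    refine ⟨hvw, _, _, _, ?_, ?_, Or.inl ?_, hc1, hc3, hc2⟩
    · rw [cls_plat_add hϖ, hv]
    · rw [cls_plat_add hϖ, hw]
    · rw [plat_le_iff hϖ]
      intro i; have := hab i; linarith

end Apartment

/-! ### The two kinds of lines of the building -/

/-- The exponents of the `j`-th vertex of a line, for a frame whose similitude factor has order `m`.
For `τ = false` the line runs along the hypotenuses of the chambers, for `τ = true` along their
legs. In the latter case the vertices with odd `j` are not special, and the lattice representing
them depends on the parity of `m`. -/
def lineX (τ : Bool) (m j : ℤ) : Fin 4 → ℤ :=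
  match τ with
  | false => ![0, 0, j, j]
  | true => ![0, (m + j - 1) / 2 - (m - 1) / 2, (m + j - 1) / 2 - (m - 1) / 2, j]

/-- The block structure of the congruence subgroup attached to a line: Siegel for `false`,
Klingen for `true`. -/
def lam (τ : Bool) : Fin 4 → ℕ :=
  match τ with
  | false => ![0, 0, 1, 1]
  | true => ![0, 1, 1, 2]

theorem vCond_lineX (τ : Bool) (m j : ℤ) : VCond m (lineX τ m j) := by
  cases τ <;> (simp [VCond, lineX]; try omega)

theorem lineX_mono {τ : Bool} {r c : Fin 4} (h : lam τ c < lam τ r) (m : ℤ) {j j' : ℤ}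
    (hj : j ≤ j') : lineX τ m j r - lineX τ m j c ≤ lineX τ m j' r - lineX τ m j' c := by
  cases τ <;> fin_cases r <;> fin_cases c <;> simp [lam, lineX] at h ⊢ <;> omega

theorem lineX_const {τ : Bool} {r c : Fin 4} (h : lam τ c = lam τ r) (m j : ℤ) :
    lineX τ m j r - lineX τ m j c = 0 := by
  cases τ <;> fin_cases r <;> fin_cases c <;> simp [lam, lineX] at h ⊢

theorem lam_rev {τ : Bool} {r c : Fin 4} : lam τ (Fin.rev r) < lam τ (Fin.rev c) ↔
    lam τ c < lam τ r := by
  cases τ <;> fin_cases r <;> fin_cases c <;> simp [lam, Fin.rev]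

theorem lam_rev_eq {τ : Bool} {r c : Fin 4} : lam τ (Fin.rev r) = lam τ (Fin.rev c) ↔
    lam τ c = lam τ r := by
  cases τ <;> fin_cases r <;> fin_cases c <;> simp [lam, Fin.rev]

theorem lineX_zero (τ : Bool) (m : ℤ) : lineX τ m 0 = 0 := by
  cases τ <;> ext i <;> fin_cases i <;> simp [lineX]

theorem lineX_one_le (τ : Bool) (m : ℤ) (r c : Fin 4) :
    lineX τ m 1 r - lineX τ m 1 c ≤ 1 ∧
      (0 < lineX τ m 1 r - lineX τ m 1 c → lam τ c < lam τ r) := by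
  cases τ <;> fin_cases r <;> fin_cases c <;> simp [lam, lineX] <;> omega

theorem lineX_one_eq {τ : Bool} {r c : Fin 4} (h : lam τ c < lam τ r) (m : ℤ) :
    1 ≤ lineX τ m 1 r - lineX τ m 1 c ∨ 1 ≤ lineX τ m 1 (Fin.rev c) - lineX τ m 1 (Fin.rev r) := by
  cases τ <;> fin_cases r <;> fin_cases c <;> simp [lam, lineX, Fin.rev] at h ⊢ <;> omega

section Lines

variable {F : Type*} [Field F] [ValuativeRel F]
  {ϖ : Fˣ}

local notation "ν" => valuation F

/-! ### Stabilizers of lattices of the standard apartment -/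

/-- The stabilizer of the lattice `diag(ϖ ^ a) · 𝒪⁴`. -/
def stab (ϖ : Fˣ) (a : Fin 4 → ℤ) : Subgroup (GL (Fin 4) F) :=
  (K F).comap (MulAut.conj (D ϖ a)⁻¹).toMonoidHom

theorem mem_stab {a : Fin 4 → ℤ} {s : GL (Fin 4) F} :
    s ∈ stab ϖ a ↔ (D ϖ a)⁻¹ * s * D ϖ a ∈ K F := by
  simp [stab, Subgroup.mem_comap]

theorem intM_conj_iff (a : Fin 4 → ℤ) (s : GL (Fin 4) F) :
    IntM (((D ϖ a)⁻¹ * s * D ϖ a : GL (Fin 4) F) : Matrix (Fin 4) (Fin 4) F) ↔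
      ∀ r c, ν ((s : Matrix (Fin 4) (Fin 4) F) r c) ≤ ν (ϖ : F) ^ (a r - a c) := by
  refine forall_congr' fun r => forall_congr' fun c => ?_
  rw [← D_neg, D_mul_apply, map_mul, map_zpow₀, Pi.neg_apply,
    show -a r + a c = -(a r - a c) by ring, zpow_neg,
    inv_mul_le_iff₀ (zpow_pos (val_unit_pos ϖ) _), mul_one]

theorem mem_stab_iff {a : Fin 4 → ℤ} {s : GL (Fin 4) F} :
    s ∈ stab ϖ a ↔
      (∀ r c, ν ((s : Matrix (Fin 4) (Fin 4) F) r c) ≤ ν (ϖ : F) ^ (a r - a c)) ∧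
      ∀ r c, ν (((s⁻¹ : GL (Fin 4) F) : Matrix (Fin 4) (Fin 4) F) r c) ≤
        ν (ϖ : F) ^ (a r - a c) := by
  rw [mem_stab, mem_K, intM_conj_iff, ← intM_conj_iff]
  have : ((D ϖ a)⁻¹ * s * D ϖ a)⁻¹ = (D ϖ a)⁻¹ * s⁻¹ * D ϖ a := by group
  rw [this, intM_conj_iff, intM_conj_iff]

theorem val_inv_apply {s : GSp4 F} (hs : ν (mu s : F) = 1) (r c : Fin 4) :
    ν ((((s : GL (Fin 4) F)⁻¹ : GL (Fin 4) F) : Matrix (Fin 4) (Fin 4) F) r c) =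
      ν (((s : GL (Fin 4) F) : Matrix (Fin 4) (Fin 4) F) (Fin.rev c) (Fin.rev r)) := by
  rw [← Subgroup.coe_inv, inv_apply, map_mul, map_mul, map_inv₀, hs]
  rcases Int.units_eq_one_or (sgn r * sgn c) with h | h <;> rw [h] <;> simp

theorem mem_stab_iff_of_mu {a : Fin 4 → ℤ} {s : GSp4 F} (hs : ν (mu s : F) = 1) :
    (s : GL (Fin 4) F) ∈ stab ϖ a ↔ ∀ r c,
      ν (((s : GL (Fin 4) F) : Matrix (Fin 4) (Fin 4) F) r c) ≤ ν (ϖ : F) ^ (a r - a c) ∧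
      ν (((s : GL (Fin 4) F) : Matrix (Fin 4) (Fin 4) F) r c) ≤
        ν (ϖ : F) ^ (a (Fin.rev c) - a (Fin.rev r)) := by
  rw [mem_stab_iff]
  simp only [val_inv_apply hs]
  constructor
  · rintro ⟨h1, h2⟩ r c
    refine ⟨h1 r c, ?_⟩
    have := h2 (Fin.rev c) (Fin.rev r)
    rwa [Fin.rev_rev, Fin.rev_rev] at this
  · intro h
    refine ⟨fun r c => (h r c).1, fun r c => ?_⟩
    have := (h (Fin.rev c) (Fin.rev r)).2
    rwa [Fin.rev_rev, Fin.rev_rev] at this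

theorem val_det_of_mem_stab {a : Fin 4 → ℤ} {s : GL (Fin 4) F} (hs : s ∈ stab ϖ a) :
    ν (s : Matrix (Fin 4) (Fin 4) F).det = 1 := by
  rw [mem_stab] at hs
  have := val_det_of_mem_K hs
  rw [← this, Units.val_mul, Units.val_mul, Matrix.det_mul, Matrix.det_mul]
  have h : ((D ϖ a)⁻¹ : GL (Fin 4) F).1.det * (D ϖ a : GL (Fin 4) F).1.det = 1 := by
    rw [← Matrix.det_mul, ← Units.val_mul, inv_mul_cancel, Units.val_one, Matrix.det_one]
  rw [mul_comm _ (s : Matrix (Fin 4) (Fin 4) F).det, mul_assoc, h, mul_one]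

theorem val_eq_one_of_pow {x : F} {n : ℕ} (hn : n ≠ 0) (h : ν x ^ n = 1) : ν x = 1 :=
  (pow_eq_one_iff_of_nonneg zero_le hn).mp h

theorem val_mu_of_mem_stab {a : Fin 4 → ℤ} {s : GSp4 F} (hs : (s : GL (Fin 4) F) ∈ stab ϖ a) :
    ν (mu s : F) = 1 := by
  have h := det_sq s
  apply val_eq_one_of_pow (n := 4) (by norm_num)
  rw [← map_pow, ← h, map_pow, val_det_of_mem_stab hs, one_pow]

theorem scalarGL_mem_stab {z : Fˣ} (hz : ν (z : F) = 1) (a : Fin 4 → ℤ) :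
    scalarGL z ∈ stab ϖ a := by
  rw [mem_stab, scalarGL_comm, mul_assoc, inv_mul_cancel, mul_one]
  exact scalarGL_mem_K hz

theorem val_scalar_eq {a b : Fin 4 → ℤ} {s : GL (Fin 4) F} {α β : Fˣ}
    (ha : scalarGL α * s ∈ stab ϖ a) (hb : scalarGL β * s ∈ stab ϖ b) :
    ν ((β * α⁻¹ : Fˣ) : F) = 1 := by
  have h1 := val_det_of_mem_stab ha
  have h2 := val_det_of_mem_stab hb
  rw [det_scalarGL_mul, map_mul] at h1 h2
  have hs : ν (s : Matrix (Fin 4) (Fin 4) F).det ≠ 0 := fun h => by simp [h] at h1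
  have h3 := mul_right_cancel₀ hs (h2.trans h1.symm)
  apply val_eq_one_of_pow (n := 4) (by norm_num)
  rw [← map_pow, Units.val_mul, mul_pow, map_mul, h3, ← map_mul, ← mul_pow, ← Units.val_mul]
  simp

theorem cls_plat_mul (g s : GL (Fin 4) F) {a : Fin 4 → ℤ} (hs : s ∈ stab ϖ a) :
    (plat ϖ (g * s) a).cls = (plat ϖ g a).cls := by
  rw [plat, plat, ← lat_mul_K (g * D ϖ a) _ (mem_stab.mp hs)]
  congr 2
  group

theorem cls_plat_eq_iff_stab (g h : GL (Fin 4) F) (a : Fin 4 → ℤ) :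
    (plat ϖ g a).cls = (plat ϖ h a).cls ↔ ∃ α : Fˣ, scalarGL α * (g⁻¹ * h) ∈ stab ϖ a := by
  rw [plat, plat, cls_lat_eq_iff]
  refine exists_congr fun α => ?_
  rw [mem_stab]
  have : (D ϖ a)⁻¹ * (scalarGL α * (g⁻¹ * h)) * D ϖ a =
      scalarGL α * ((g * D ϖ a)⁻¹ * (h * D ϖ a)) := by
    rw [← mul_assoc (D ϖ a)⁻¹, scalarGL_comm]; group
  rw [this]

theorem scalarGL_cls (g : GL (Fin 4) F) (a : Fin 4 → ℤ) (z : Fˣ) :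
    (plat ϖ (scalarGL z * g) a).cls = (plat ϖ g a).cls := by
  rw [eq_comm, cls_eq_iff]
  exact ⟨z, by rw [plat, plat, smul_lat, mul_assoc]⟩

theorem coe_scalarG_mul (α : Fˣ) (s : GSp4 F) :
    ((scalarG α * s : GSp4 F) : GL (Fin 4) F) = scalarGL α * (s : GL (Fin 4) F) := rfl

theorem stab_lower [TopologicalSpace F] [IsNonarchimedeanLocalField F] (hϖ : IsUniformizer ϖ)
    {τ : Bool} {m j j' : ℤ} (hj : j ≤ j') {u : GSp4 F}
    (hu0 : ∀ r c, lam τ r < lam τ c → ((u : GL (Fin 4) F) : Matrix (Fin 4) (Fin 4) F) r c = 0)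
    (hu : (u : GL (Fin 4) F) ∈ stab ϖ (lineX τ m j')) : (u : GL (Fin 4) F) ∈ stab ϖ (lineX τ m j) := by
  have hmu := val_mu_of_mem_stab hu
  rw [mem_stab_iff_of_mu hmu] at hu ⊢
  intro r c
  rcases lt_trichotomy (lam τ r) (lam τ c) with h | h | h
  · rw [hu0 r c h]; simp
  · obtain ⟨h1, h2⟩ := hu r c
    rw [lineX_const h.symm] at h1 ⊢
    rw [lineX_const (lam_rev_eq.mpr h.symm)] at h2 ⊢
    exact ⟨h1, h2⟩
  · obtain ⟨h1, h2⟩ := hu r c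
    exact ⟨h1.trans (hϖ.zpow_le_iff.mpr (lineX_mono h m hj)),
      h2.trans (hϖ.zpow_le_iff.mpr (lineX_mono (lam_rev.mpr h) m hj))⟩

theorem stab_upper [TopologicalSpace F] [IsNonarchimedeanLocalField F] (hϖ : IsUniformizer ϖ)
    {τ : Bool} {m j j' : ℤ} (hj : j ≤ j') {u : GSp4 F}
    (hu0 : ∀ r c, lam τ c < lam τ r → ((u : GL (Fin 4) F) : Matrix (Fin 4) (Fin 4) F) r c = 0)
    (hu : (u : GL (Fin 4) F) ∈ stab ϖ (lineX τ m j)) : (u : GL (Fin 4) F) ∈ stab ϖ (lineX τ m j') := by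
  have hmu := val_mu_of_mem_stab hu
  rw [mem_stab_iff_of_mu hmu] at hu ⊢
  intro r c
  rcases lt_trichotomy (lam τ r) (lam τ c) with h | h | h
  · obtain ⟨h1, h2⟩ := hu r c
    have k1 := lineX_mono h m hj
    have k2 := lineX_mono (lam_rev.mpr h) m hj
    exact ⟨h1.trans (hϖ.zpow_le_iff.mpr (by linarith)),
      h2.trans (hϖ.zpow_le_iff.mpr (by linarith))⟩
  · obtain ⟨h1, h2⟩ := hu r c
    rw [lineX_const h.symm] at h1 ⊢
    rw [lineX_const (lam_rev_eq.mpr h.symm)] at h2 ⊢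
    exact ⟨h1, h2⟩
  · rw [hu0 r c h]; simp

end Lines

/-! ### Unipotent elements and the Iwahori factorization -/

section Unipotent

variable {F : Type*} [Field F]

/-- The matrix with lower left block `(p, q; r, p)` in the opposite Siegel unipotent radical. -/
def siegelMat (p q r : F) : Matrix (Fin 4) (Fin 4) F :=
  !![1, 0, 0, 0; 0, 1, 0, 0; p, q, 1, 0; r, p, 0, 1]

/-- The matrix with first column `(1, x, y, z)` in the opposite Klingen unipotent radical. -/
def klingenMat (x y z : F) : Matrix (Fin 4) (Fin 4) F :=
  !![1, 0, 0, 0; x, 1, 0, 0; y, 0, 1, 0; z, y, -x, 1]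

theorem klingenMat_mul (x y z x' y' z' : F) : klingenMat x y z * klingenMat x' y' z' =
    klingenMat (x + x') (y + y') (z + y * x' - x * y' + z') := by
  ext i j
  fin_cases i <;> fin_cases j <;>
    simp [klingenMat, Matrix.mul_apply, Fin.sum_univ_four] <;> ring

theorem klingenMat_zero : klingenMat 0 0 0 = (1 : Matrix (Fin 4) (Fin 4) F) := by
  ext i j
  fin_cases i <;> fin_cases j <;> simp [klingenMat]

theorem klingenMat_form (x y z : F) : (klingenMat x y z)ᵀ * J F * klingenMat x y z = J F := by
  ext i j
  fin_cases i <;> fin_cases j <;>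
    simp [klingenMat, J, Matrix.mul_apply, Fin.sum_univ_four]
  ring

theorem siegelMat_mul (p q r p' q' r' : F) : siegelMat p q r * siegelMat p' q' r' =
    siegelMat (p + p') (q + q') (r + r') := by
  ext i j
  fin_cases i <;> fin_cases j <;>
    simp [siegelMat, Matrix.mul_apply, Fin.sum_univ_four]

theorem siegelMat_zero : siegelMat 0 0 0 = (1 : Matrix (Fin 4) (Fin 4) F) := by
  ext i j
  fin_cases i <;> fin_cases j <;> simp [siegelMat]

theorem siegelMat_form (p q r : F) : (siegelMat p q r)ᵀ * J F * siegelMat p q r = J F := by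
  ext i j
  fin_cases i <;> fin_cases j <;>
    simp [siegelMat, J, Matrix.mul_apply, Fin.sum_univ_four]

/-- The element of the opposite Siegel unipotent radical with lower left block `(p, q; r, p)`. -/
def siegelU (p q r : F) : GSp4 F :=
  ⟨⟨siegelMat p q r, siegelMat (-p) (-q) (-r),
    by rw [siegelMat_mul]; simp [← siegelMat_zero],
    by rw [siegelMat_mul]; simp [← siegelMat_zero]⟩, 1, by
    simp [siegelMat_form]⟩

/-- The element of the opposite Klingen unipotent radical with first column `(1, x, y, z)`. -/
def klingenU (x y z : F) : GSp4 F :=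
  ⟨⟨klingenMat x y z, klingenMat (-x) (-y) (-z),
    by rw [klingenMat_mul, ← klingenMat_zero]; congr 1 <;> ring,
    by rw [klingenMat_mul, ← klingenMat_zero]; congr 1 <;> ring⟩, 1, by
    simp [klingenMat_form]⟩

theorem coe_siegelU (p q r : F) :
    ((siegelU p q r : GL (Fin 4) F) : Matrix (Fin 4) (Fin 4) F) = siegelMat p q r := rfl

theorem coe_klingenU (x y z : F) :
    ((klingenU x y z : GL (Fin 4) F) : Matrix (Fin 4) (Fin 4) F) = klingenMat x y z := rfl

theorem coe_siegelU_inv (p q r : F) :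
    (((siegelU p q r)⁻¹ : GSp4 F) : GL (Fin 4) F) = (siegelU (-p) (-q) (-r) : GL (Fin 4) F) := by
  rw [Subgroup.coe_inv]
  refine inv_eq_of_mul_eq_one_right (Units.ext ?_)
  rw [Units.val_mul, coe_siegelU, coe_siegelU, siegelMat_mul, Units.val_one, ← siegelMat_zero]
  congr 1 <;> ring

theorem coe_klingenU_inv (x y z : F) :
    (((klingenU x y z)⁻¹ : GSp4 F) : GL (Fin 4) F) = (klingenU (-x) (-y) (-z) : GL (Fin 4) F) := by
  rw [Subgroup.coe_inv]
  refine inv_eq_of_mul_eq_one_right (Units.ext ?_)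
  rw [Units.val_mul, coe_klingenU, coe_klingenU, klingenMat_mul, Units.val_one, ← klingenMat_zero]
  congr 1 <;> ring

theorem siegelMat_apply_eq_zero {p q r : F} {i j : Fin 4} (h : lam false i < lam false j) :
    siegelMat p q r i j = 0 := by
  revert h
  fin_cases i <;> fin_cases j <;> simp [siegelMat, lam]

theorem klingenMat_apply_eq_zero {x y z : F} {i j : Fin 4} (h : lam true i < lam true j) :
    klingenMat x y z i j = 0 := by
  revert h
  fin_cases i <;> fin_cases j <;> simp [klingenMat, lam]

theorem siegelMat_mul_eq_zero {S : Matrix (Fin 4) (Fin 4) F} {δ : F}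
    (hδ : δ = S 0 0 * S 1 1 - S 0 1 * S 1 0) (hδ0 : δ ≠ 0)
    (hS : S 0 0 * S 3 1 + S 1 0 * S 2 1 - S 2 0 * S 1 1 - S 3 0 * S 0 1 = 0)
    {i j : Fin 4} (h : lam false j < lam false i) :
    (siegelMat (-((S 2 0 * S 1 1 - S 2 1 * S 1 0) / δ)) (-((S 2 1 * S 0 0 - S 2 0 * S 0 1) / δ))
      (-((S 3 0 * S 1 1 - S 3 1 * S 1 0) / δ)) * S) i j = 0 := by
  rw [Matrix.mul_apply, Fin.sum_univ_four]
  have h4 : (i = 2 ∧ j = 0) ∨ (i = 2 ∧ j = 1) ∨ (i = 3 ∧ j = 0) ∨ (i = 3 ∧ j = 1) := by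
    revert i j; decide
  rcases h4 with ⟨rfl, rfl⟩ | ⟨rfl, rfl⟩ | ⟨rfl, rfl⟩ | ⟨rfl, rfl⟩ <;>
    simp [siegelMat] <;> field_simp
  · linear_combination S 2 0 * hδ
  · linear_combination S 2 1 * hδ
  · linear_combination S 3 0 * hδ + S 1 0 * hS
  · linear_combination S 3 1 * hδ + S 1 1 * hS

theorem mu_siegelU (p q r : F) : mu (siegelU p q r) = 1 := mu_unique (by
  rw [coe_siegelU, siegelMat_form, Units.val_one, one_smul])

theorem mu_klingenU (x y z : F) : mu (klingenU x y z) = 1 := mu_unique (by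
  rw [coe_klingenU, klingenMat_form, Units.val_one, one_smul])

/-- The columns of a similitude satisfy the relations of the standard basis. -/
theorem form_col (s : GSp4 F) (i j : Fin 4) :
    form (fun k => ((s : GL (Fin 4) F) : Matrix (Fin 4) (Fin 4) F) k i)
      (fun k => ((s : GL (Fin 4) F) : Matrix (Fin 4) (Fin 4) F) k j) = (mu s : F) * J F i j := by
  have h := form_mulVec s (Pi.single i 1) (Pi.single j 1)
  rw [Matrix.mulVec_single_one, Matrix.mulVec_single_one] at h
  refine h.trans ?_
  congr 1
  simp [form]

end Unipotent

section Factorization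

variable {F : Type*} [Field F] [ValuativeRel F] [TopologicalSpace F] [IsNonarchimedeanLocalField F]
  {ϖ : Fˣ}

local notation "ν" => valuation F

theorem val_lt_one_of_le_zpow (hϖ : IsUniformizer ϖ) {x y : F} {a b : ℤ}
    (hx : ν x ≤ ν (ϖ : F) ^ a) (hy : ν y ≤ ν (ϖ : F) ^ b) (hab : 0 < a + b) : ν (x * y) < 1 := by
  rw [map_mul]
  refine (mul_le_mul' hx hy).trans_lt ?_
  rw [← zpow_add₀ (val_unit_ne_zero ϖ), ← zpow_zero (ν (ϖ : F)), hϖ.zpow_lt_iff]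
  exact hab

theorem val_add_lt_one {x y : F} (hx : ν x < 1) (hy : ν y < 1) : ν (x + y) < 1 :=
  (Valuation.map_add _ _ _).trans_lt (max_lt hx hy)

theorem val_mul_lt_one {x y : F} (hx : ν x < 1) (hy : ν y < 1) : ν (x * y) < 1 := by
  rw [map_mul]; exact (mul_le_of_le_one_right' hy.le).trans_lt hx

theorem siegelU_mem_stab {m j : ℤ} {p q r : F} (hp : ν p ≤ ν (ϖ : F) ^ j)
    (hq : ν q ≤ ν (ϖ : F) ^ j) (hr : ν r ≤ ν (ϖ : F) ^ j) :
    (siegelU p q r : GL (Fin 4) F) ∈ stab ϖ (lineX false m j) := by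
  rw [mem_stab_iff_of_mu (by rw [mu_siegelU]; simp), coe_siegelU]
  intro a b
  fin_cases a <;> fin_cases b <;> simp [siegelMat, lineX, Fin.rev, hp, hq, hr]

theorem klingenU_mem_stab {m j : ℤ} {x y z : F}
    (hx : ν x ≤ ν (ϖ : F) ^ ((m + j - 1) / 2 - (m - 1) / 2))
    (hx' : ν x ≤ ν (ϖ : F) ^ (j - ((m + j - 1) / 2 - (m - 1) / 2)))
    (hy : ν y ≤ ν (ϖ : F) ^ ((m + j - 1) / 2 - (m - 1) / 2))
    (hy' : ν y ≤ ν (ϖ : F) ^ (j - ((m + j - 1) / 2 - (m - 1) / 2)))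
    (hz : ν z ≤ ν (ϖ : F) ^ j) :
    (klingenU x y z : GL (Fin 4) F) ∈ stab ϖ (lineX true m j) := by
  rw [mem_stab_iff_of_mu (by rw [mu_klingenU]; simp), coe_klingenU]
  intro a b
  fin_cases a <;> fin_cases b <;>
    simp [klingenMat, lineX, Fin.rev, Valuation.map_neg, hx, hx', hy, hy', hz]

theorem val_eq_one_of_mul {x y e : F} (hx : ν x ≤ 1) (hy : ν y ≤ 1) (he : ν e < 1)
    (h : x * y = 1 - e) : ν x = 1 := by
  have h1 : ν (x * y) = 1 := by rw [h]; exact Valuation.map_one_sub_of_lt _ he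
  rw [map_mul] at h1
  refine le_antisymm hx ?_
  rw [← h1]
  exact mul_le_of_le_one_right' hy

theorem inv_mul_entry (s : GL (Fin 4) F) (i j : Fin 4) :
    (s : Matrix (Fin 4) (Fin 4) F) i 0 * ((s⁻¹ : GL (Fin 4) F) : Matrix (Fin 4) (Fin 4) F) 0 j +
    (s : Matrix (Fin 4) (Fin 4) F) i 1 * ((s⁻¹ : GL (Fin 4) F) : Matrix (Fin 4) (Fin 4) F) 1 j +
    (s : Matrix (Fin 4) (Fin 4) F) i 2 * ((s⁻¹ : GL (Fin 4) F) : Matrix (Fin 4) (Fin 4) F) 2 j +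
    (s : Matrix (Fin 4) (Fin 4) F) i 3 * ((s⁻¹ : GL (Fin 4) F) : Matrix (Fin 4) (Fin 4) F) 3 j =
      if i = j then 1 else 0 := by
  rw [← Fin.sum_univ_four (f := fun k => (s : Matrix (Fin 4) (Fin 4) F) i k *
    ((s⁻¹ : GL (Fin 4) F) : Matrix (Fin 4) (Fin 4) F) k j), ← Matrix.mul_apply, ← Units.val_mul,
    mul_inv_cancel, Units.val_one, Matrix.one_apply]

/-- The factor `u` of `s = u p`, with `u` lower unipotent and `p` block upper triangular, for `s`
stabilizing an edge on a line along hypotenuses. -/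
theorem exists_siegelU (hϖ : IsUniformizer ϖ) {m i : ℤ} {s : GSp4 F}
    (h0 : (s : GL (Fin 4) F) ∈ stab ϖ (lineX false m i))
    (h1 : (s : GL (Fin 4) F) ∈ stab ϖ (lineX false m (i + 1))) :
    ∃ u : GSp4 F, mu u = 1 ∧ (u : GL (Fin 4) F) ∈ stab ϖ (lineX false m (i + 1)) ∧
      (∀ r c, lam false r < lam false c →
        ((u : GL (Fin 4) F) : Matrix (Fin 4) (Fin 4) F) r c = 0) ∧
      ∀ r c, lam false c < lam false r →
        (((u⁻¹ * s : GSp4 F) : GL (Fin 4) F) : Matrix (Fin 4) (Fin 4) F) r c = 0 := by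
  have hc := form_col s 0 1
  obtain ⟨e0, e0'⟩ := mem_stab_iff.mp h0
  obtain ⟨e1, e1'⟩ := mem_stab_iff.mp h1
  have inv := inv_mul_entry (s : GL (Fin 4) F)
  set S := ((s : GL (Fin 4) F) : Matrix (Fin 4) (Fin 4) F) with hS
  set T := (((s : GL (Fin 4) F)⁻¹ : GL (Fin 4) F) : Matrix (Fin 4) (Fin 4) F) with hT
  set δ := S 0 0 * S 1 1 - S 0 1 * S 1 0 with hδ
  have hA : ∀ M : Matrix (Fin 4) (Fin 4) F,
      (∀ r c, ν (M r c) ≤ ν (ϖ : F) ^ (lineX false m i r - lineX false m i c)) →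
      ν (M 0 0 * M 1 1 - M 0 1 * M 1 0) ≤ 1 := by
    intro M hM
    have h00 := hM 0 0
    have h01 := hM 0 1
    have h10 := hM 1 0
    have h11 := hM 1 1
    simp [lineX] at h00 h01 h10 h11
    exact (Valuation.map_sub _ _ _).trans (max_le (val_mul_le_one h00 h11) (val_mul_le_one h01 h10))
  have hx : ∀ a b : Fin 4, lam false a = 0 → lam false b = 0 →
      ν (S a 2 * T 2 b + S a 3 * T 3 b) < 1 := by
    intro a b ha hb
    apply val_add_lt_one
    · refine val_lt_one_of_le_zpow hϖ (e0 a 2) (e1' 2 b) ?_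
      fin_cases a <;> fin_cases b <;> simp [lineX, lam] at ha hb ⊢
    · refine val_lt_one_of_le_zpow hϖ (e0 a 3) (e1' 3 b) ?_
      fin_cases a <;> fin_cases b <;> simp [lineX, lam] at ha hb ⊢
  have x00 := hx 0 0 rfl rfl
  have x01 := hx 0 1 rfl rfl
  have x10 := hx 1 0 rfl rfl
  have x11 := hx 1 1 rfl rfl
  -- The upper left blocks of `s` and of its inverse are inverse to each other modulo `𝒫`, so the
  -- determinant `δ` of the first is a unit.
  have hδ1 : ν δ = 1 := by
    refine val_eq_one_of_mul (hA S e0) (hA T e0')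
      (e := (S 0 2 * T 2 0 + S 0 3 * T 3 0) + (S 1 2 * T 2 1 + S 1 3 * T 3 1) +
        -((S 0 2 * T 2 0 + S 0 3 * T 3 0) * (S 1 2 * T 2 1 + S 1 3 * T 3 1) +
          -((S 0 2 * T 2 1 + S 0 3 * T 3 1) * (S 1 2 * T 2 0 + S 1 3 * T 3 0)))) ?_ ?_
    · refine val_add_lt_one (val_add_lt_one x00 x11) ?_
      rw [Valuation.map_neg]
      refine val_add_lt_one ?_ ?_
      · exact val_mul_lt_one x00 x11
      · rw [Valuation.map_neg]; exact val_mul_lt_one x01 x10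
    · have i00 := inv 0 0
      have i01 := inv 0 1
      have i10 := inv 1 0
      have i11 := inv 1 1
      simp only [if_true, Fin.isValue, Fin.reduceEq, if_false] at i00 i01 i10 i11
      have j00 := sub_eq_of_eq_add (i00.symm.trans (add_assoc _ _ _))
      have j01 := sub_eq_of_eq_add (i01.symm.trans (add_assoc _ _ _))
      have j10 := sub_eq_of_eq_add (i10.symm.trans (add_assoc _ _ _))
      have j11 := sub_eq_of_eq_add (i11.symm.trans (add_assoc _ _ _))
      calc _ = (S 0 0 * T 0 0 + S 0 1 * T 1 0) * (S 1 0 * T 0 1 + S 1 1 * T 1 1) -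
            (S 0 0 * T 0 1 + S 0 1 * T 1 1) * (S 1 0 * T 0 0 + S 1 1 * T 1 0) := by rw [hδ]; ring
        _ = _ := by rw [← j00, ← j01, ← j10, ← j11]; ring
  have hδ0 : δ ≠ 0 := by rintro h; simp [h] at hδ1
  have hb : ∀ a b, ν a ≤ ν (ϖ : F) ^ (i + 1) → ν b ≤ 1 → ν (a * b) ≤ ν (ϖ : F) ^ (i + 1) := by
    intro a b ha hb
    rw [map_mul]; exact (mul_le_of_le_one_right' hb).trans ha
  have hb2 : ∀ a b, ν a ≤ ν (ϖ : F) ^ (i + 1) → ν b ≤ ν (ϖ : F) ^ (i + 1) →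
      ν ((a - b) / δ) ≤ ν (ϖ : F) ^ (i + 1) := by
    intro a b ha hb
    rw [map_div₀, hδ1, div_one]
    exact (Valuation.map_sub _ _ _).trans (max_le ha hb)
  have a00 := e1 0 0
  have a01 := e1 0 1
  have a10 := e1 1 0
  have a11 := e1 1 1
  have c20 := e1 2 0
  have c21 := e1 2 1
  have c30 := e1 3 0
  have c31 := e1 3 1
  simp [lineX] at a00 a01 a10 a11 c20 c21 c30 c31
  -- `u` has the lower left block `C A⁻¹`, for `A` and `C` the left blocks of `s`.
  refine ⟨siegelU ((S 2 0 * S 1 1 - S 2 1 * S 1 0) / δ) ((S 2 1 * S 0 0 - S 2 0 * S 0 1) / δ)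
    ((S 3 0 * S 1 1 - S 3 1 * S 1 0) / δ), mu_siegelU _ _ _, ?_, ?_, ?_⟩
  · exact siegelU_mem_stab (hb2 _ _ (hb _ _ c20 a11) (hb _ _ c21 a10))
      (hb2 _ _ (hb _ _ c21 a00) (hb _ _ c20 a01)) (hb2 _ _ (hb _ _ c30 a11) (hb _ _ c31 a10))
  · exact fun r c h => siegelMat_apply_eq_zero h
  · intro r c hrc
    rw [form_eq] at hc
    simp only [J, Matrix.of_apply, Matrix.cons_val_zero, Matrix.cons_val_one, mul_zero] at hc
    rw [Subgroup.coe_mul, Units.val_mul, coe_siegelU_inv, coe_siegelU, ← hS]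
    exact siegelMat_mul_eq_zero rfl hδ0 hc hrc

/-- The factor `u` of `s = u p`, with `u` lower unipotent and `p` block upper triangular, for `s`
stabilizing an edge on a line along legs. -/
theorem exists_klingenU (hϖ : IsUniformizer ϖ) {m i : ℤ} {s : GSp4 F}
    (h0 : (s : GL (Fin 4) F) ∈ stab ϖ (lineX true m i))
    (h1 : (s : GL (Fin 4) F) ∈ stab ϖ (lineX true m (i + 1))) :
    ∃ u : GSp4 F, mu u = 1 ∧ (u : GL (Fin 4) F) ∈ stab ϖ (lineX true m (i + 1)) ∧
      (∀ r c, lam true r < lam true c →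
        ((u : GL (Fin 4) F) : Matrix (Fin 4) (Fin 4) F) r c = 0) ∧
      ∀ r c, lam true c < lam true r →
        (((u⁻¹ * s : GSp4 F) : GL (Fin 4) F) : Matrix (Fin 4) (Fin 4) F) r c = 0 := by
  have hmu := val_mu_of_mem_stab h0
  obtain ⟨e0, e0'⟩ := mem_stab_iff.mp h0
  obtain ⟨e1, e1'⟩ := mem_stab_iff.mp h1
  have f0 := (mem_stab_iff_of_mu hmu).mp h0
  have f1 := (mem_stab_iff_of_mu hmu).mp h1
  have f0' := (mem_stab_iff_of_mu (s := s⁻¹) (by rw [mu_inv]; simpa using hmu)).mp (inv_mem h0)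
  have f1' := (mem_stab_iff_of_mu (s := s⁻¹) (by rw [mu_inv]; simpa using hmu)).mp (inv_mem h1)
  have inv := inv_mul_entry (s : GL (Fin 4) F) 0 0
  simp only [Subgroup.coe_inv] at f0' f1'
  set S := ((s : GL (Fin 4) F) : Matrix (Fin 4) (Fin 4) F) with hS
  set T := (((s : GL (Fin 4) F)⁻¹ : GL (Fin 4) F) : Matrix (Fin 4) (Fin 4) F) with hT
  have hx : ∀ k : Fin 4, k ≠ 0 → ν (S 0 k * T k 0) < 1 := by
    intro k hk
    -- Depending on parity, it is the lattices themselves or their duals that show that the product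
    -- is not a unit.
    by_cases hd : (m + (i + 1) - 1) / 2 = (m + i - 1) / 2
    · refine val_lt_one_of_le_zpow hϖ (f0 0 k).2 (f1' k 0).2 ?_
      fin_cases k <;> simp [lineX, Fin.rev] at hk ⊢ <;> omega
    · refine val_lt_one_of_le_zpow hϖ (f0 0 k).1 (f1' k 0).1 ?_
      fin_cases k <;> simp [lineX] at hk ⊢ <;> omega
  have hδ1 : ν (S 0 0) = 1 := by
    have e0 := e0 0 0
    have e0' := e0' 0 0
    rw [sub_self, zpow_zero] at e0 e0'
    refine val_eq_one_of_mul e0 e0' (e := S 0 1 * T 1 0 + S 0 2 * T 2 0 + S 0 3 * T 3 0)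
      (val_add_lt_one (val_add_lt_one (hx 1 (by decide)) (hx 2 (by decide))) (hx 3 (by decide))) ?_
    rw [if_pos rfl] at inv
    rw [← inv]; ring
  have hδ0 : S 0 0 ≠ 0 := by rintro h; simp [h] at hδ1
  have hdiv : ∀ x : F, ν (x / S 0 0) = ν x := by
    intro x; rw [map_div₀, hδ1, div_one]
  have hp : ∀ r, r ≠ 0 → ((((klingenU (S 1 0 / S 0 0) (S 2 0 / S 0 0) (S 3 0 / S 0 0))⁻¹ * s :
      GSp4 F) : GL (Fin 4) F) : Matrix (Fin 4) (Fin 4) F) r 0 = 0 := by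
    intro r hr
    rw [Subgroup.coe_mul, Units.val_mul, coe_klingenU_inv, coe_klingenU, Matrix.mul_apply,
      Fin.sum_univ_four, ← hS]
    fin_cases r <;> simp [klingenMat] at hr ⊢ <;> field_simp <;> ring
  have hp0 : ((((klingenU (S 1 0 / S 0 0) (S 2 0 / S 0 0) (S 3 0 / S 0 0))⁻¹ * s :
      GSp4 F) : GL (Fin 4) F) : Matrix (Fin 4) (Fin 4) F) 0 0 = S 0 0 := by
    rw [Subgroup.coe_mul, Units.val_mul, coe_klingenU_inv, coe_klingenU, Matrix.mul_apply,
      Fin.sum_univ_four, ← hS]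
    simp [klingenMat]
  refine ⟨klingenU (S 1 0 / S 0 0) (S 2 0 / S 0 0) (S 3 0 / S 0 0), mu_klingenU _ _ _, ?_, ?_, ?_⟩
  · have x1 := f1 1 0
    have x2 := f1 2 0
    have x3 := f1 3 0
    rw [← hdiv] at x1 x2 x3
    simp only [lineX, Fin.rev] at x1 x2 x3
    exact klingenU_mem_stab (by simpa using x1.1) (by simpa using x1.2) (by simpa using x2.1)
      (by simpa using x2.2) (by simpa using x3.1)
  · exact fun r c h => klingenMat_apply_eq_zero h
  · have c1 := form_col ((klingenU (S 1 0 / S 0 0) (S 2 0 / S 0 0) (S 3 0 / S 0 0))⁻¹ * s) 0 1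
    have c2 := form_col ((klingenU (S 1 0 / S 0 0) (S 2 0 / S 0 0) (S 3 0 / S 0 0))⁻¹ * s) 0 2
    rw [form_eq, hp0, hp 1 (by decide), hp 2 (by decide), hp 3 (by decide)] at c1 c2
    simp only [J, Matrix.of_apply, Matrix.cons_val_zero, Matrix.cons_val_one, Matrix.cons_val,
      mul_zero, zero_mul, add_zero, sub_zero, mul_eq_zero, hδ0, false_or] at c1 c2
    intro r c hrc
    have h5 : (r ≠ 0 ∧ c = 0) ∨ (r = 3 ∧ c = 1) ∨ (r = 3 ∧ c = 2) := by
      revert r c; decide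
    rcases h5 with ⟨h, rfl⟩ | ⟨rfl, rfl⟩ | ⟨rfl, rfl⟩
    · exact hp r h
    · exact c1
    · exact c2

end Factorization

/-! ### Lines in apartments -/

theorem lineX_congr (τ : Bool) {m m' : ℤ} (h : m % 2 = m' % 2) (j : ℤ) :
    lineX τ m j = lineX τ m' j := by
  cases τ
  · rfl
  · have : (m + j - 1) / 2 - (m - 1) / 2 = (m' + j - 1) / 2 - (m' - 1) / 2 := by omega
    simp only [lineX, this]

theorem lineX_succ (τ : Bool) (m j : ℤ) (i : Fin 4) :
    lineX τ m j i ≤ lineX τ m (j + 1) i ∧ lineX τ m (j + 1) i ≤ lineX τ m j i + 1 := by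
  cases τ <;> fin_cases i <;> simp [lineX] <;> omega

theorem lineX_apply_zero (τ : Bool) (m j : ℤ) : lineX τ m j 0 = 0 := by
  cases τ <;> rfl

theorem lineX_apply_three (τ : Bool) (m j : ℤ) : lineX τ m j 3 = j := by
  cases τ <;> rfl

theorem sum_lineX_false (m j : ℤ) : ∑ i, lineX false m j i = 2 * j := by
  simp [lineX, Fin.sum_univ_four]; ring

theorem sum_lineX_true (m j : ℤ) :
    ∑ i, lineX true m j i = 2 * ((m + j - 1) / 2 - (m - 1) / 2) + j := by
  simp [lineX, Fin.sum_univ_four]; ring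

section Line

variable {F : Type*} [Field F] [ValuativeRel F] [TopologicalSpace F] [IsNonarchimedeanLocalField F]
  {ϖ : Fˣ}

local notation "ν" => valuation F

theorem simOrd_mul (hϖ : IsUniformizer ϖ) (g h : GSp4 F) :
    simOrd ϖ (g * h) = simOrd ϖ g + simOrd ϖ h := by
  rw [simOrd, mu_mul, hϖ.ord_mul, simOrd, simOrd]

theorem simOrd_DG (hϖ : IsUniformizer ϖ) (a : Fin 4 → ℤ) (h : a 0 + a 3 = a 1 + a 2) :
    simOrd ϖ (DG ϖ a h) = a 0 + a 3 := by
  rw [simOrd, mu_DG, hϖ.ord_zpow]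

theorem ord_det (hϖ : IsUniformizer ϖ) (g : GSp4 F) :
    ν ((g : GL (Fin 4) F) : Matrix (Fin 4) (Fin 4) F).det = ν (ϖ : F) ^ (2 * simOrd ϖ g) := by
  have h := congrArg ν (det_sq g)
  rw [map_pow, map_pow, hϖ.val_eq (mu g)] at h
  refine (pow_left_inj₀ zero_le zero_le two_ne_zero).mp (h.trans ?_)
  rw [← zpow_natCast, ← zpow_natCast, ← zpow_mul, ← zpow_mul, simOrd]
  congr 1
  push_cast
  ring

theorem val_det_D (ϖ : Fˣ) (a : Fin 4 → ℤ) :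
    ν (D ϖ a : Matrix (Fin 4) (Fin 4) F).det = ν (ϖ : F) ^ ∑ i, a i := by
  have : (D ϖ a : Matrix (Fin 4) (Fin 4) F) = Matrix.diagonal fun i => (ϖ : F) ^ a i := by
    ext i j
    rw [D_apply, Matrix.diagonal_apply]
  rw [this, Matrix.det_diagonal, map_prod, Fin.prod_univ_four, Fin.sum_univ_four]
  simp only [map_zpow₀, zpow_add₀ (val_unit_ne_zero ϖ)]

/-- The volume of a lattice, modulo `4`, is an invariant of its homothety class. -/
theorem volume_modEq (hϖ : IsUniformizer ϖ) {g h : GSp4 F} {a b : Fin 4 → ℤ}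
    (H : (plat ϖ (g : GL (Fin 4) F) a).cls = (plat ϖ (h : GL (Fin 4) F) b).cls) :
    (2 * simOrd ϖ g + ∑ i, a i) % 4 = (2 * simOrd ϖ h + ∑ i, b i) % 4 := by
  obtain ⟨α, hα⟩ := (cls_lat_eq_iff _ _).mp H
  have key : ((g : GL (Fin 4) F) * D ϖ a) * (scalarGL α * (((g : GL (Fin 4) F) * D ϖ a)⁻¹ *
      ((h : GL (Fin 4) F) * D ϖ b))) = scalarGL α * ((h : GL (Fin 4) F) * D ϖ b) := by
    rw [← mul_assoc, scalarGL_comm]; group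
  have h1 := congrArg (fun M : GL (Fin 4) F => ν (M : Matrix (Fin 4) (Fin 4) F).det) key
  rw [Units.val_mul, Matrix.det_mul, map_mul, val_det_of_mem_K hα, mul_one, det_scalarGL_mul,
    Units.val_mul, Units.val_mul, Matrix.det_mul, Matrix.det_mul, map_mul, map_mul, map_mul,
    ord_det hϖ, ord_det hϖ, val_det_D, val_det_D, map_pow, hϖ.val_eq α, ← zpow_natCast, ← zpow_mul,
    ← zpow_add₀ (val_unit_ne_zero ϖ), ← zpow_add₀ (val_unit_ne_zero ϖ),
    ← zpow_add₀ (val_unit_ne_zero ϖ), hϖ.zpow_inj] at h1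
  push_cast at h1
  omega

/-- The vertices, indexed by `j ∈ ℤ`, of a line through the vertex of `g 𝒪⁴` in the apartment
of `g`: it runs along hypotenuses of chambers if `τ = false` and along legs if `τ = true`. -/
def lineC (ϖ : Fˣ) (τ : Bool) (g : GSp4 F) (j : ℤ) : LatticeClass F :=
  (plat ϖ (g : GL (Fin 4) F) (lineX τ (simOrd ϖ g) j)).cls

/-- The `j`-th vertex of a line, as a vertex of the building. -/
def lineV (hϖ : IsUniformizer ϖ) (τ : Bool) (g : GSp4 F) (j : ℤ) : Vertex F :=
  ⟨lineC ϖ τ g j, exists_vertex hϖ (vCond_lineX _ _ _)⟩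

theorem adj_lineV (hϖ : IsUniformizer ϖ) (τ : Bool) (g : GSp4 F) (j : ℤ) :
    Adj (lineV hϖ τ g j) (lineV hϖ τ g (j + 1)) := by
  refine adj_of_coords hϖ (g := g) rfl rfl (lineX_succ _ _ _) ?_
  rintro ⟨k, hk⟩
  have h0 := hk 0
  have h3 := hk 3
  rw [lineX_apply_zero, lineX_apply_zero] at h0
  rw [lineX_apply_three, lineX_apply_three] at h3
  omega

/-- The `j`-th edge of a line. -/
def lineE (hϖ : IsUniformizer ϖ) (τ : Bool) (g : GSp4 F) (j : ℤ) : DEdge F :=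
  ⟨(lineV hϖ τ g j, lineV hϖ τ g (j + 1)), adj_lineV hϖ τ g j⟩

/-- Two edges on lines that coincide are of the same type, and have positions of the same parity
if they are legs of chambers. -/
theorem lineC_parity (hϖ : IsUniformizer ϖ) {τ τ' : Bool} {g h : GSp4 F} {j i : ℤ}
    (h0 : lineC ϖ τ g j = lineC ϖ τ' h i) (h1 : lineC ϖ τ g (j + 1) = lineC ϖ τ' h (i + 1)) :
    τ = τ' ∧ (τ = true → (j - i) % 2 = 0) ∧ (2 * simOrd ϖ g + 2 * j) % 4 =
      (2 * simOrd ϖ h + 2 * i) % 4 := by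
  have e0 := volume_modEq hϖ h0
  have e1 := volume_modEq hϖ h1
  cases τ <;> cases τ' <;> simp only [sum_lineX_false, sum_lineX_true] at e0 e1
  · exact ⟨rfl, by simp, e0⟩
  · exfalso; omega
  · exfalso; omega
  · refine ⟨rfl, fun _ => by omega, by omega⟩

/-- A line may be translated by `k` steps, for even `k` if it runs along legs. -/
theorem exists_lineC_shift (hϖ : IsUniformizer ϖ) (τ : Bool) (g : GSp4 F) (k : ℤ)
    (hk : τ = true → k % 2 = 0) :
    ∃ g' : GSp4 F, ∀ j, lineC ϖ τ g' j = lineC ϖ τ g (j + k) := by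
  have hδ : (lineX τ 0 k) 0 + (lineX τ 0 k) 3 = (lineX τ 0 k) 1 + (lineX τ 0 k) 2 := by
    cases τ
    · simp [lineX]
    · have := hk rfl
      simp [lineX]; omega
  refine ⟨g * DG ϖ (lineX τ 0 k) hδ, fun j => ?_⟩
  have hm : simOrd ϖ (g * DG ϖ (lineX τ 0 k) hδ) = simOrd ϖ g + k := by
    rw [simOrd_mul hϖ, simOrd_DG hϖ, lineX_apply_zero, lineX_apply_three, zero_add]
  have hX : lineX τ 0 k + lineX τ (simOrd ϖ g + k) j = lineX τ (simOrd ϖ g) (j + k) := by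
    ext i
    cases τ
    · fin_cases i <;> simp [lineX] <;> ring
    · have := hk rfl
      fin_cases i <;> simp [lineX] <;> omega
  rw [lineC, lineC, hm, plat, plat, ← hX, D_add, Subgroup.coe_mul, mul_assoc]
  rfl

/-- Two lines through a common edge can be spliced: the part of one up to the edge and the part
of the other from the edge on lie on a common line. This is where the Iwahori factorization of the
stabilizer of an edge enters. -/
theorem exists_splice (hϖ : IsUniformizer ϖ) {τ : Bool} {g h : GSp4 F} {i : ℤ}
    (h0 : lineC ϖ τ g i = lineC ϖ τ h i) (h1 : lineC ϖ τ g (i + 1) = lineC ϖ τ h (i + 1)) :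
    ∃ g' : GSp4 F, (∀ j ≤ i + 1, lineC ϖ τ g' j = lineC ϖ τ g j) ∧
      ∀ j, i ≤ j → lineC ϖ τ g' j = lineC ϖ τ h j := by
  have hp : simOrd ϖ h % 2 = simOrd ϖ g % 2 := by
    have := (lineC_parity hϖ h0 h1).2.2
    omega
  have hC : ∀ j, lineC ϖ τ h j = (plat ϖ (h : GL (Fin 4) F) (lineX τ (simOrd ϖ g) j)).cls :=
    fun j => by rw [lineC, lineX_congr τ hp]
  rw [hC] at h0 h1
  obtain ⟨α, hα⟩ := (cls_plat_eq_iff_stab _ _ _).mp h0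
  obtain ⟨β, hβ⟩ := (cls_plat_eq_iff_stab _ _ _).mp h1
  have hα' : scalarGL α * ((g : GL (Fin 4) F)⁻¹ * (h : GL (Fin 4) F)) ∈
      stab ϖ (lineX τ (simOrd ϖ g) (i + 1)) := by
    have := mul_mem (inv_mem (scalarGL_mem_stab (ϖ := ϖ) (val_scalar_eq hα hβ)
      (lineX τ (simOrd ϖ g) (i + 1)))) hβ
    rw [scalarGL_inv, ← mul_assoc, ← scalarGL_mul] at this
    rwa [mul_inv_rev, inv_inv, inv_mul_cancel_right] at this
  set s : GSp4 F := scalarG α * (g⁻¹ * h) with hs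
  have hsc : (s : GL (Fin 4) F) = scalarGL α * ((g : GL (Fin 4) F)⁻¹ * (h : GL (Fin 4) F)) := by
    rw [hs, coe_scalarG_mul]; rfl
  rw [← hsc] at hα hα'
  obtain ⟨u, hmu, hu, hu0, hp0⟩ : ∃ u : GSp4 F, mu u = 1 ∧
      (u : GL (Fin 4) F) ∈ stab ϖ (lineX τ (simOrd ϖ g) (i + 1)) ∧
      (∀ r c, lam τ r < lam τ c → ((u : GL (Fin 4) F) : Matrix (Fin 4) (Fin 4) F) r c = 0) ∧
      ∀ r c, lam τ c < lam τ r →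
        (((u⁻¹ * s : GSp4 F) : GL (Fin 4) F) : Matrix (Fin 4) (Fin 4) F) r c = 0 := by
    cases τ
    · exact exists_siegelU hϖ hα hα'
    · exact exists_klingenU hϖ hα hα'
  have hm : simOrd ϖ (g * u) = simOrd ϖ g := by
    rw [simOrd, simOrd, mu_mul, hmu, mul_one]
  refine ⟨g * u, fun j hj => ?_, fun j hj => ?_⟩
  · rw [lineC, lineC, hm, Subgroup.coe_mul, cls_plat_mul _ _ (stab_lower hϖ hj hu0 hu)]
  · have hps : ((u⁻¹ * s : GSp4 F) : GL (Fin 4) F) ∈ stab ϖ (lineX τ (simOrd ϖ g) i) := by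
      rw [Subgroup.coe_mul, Subgroup.coe_inv]
      exact mul_mem (inv_mem (stab_lower hϖ (by omega) hu0 hu)) hα
    have e : ((g * u : GSp4 F) : GL (Fin 4) F) * ((u⁻¹ * s : GSp4 F) : GL (Fin 4) F) =
        scalarGL α * (h : GL (Fin 4) F) := by
      rw [← Subgroup.coe_mul, mul_assoc, mul_inv_cancel_left, Subgroup.coe_mul, hsc, ← mul_assoc,
        scalarGL_comm, mul_assoc, mul_inv_cancel_left]
    rw [hC, lineC, hm, ← cls_plat_mul _ _ (stab_upper hϖ hj hp0 hps), e, scalarGL_cls]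

theorem smul_lineC (g γ : GSp4 F) (hϖ : IsUniformizer ϖ) (hγ : simOrd ϖ γ % 2 = 0) (τ : Bool)
    (j : ℤ) : (γ : GL (Fin 4) F) • lineC ϖ τ g j = lineC ϖ τ (γ * g) j := by
  rw [lineC, lineC, smul_cls, plat, plat, smul_lat, ← mul_assoc, Subgroup.coe_mul,
    lineX_congr τ (m' := simOrd ϖ (γ * g)) (by rw [simOrd_mul hϖ]; omega)]

end Line

/-! ### Straight paths are lines -/

section Frame

variable {F : Type*} [Field F] [ValuativeRel F]

/-- The matrix with columns `b`. -/
def frameMat (b : Fin 4 → Fin 4 → F) : Matrix (Fin 4) (Fin 4) F := Matrix.of fun i j => b j i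

theorem frameMat_form {b : Fin 4 → Fin 4 → F} (hb : IsSymplecticBasis b) :
    (frameMat b)ᵀ * J F * frameMat b = J F := by
  ext i j
  rw [← hb i j, Matrix.mul_assoc]
  rfl

/-- A symplectic basis, as the matrix with columns `b`. -/
def frame (b : Fin 4 → Fin 4 → F) (hb : IsSymplecticBasis b) : GSp4 F :=
  have h : -(J F * (frameMat b)ᵀ * J F) * frameMat b = 1 := by
    rw [Matrix.neg_mul, Matrix.mul_assoc, Matrix.mul_assoc, ← Matrix.mul_assoc (frameMat b)ᵀ,
      frameMat_form hb, J_mul_J, neg_neg]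
  ⟨⟨frameMat b, -(J F * (frameMat b)ᵀ * J F), mul_eq_one_comm.mp h, h⟩, 1, by
    rw [Units.val_one, one_smul]; exact frameMat_form hb⟩

theorem coe_frame (b : Fin 4 → Fin 4 → F) (hb : IsSymplecticBasis b) :
    ((frame b hb : GL (Fin 4) F) : Matrix (Fin 4) (Fin 4) F) = frameMat b := rfl

theorem mu_frame (b : Fin 4 → Fin 4 → F) (hb : IsSymplecticBasis b) : mu (frame b hb) = 1 :=
  mu_unique (by rw [coe_frame, frameMat_form hb, Units.val_one, one_smul])

end Frame

section Straight

variable {F : Type*} [Field F] [ValuativeRel F] [TopologicalSpace F] [IsNonarchimedeanLocalField F]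
  {ϖ : Fˣ}

local notation "ν" => valuation F

theorem plat_frame (ϖ : Fˣ) (b : Fin 4 → Fin 4 → F) (hb : IsSymplecticBasis b)
    (a : Fin 4 → ℤ) : (plat ϖ (frame b hb : GL (Fin 4) F) a).1 =
      Submodule.span 𝒪[F] (Set.range fun i => ((ϖ ^ a i : Fˣ) : F) • b i) := by
  have e : ∀ x : Fin 4 → F, (((frame b hb : GL (Fin 4) F) * D ϖ a : GL (Fin 4) F) :
      Matrix (Fin 4) (Fin 4) F) *ᵥ x = ∑ i, x i • ((ϖ ^ a i : Fˣ) : F) • b i := by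
    intro x
    ext r
    rw [Matrix.mulVec, dotProduct, Finset.sum_apply]
    refine Finset.sum_congr rfl fun i _ => ?_
    rw [Units.val_mul, Matrix.mul_apply, Finset.sum_eq_single i, D_apply, if_pos rfl, coe_frame]
    · simp [frameMat]; ring
    · intro k _ hk
      rw [D_apply, if_neg hk, mul_zero]
    · simp
  ext x
  rw [mem_plat_iff, Submodule.mem_span_range_iff_exists_fun]
  constructor
  · rintro ⟨x', hx', rfl⟩
    exact ⟨fun i => ⟨x' i, hx' i⟩, (e x').symm⟩
  · rintro ⟨c, rfl⟩
    exact ⟨fun i => (c i : F), fun i => (c i).2, (e _).symm⟩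

theorem hasCoord_iff {b : Fin 4 → Fin 4 → F} (hb : IsSymplecticBasis b) {v : Vertex F}
    {a : Fin 4 → ℤ} :
    HasCoord ϖ b v a ↔ v.1 = (plat ϖ (frame b hb : GL (Fin 4) F) a).cls := by
  constructor
  · rintro ⟨L, h1, h2⟩
    rw [← h1]
    congr 1
    exact Subtype.ext (h2.trans (plat_frame ϖ b hb a).symm)
  · intro h
    exact ⟨_, h.symm, plat_frame ϖ b hb a⟩

theorem HasCoord.reindex {b : Fin 4 → Fin 4 → F} {v : Vertex F} {a : Fin 4 → ℤ}
    (h : HasCoord ϖ b v a) (σ : Equiv.Perm (Fin 4)) (s : Fin 4 → ℤˣ) :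
    HasCoord ϖ (fun i => s i • b (σ i)) v (a ∘ σ) := by
  obtain ⟨L, h1, h2⟩ := h
  refine ⟨L, h1, h2.trans (le_antisymm ?_ ?_)⟩
  · rw [Submodule.span_le]
    rintro _ ⟨i, rfl⟩
    have hm : ((ϖ ^ (a ∘ σ) (σ.symm i) : Fˣ) : F) • (s (σ.symm i) • b (σ (σ.symm i))) ∈
        Submodule.span 𝒪[F] (Set.range fun i => ((ϖ ^ (a ∘ σ) i : Fˣ) : F) • (s i • b (σ i))) :=
      Submodule.subset_span ⟨σ.symm i, rfl⟩
    rcases Int.units_eq_one_or (s (σ.symm i)) with hs | hs <;> rw [hs] at hm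
    · simpa using hm
    · simpa using hm
  · rw [Submodule.span_le]
    rintro _ ⟨i, rfl⟩
    have hm : ((ϖ ^ a (σ i) : Fˣ) : F) • b (σ i) ∈
        Submodule.span 𝒪[F] (Set.range fun i => ((ϖ ^ a i : Fˣ) : F) • b i) :=
      Submodule.subset_span ⟨σ i, rfl⟩
    rcases Int.units_eq_one_or (s i) with hs | hs <;> simp only [hs]
    · simpa using hm
    · simpa using hm

theorem simOrd_frame (hϖ : IsUniformizer ϖ) (b : Fin 4 → Fin 4 → F) (hb : IsSymplecticBasis b) :
    simOrd ϖ (frame b hb) = 0 := by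
  rw [simOrd, mu_frame, hϖ.ord_one]

theorem lineC_mul_DG (hϖ : IsUniformizer ϖ) (τ : Bool) (g : GSp4 F) (a : Fin 4 → ℤ)
    (h : a 0 + a 3 = a 1 + a 2) (j : ℤ) : lineC ϖ τ (g * DG ϖ a h) j =
      (plat ϖ (g : GL (Fin 4) F) (a + lineX τ (simOrd ϖ g + (a 0 + a 3)) j)).cls := by
  rw [lineC, simOrd_mul hϖ, simOrd_DG hϖ, plat, plat, D_add, Subgroup.coe_mul, mul_assoc]
  rfl

/-- Three successive vertices on a line. -/
def IsLine3 (ϖ : Fˣ) (v₀ v₁ v₂ : Vertex F) : Prop :=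
  ∃ τ g j, v₀.1 = lineC ϖ τ g j ∧ v₁.1 = lineC ϖ τ g (j + 1) ∧ v₂.1 = lineC ϖ τ g (j + 1 + 1)

/-- Two steps by `(1, 0)` or `(1, 1)` in an apartment lie on one of the lines `lineC`. The frame
has to be translated to a special vertex, which for the direction `(1, 0)` is the first or the
second one. -/
theorem isLine3_of_coords (hϖ : IsUniformizer ϖ) {g : GSp4 F} (hg : simOrd ϖ g = 0)
    {v₀ v₁ v₂ : Vertex F} {a₀ a₁ a₂ : Fin 4 → ℤ}
    (h0 : v₀.1 = (plat ϖ (g : GL (Fin 4) F) a₀).cls)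
    (h1 : v₁.1 = (plat ϖ (g : GL (Fin 4) F) a₁).cls)
    (h2 : v₂.1 = (plat ϖ (g : GL (Fin 4) F) a₂).cls)
    (h01 : ∀ i, a₀ i ≤ a₁ i ∧ a₁ i ≤ a₀ i + 1) (h12 : ∀ i, a₁ i ≤ a₂ i ∧ a₂ i ≤ a₁ i + 1)
    {d : ℤ × ℤ} (hd1 : d.1 = 1) (hd2 : d.2 = 0 ∨ d.2 = 1)
    (p01 : position a₁ = position a₀ + d) (p12 : position a₂ = position a₁ + d) :
    IsLine3 ϖ v₀ v₁ v₂ := by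
  have c0 := vCond_of_vertex hϖ h0
  have c1 := vCond_of_vertex hϖ h1
  have c2 := vCond_of_vertex hϖ h2
  simp only [VCond, hg, zero_add] at c0 c1 c2
  have q1 := congrArg Prod.fst p01
  have q2 := congrArg Prod.snd p01
  have q3 := congrArg Prod.fst p12
  have q4 := congrArg Prod.snd p12
  simp only [position, Prod.fst_add, Prod.snd_add, hd1] at q1 q2 q3 q4
  have u0 := h01 0
  have u1 := h01 1
  have u2 := h01 2
  have u3 := h01 3
  have w0 := h12 0
  have w1 := h12 1
  have w2 := h12 2
  have w3 := h12 3
  clear h01 h12 p01 p12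
  rcases hd2 with hd2 | hd2 <;> rw [hd2] at q2 q4
  · by_cases hs : a₀ 0 + a₀ 3 = a₀ 1 + a₀ 2
    · refine ⟨true, g * DG ϖ a₀ hs, 0, ?_, ?_, ?_⟩
      · rw [lineC_mul_DG hϖ, h0, lineX_zero, add_zero]
      · rw [lineC_mul_DG hϖ, h1, hg]
        congr 2
        ext i
        fin_cases i <;> simp [lineX] <;> omega
      · rw [lineC_mul_DG hϖ, h2, hg]
        congr 2
        ext i
        fin_cases i <;> simp [lineX] <;> omega
    · have hs : a₁ 0 + a₁ 3 = a₁ 1 + a₁ 2 := by omega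
      refine ⟨true, g * DG ϖ a₁ hs, -1, ?_, ?_, ?_⟩
      · rw [lineC_mul_DG hϖ, h0, hg]
        congr 2
        ext i
        fin_cases i <;> simp [lineX] <;> omega
      · rw [lineC_mul_DG hϖ, h1, neg_add_cancel, lineX_zero, add_zero]
      · rw [lineC_mul_DG hϖ, h2, hg]
        congr 2
        ext i
        fin_cases i <;> simp [lineX] <;> omega
  · have hs : a₀ 0 + a₀ 3 = a₀ 1 + a₀ 2 := by omega
    refine ⟨false, g * DG ϖ a₀ hs, 0, ?_, ?_, ?_⟩
    · rw [lineC_mul_DG hϖ, h0, lineX_zero, add_zero]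
    · rw [lineC_mul_DG hϖ, h1, hg]
      congr 2
      ext i
      fin_cases i <;> simp [lineX] <;> omega
    · rw [lineC_mul_DG hϖ, h2, hg]
      congr 2
      ext i
      fin_cases i <;> simp [lineX] <;> omega

/-- The data of a straight path with two edges. -/
def Straight3 (ϖ : Fˣ) (b : Fin 4 → Fin 4 → F) (v : Fin 3 → Vertex F) (d : ℤ × ℤ) : Prop :=
  IsSymplecticBasis b ∧ ∃ a : Fin 3 → Fin 4 → ℤ, (∀ i, HasCoord ϖ b (v i) (a i)) ∧
    ∃ k l : ℕ, 0 < k ∧ 0 < l ∧ position (a 1) = position (a 0) + k • d ∧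
      position (a 2) = position (a 1) + l • d

theorem Straight3.reindex {b : Fin 4 → Fin 4 → F} {v : Fin 3 → Vertex F} {d d' : ℤ × ℤ}
    (h : Straight3 ϖ b v d) (σ : Equiv.Perm (Fin 4)) (s : Fin 4 → ℤˣ)
    (hb : IsSymplecticBasis fun i => s i • b (σ i)) (f : ℤ × ℤ →+ ℤ × ℤ)
    (hf : ∀ a, position (a ∘ σ) = f (position a)) (hd : f d = d') :
    Straight3 ϖ (fun i => s i • b (σ i)) v d' := by
  obtain ⟨-, a, ha, k, l, hk, hl, h1, h2⟩ := h
  refine ⟨hb, fun i => a i ∘ σ, fun i => (ha i).reindex σ s, k, l, hk, hl, ?_, ?_⟩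
  · rw [hf, hf, h1, map_add, map_nsmul, hd]
  · rw [hf, hf, h2, map_add, map_nsmul, hd]

theorem int_step {k : ℕ} {x : ℤ} (hk : 0 < k) (hx : 1 ≤ x) (h : k * x ≤ 1) : k = 1 ∧ x = 1 := by
  have : (1 : ℤ) ≤ k := by exact_mod_cast hk
  constructor
  · have : (k : ℤ) ≤ 1 := by nlinarith
    omega
  · nlinarith

theorem Straight3.isLine3_of_nonneg (hϖ : IsUniformizer ϖ) {b : Fin 4 → Fin 4 → F}
    {v : Fin 3 → Vertex F} {d : ℤ × ℤ} (h : Straight3 ϖ b v d) (h01 : Adj (v 0) (v 1))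
    (h12 : Adj (v 1) (v 2)) (hd2 : 0 ≤ d.2) (hd1 : d.2 ≤ d.1) (hd : d ≠ 0) :
    IsLine3 ϖ (v 0) (v 1) (v 2) := by
  obtain ⟨hb, a, ha, k, l, hk, hl, p1, p2⟩ := h
  simp only [hasCoord_iff hb] at ha
  obtain ⟨s, hs⟩ := h01.exists_coords hϖ (ha 0) (ha 1)
  obtain ⟨t, ht⟩ := h12.exists_coords hϖ (a := fun i => a 1 i + s)
    ((ha 1).trans (cls_plat_add hϖ _ _ _).symm) (ha 2)
  have hd1' : 1 ≤ d.1 := by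
    by_contra hlt
    exact hd (Prod.ext (by simp; omega) (by simp; omega))
  have q1 := congrArg Prod.fst p1
  have q2 := congrArg Prod.fst p2
  simp only [position, Prod.fst_add, Prod.smul_fst] at q1 q2
  rw [nsmul_eq_mul] at q1 q2
  obtain ⟨rfl, hx⟩ := int_step hk hd1' (by have := hs 0; have := hs 3; omega)
  obtain ⟨rfl, -⟩ := int_step hl hd1' (by have := ht 0; have := ht 3; omega)
  rw [one_smul] at p1 p2
  refine isLine3_of_coords hϖ (simOrd_frame hϖ b hb) (ha 0)
    ((ha 1).trans (cls_plat_add hϖ _ _ s).symm) ((ha 2).trans (cls_plat_add hϖ _ _ t).symm)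
    hs ht hx (by omega) ?_ ?_
  · rw [← p1]; simp [position]
  · rw [show position (fun i => a 2 i + t) = position (a 2) by simp [position], p2]
    simp [position]

theorem IsSymplecticBasis.swap {b : Fin 4 → Fin 4 → F} (hb : IsSymplecticBasis b) :
    IsSymplecticBasis fun i => (1 : Fin 4 → ℤˣ) i • b ((Equiv.swap 0 1 * Equiv.swap 2 3 : Equiv.Perm (Fin 4)) i) := by
  have e : ∀ i : Fin 4, (Equiv.swap 0 1 * Equiv.swap 2 3 : Equiv.Perm (Fin 4)) i =
      ![1, 0, 3, 2] i := by decide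
  intro i j
  simp only [Pi.one_apply, one_smul, e]
  rw [hb]
  fin_cases i <;> fin_cases j <;> simp [J]

theorem form_units_smul (s t : ℤˣ) (x y : Fin 4 → F) :
    form (s • x) (t • y) = ((s * t : ℤˣ) : ℤ) * form x y := by
  rcases Int.units_eq_one_or s with rfl | rfl <;> rcases Int.units_eq_one_or t with rfl | rfl <;>
    simp [form_eq] <;> ring

theorem IsSymplecticBasis.reflect₁ {b : Fin 4 → Fin 4 → F} (hb : IsSymplecticBasis b) :
    IsSymplecticBasis fun i => (![1, 1, 1, -1] : Fin 4 → ℤˣ) i • b (Equiv.swap 0 3 i) := by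
  have e : ∀ i : Fin 4, (Equiv.swap 0 3 : Equiv.Perm (Fin 4)) i = ![3, 1, 2, 0] i := by decide
  intro i j
  simp only [form_units_smul, e, hb _ _]
  fin_cases i <;> fin_cases j <;> simp [J]

theorem IsSymplecticBasis.reflect₂ {b : Fin 4 → Fin 4 → F} (hb : IsSymplecticBasis b) :
    IsSymplecticBasis fun i => (![1, 1, -1, 1] : Fin 4 → ℤˣ) i • b (Equiv.swap 1 2 i) := by
  have e : ∀ i : Fin 4, (Equiv.swap 1 2 : Equiv.Perm (Fin 4)) i = ![0, 2, 1, 3] i := by decide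
  intro i j
  simp only [form_units_smul, e, hb _ _]
  fin_cases i <;> fin_cases j <;> simp [J]

/-- Straight paths with two edges lie on one of the lines `lineC`: up to the action of the Weyl
group, the direction is that of a hypotenuse or that of a leg. -/
theorem Straight3.isLine3 (hϖ : IsUniformizer ϖ) {b : Fin 4 → Fin 4 → F}
    {v : Fin 3 → Vertex F} {d : ℤ × ℤ} (h : Straight3 ϖ b v d) (h01 : Adj (v 0) (v 1))
    (h12 : Adj (v 1) (v 2)) (hd : d ≠ 0) : IsLine3 ϖ (v 0) (v 1) (v 2) := by
  have A : ∀ (b : Fin 4 → Fin 4 → F) (d : ℤ × ℤ), Straight3 ϖ b v d → d ≠ 0 → 0 ≤ d.1 → 0 ≤ d.2 →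
      IsLine3 ϖ (v 0) (v 1) (v 2) := by
    intro b d h hd h1 h2
    rcases le_total d.2 d.1 with h3 | h3
    · exact h.isLine3_of_nonneg hϖ h01 h12 h2 h3 hd
    · refine (h.reindex (d' := (d.2, d.1)) _ _ h.1.swap ((AddMonoidHom.snd ℤ ℤ).prod
        (AddMonoidHom.fst ℤ ℤ)) (fun a => ?_) rfl).isLine3_of_nonneg hϖ h01 h12 h1 h3 ?_
      · rfl
      · rintro h0
        exact hd (Prod.ext (congrArg Prod.snd h0) (congrArg Prod.fst h0))
  have B : ∀ (b : Fin 4 → Fin 4 → F) (d : ℤ × ℤ), Straight3 ϖ b v d → d ≠ 0 → 0 ≤ d.1 →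
      IsLine3 ϖ (v 0) (v 1) (v 2) := by
    intro b d h hd h1
    rcases le_total 0 d.2 with h2 | h2
    · exact A b d h hd h1 h2
    · refine A _ (d.1, -d.2) (h.reindex _ _ h.1.reflect₂ ((AddMonoidHom.fst ℤ ℤ).prod
        (-AddMonoidHom.snd ℤ ℤ)) (fun a => ?_) rfl) ?_ h1 (by simpa using h2)
      · simp only [position, Function.comp, AddMonoidHom.prod_apply, AddMonoidHom.neg_apply,
          AddMonoidHom.coe_fst, AddMonoidHom.coe_snd, neg_sub]
        rfl
      · rintro h0
        have e1 : d.1 = 0 := congrArg Prod.fst h0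
        have e2 : -d.2 = 0 := congrArg Prod.snd h0
        exact hd (Prod.ext e1 (neg_eq_zero.mp e2))
  rcases le_total 0 d.1 with h1 | h1
  · exact B b d h hd h1
  · refine B _ (-d.1, d.2) (h.reindex _ _ h.1.reflect₁ ((-AddMonoidHom.fst ℤ ℤ).prod
      (AddMonoidHom.snd ℤ ℤ)) (fun a => ?_) rfl) ?_ (by simpa using h1)
    · simp only [position, Function.comp, AddMonoidHom.prod_apply, AddMonoidHom.neg_apply,
        AddMonoidHom.coe_fst, AddMonoidHom.coe_snd, neg_sub]
      rfl
    · rintro h0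
      have e1 : -d.1 = 0 := congrArg Prod.fst h0
      have e2 : d.2 = 0 := congrArg Prod.snd h0
      exact hd (Prod.ext (neg_eq_zero.mp e1) e2)

theorem IsStraight.isLine3 (hϖ : IsUniformizer ϖ) {n : ℕ} {v : ℕ → Vertex F}
    (h : IsStraight ϖ n v) (hn : 2 ≤ n) (h01 : Adj (v 0) (v 1)) (h12 : Adj (v 1) (v 2)) :
    IsLine3 ϖ (v 0) (v 1) (v 2) := by
  obtain ⟨b, hb, a, ha, d, hd, hs⟩ := h
  obtain ⟨k, hk, p1⟩ := hs 0 (by omega)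
  obtain ⟨l, hl, p2⟩ := hs 1 (by omega)
  exact Straight3.isLine3 hϖ (v := fun i => v i) (b := b)
    ⟨hb, fun i => a i, fun i => ha i (by omega), k, l, hk, hl, p1, p2⟩ h01 h12 hd

/-- The vertices of a line form a straight path. The frame of a similitude `g` is made symplectic by
dividing two of the columns by the similitude factor, which only shifts coordinates. -/
theorem isStraight_lineV (hϖ : IsUniformizer ϖ) (τ : Bool) (g : GSp4 F) (j : ℤ) (n : ℕ) :
    IsStraight ϖ n (fun i => lineV hϖ τ g (j + i)) := by
  -- The columns of `g · diag(t)` form a symplectic basis.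
  set t : Fin 4 → Fˣ := ![1, 1, (mu g)⁻¹, (mu g)⁻¹] with ht
  set b : Fin 4 → Fin 4 → F :=
    fun i r => (t i : F) * ((g : GL (Fin 4) F) : Matrix (Fin 4) (Fin 4) F) r i with hbdef
  have hb : IsSymplecticBasis b := by
    intro i j
    have h1 : form (b i) (b j) = (t i : F) * t j * ((mu g : F) * J F i j) := by
      rw [← form_col, form_eq, form_eq, hbdef]; ring
    have hm : (mu g : F) ≠ 0 := (mu g).ne_zero
    rw [h1, ht]
    fin_cases i <;> fin_cases j <;> simp [J, hm]
  have hfr : (frame b hb : GL (Fin 4) F) = (g : GL (Fin 4) F) * diagGL t := by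
    refine Units.ext ?_
    rw [coe_frame, Units.val_mul]
    ext r c
    simp [diagGL, frameMat, hbdef, Matrix.mul_diagonal, mul_comm]
  have hpl : ∀ a : Fin 4 → ℤ, plat ϖ (frame b hb : GL (Fin 4) F) a =
      plat ϖ (g : GL (Fin 4) F) (fun i => a i + ord ϖ (t i)) := by
    intro a
    rw [plat, plat, lat_eq_iff, hfr]
    have e : ((g : GL (Fin 4) F) * D ϖ fun i => a i + ord ϖ (t i))⁻¹ *
        ((g : GL (Fin 4) F) * diagGL t * D ϖ a) =
        diagGL fun i => t i * ϖ ^ (-ord ϖ (t i)) := by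
      have e1 : D ϖ (fun i => a i + ord ϖ (t i)) * (diagGL fun i => t i * ϖ ^ (-ord ϖ (t i))) =
          diagGL t * D ϖ a := by
        refine Units.ext ?_
        simp only [Units.val_mul, D, diagGL, Matrix.diagonal_mul_diagonal]
        congr 1
        ext i
        simp only [← Units.val_mul]
        congr 1
        rw [zpow_add, zpow_neg, mul_comm (t i), mul_assoc, mul_inv_cancel_left, mul_comm]
      rw [mul_inv_rev, mul_assoc, inv_mul_eq_iff_eq_mul, e1, mul_assoc, inv_mul_cancel_left]
    have hv : ∀ i, ν ((t i * ϖ ^ (-ord ϖ (t i)) : Fˣ) : F) = 1 := by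
      intro i
      rw [← hϖ.ord_eq_zero_iff, hϖ.ord_mul, hϖ.ord_zpow]; ring
    rw [e, mem_K]
    constructor
    · intro r c
      simp only [diagGL, Matrix.diagonal_apply]
      split_ifs
      · exact (hv r).le
      · simp
    · intro r c
      simp only [diagGL, Units.inv_mk, Matrix.diagonal_apply]
      split_ifs
      · rw [Units.val_inv_eq_inv_val, map_inv₀, hv, inv_one]
      · simp
  refine ⟨b, hb, fun i r => lineX τ (simOrd ϖ g) (j + i) r - ord ϖ (t r), fun i _ => ?_,
    if τ then (1, 0) else (1, 1), by cases τ <;> simp, fun i _ => ⟨1, one_pos, ?_⟩⟩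
  · rw [hasCoord_iff hb, hpl]
    simp only [sub_add_cancel]
    rfl
  · cases τ <;> refine Prod.ext ?_ ?_ <;> simp [position, lineX, ht] <;> ring

end Straight

/-! ### Geodesic cycles as closed walks -/

section Quotient

variable {F : Type*} [Field F] [ValuativeRel F] [TopologicalSpace F] [IsNonarchimedeanLocalField F]
  {ϖ : Fˣ} {Γ : Subgroup (PGSp4 F)}

local notation "ν" => valuation F

theorem simOrd_scalarG (hϖ : IsUniformizer ϖ) (z : Fˣ) : simOrd ϖ (scalarG z) = 2 * ord ϖ z := by
  rw [simOrd, mu_scalarG, pow_two, hϖ.ord_mul, two_mul]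

/-- The elements of `Γ` preserve the types of vertices. -/
theorem simOrd_even (hϖ : IsUniformizer ϖ) (hΓ : Γ ≤ (G0 ϖ).map (QuotientGroup.mk' (Z F)))
    {γ : GSp4 F} (hγ : γ ∈ preim Γ) : simOrd ϖ γ % 2 = 0 := by
  obtain ⟨g, ⟨k, u, hg⟩, hgγ⟩ := hΓ hγ
  obtain ⟨z, hz, rfl⟩ := (QuotientGroup.mk'_eq_mk' (Z F)).mp hgγ
  obtain ⟨w, rfl⟩ := mem_Z.mp hz
  rw [simOrd_mul hϖ, simOrd_scalarG hϖ]
  have h1 := ord_det hϖ g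
  have h2 : ((g : GL (Fin 4) F) : Matrix (Fin 4) (Fin 4) F).det =
      ((ϖ ^ (4 * k) * Units.map (algebraMap 𝒪[F] F).toMonoidHom u : Fˣ) : F) := by
    rw [← hg]; rfl
  have h3 : ν (((u : 𝒪[F]) : F)) = 1 :=
    (Valuation.Integers.isUnit_iff_valuation_eq_one (Valuation.integer.integers ν)).mp u.isUnit
  have h4 : ((Units.map (algebraMap 𝒪[F] F).toMonoidHom u : Fˣ) : F) = ((u : 𝒪[F]) : F) := rfl
  rw [h2, Units.val_mul, map_mul, h4, h3, mul_one, Units.val_zpow_eq_zpow_val, map_zpow₀,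
    hϖ.zpow_inj] at h1
  omega

/-- The image in `X_Γ` of the `j`-th edge of a line. -/
def qLine (hϖ : IsUniformizer ϖ) (Γ : Subgroup (PGSp4 F)) (τ : Bool) (g : GSp4 F) (j : ℤ) :
    QEdge Γ :=
  Quotient.mk (edgeRel Γ) (lineE hϖ τ g j)

theorem qLine_eq_iff (hϖ : IsUniformizer ϖ) (hΓ : Γ ≤ (G0 ϖ).map (QuotientGroup.mk' (Z F)))
    {τ τ' : Bool} {g g' : GSp4 F} {j j' : ℤ} :
    qLine hϖ Γ τ g j = qLine hϖ Γ τ' g' j' ↔ ∃ γ ∈ preim Γ,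
      lineC ϖ τ (γ * g) j = lineC ϖ τ' g' j' ∧
        lineC ϖ τ (γ * g) (j + 1) = lineC ϖ τ' g' (j' + 1) := by
  have e : ∀ γ ∈ preim Γ, ∀ i, (γ : GL (Fin 4) F) • lineC ϖ τ g i = lineC ϖ τ (γ * g) i :=
    fun γ hγ i => smul_lineC g γ hϖ (simOrd_even hϖ hΓ hγ) τ i
  refine (Quotient.eq (r := edgeRel Γ)).trans ?_
  refine exists_congr fun γ => and_congr_right fun hγ => ?_
  rw [← e γ hγ, ← e γ hγ]
  rfl

theorem qLine_congr (hϖ : IsUniformizer ϖ) {τ τ' : Bool} {g g' : GSp4 F} {j j' : ℤ}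
    (h0 : lineC ϖ τ g j = lineC ϖ τ' g' j')
    (h1 : lineC ϖ τ g (j + 1) = lineC ϖ τ' g' (j' + 1)) :
    qLine hϖ Γ τ g j = qLine hϖ Γ τ' g' j' :=
  congrArg (Quotient.mk (edgeRel Γ)) (Subtype.ext (Prod.ext (Subtype.ext h0) (Subtype.ext h1)))

/-- `e'` follows `e` on the image in `X_Γ` of a line. -/
def GeoStep (hϖ : IsUniformizer ϖ) (e e' : QEdge Γ) : Prop :=
  ∃ τ g j, e = qLine hϖ Γ τ g j ∧ e' = qLine hϖ Γ τ g (j + 1)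

theorem QEdge.tgt_mk (e : DEdge F) : QEdge.tgt (Quotient.mk (edgeRel Γ) e : QEdge Γ) =
    Quotient.mk (vertexRel Γ) e.1.2 := rfl

theorem QEdge.src_mk (e : DEdge F) : QEdge.src (Quotient.mk (edgeRel Γ) e : QEdge Γ) =
    Quotient.mk (vertexRel Γ) e.1.1 := rfl

theorem GeoStep.tgt_eq_src (hϖ : IsUniformizer ϖ) {e e' : QEdge Γ} (h : GeoStep hϖ e e') :
    e.tgt = e'.src := by
  obtain ⟨τ, g, j, rfl, rfl⟩ := h
  rw [qLine, qLine, QEdge.tgt_mk, QEdge.src_mk, lineE, lineE]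

/-- A walk of geodesic steps is the image of a line. -/
theorem exists_line_of_geoStep (hϖ : IsUniformizer ϖ)
    (hΓ : Γ ≤ (G0 ϖ).map (QuotientGroup.mk' (Z F))) {e : ℕ → QEdge Γ} (n : ℕ)
    (he : ∀ i ≤ n, GeoStep hϖ (e i) (e (i + 1))) :
    ∃ τ g j, ∀ i ≤ n + 1, e i = qLine hϖ Γ τ g (j + (i : ℕ)) := by
  induction n with
  | zero =>
    obtain ⟨τ, g, j, h0, h1⟩ := he 0 le_rfl
    refine ⟨τ, g, j, fun i hi => ?_⟩
    interval_cases i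
    · simpa using h0
    · simpa using h1
  | succ n ih =>
    obtain ⟨τ, g, j, h⟩ := ih fun i hi => he i (by omega)
    obtain ⟨τ', h', j', e0, e1⟩ := he (n + 1) le_rfl
    obtain ⟨γ, hγ, q0, q1⟩ := (qLine_eq_iff hϖ hΓ).mp (e0.symm.trans (h (n + 1) le_rfl))
    obtain ⟨rfl, hpar, -⟩ := lineC_parity hϖ q0 q1
    -- translate the second line so that the common edges have the same index
    obtain ⟨k, hk⟩ := exists_lineC_shift hϖ τ' (γ * h') (j' - (j + (n + 1 : ℕ))) (fun ht => by
      have := hpar ht; omega)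
    have r0 : lineC ϖ τ' k (j + (n + 1 : ℕ)) = lineC ϖ τ' g (j + (n + 1 : ℕ)) := by
      rw [hk, ← q0]; congr 1; ring
    have r1 : lineC ϖ τ' k (j + (n + 1 : ℕ) + 1) = lineC ϖ τ' g (j + (n + 1 : ℕ) + 1) := by
      rw [hk, ← q1]; congr 1; ring
    obtain ⟨g', s0, s1⟩ := exists_splice hϖ r0.symm r1.symm
    refine ⟨τ', g', j, fun i hi => ?_⟩
    rcases Nat.lt_or_ge (n + 1) i with hni | hni
    · obtain rfl : i = n + 1 + 1 := by omega
      rw [e1, qLine_eq_iff hϖ hΓ]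
      refine ⟨γ, hγ, ?_, ?_⟩
      · rw [s1 _ (by push_cast; omega), hk]; congr 1; push_cast; ring
      · rw [s1 _ (by push_cast; omega), hk]; congr 1; push_cast; ring
    · rw [h i hni]
      exact qLine_congr hϖ (s0 _ (by omega)).symm (s0 _ (by omega)).symm

/-- Adjacent vertices of an apartment are of different types, so `X_Γ` has no loops there. -/
theorem tgt_ne_src (hϖ : IsUniformizer ϖ) (hΓ : Γ ≤ (G0 ϖ).map (QuotientGroup.mk' (Z F)))
    {b : Fin 4 → Fin 4 → F} (hb : IsSymplecticBasis b) {v w : Vertex F} {a a' : Fin 4 → ℤ}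
    (hv : HasCoord ϖ b v a) (hw : HasCoord ϖ b w a') (hvw : Adj v w) {γ : GSp4 F}
    (hγ : γ ∈ preim Γ) : (γ : GL (Fin 4) F) • w.1 ≠ v.1 := by
  intro h
  rw [hasCoord_iff hb] at hv hw
  obtain ⟨k, hk⟩ := hvw.exists_coords hϖ hv hw
  have hpar := simOrd_even hϖ hΓ hγ
  rw [hw, hv, smul_cls, plat, smul_lat, ← mul_assoc] at h
  have hvol := volume_modEq hϖ (g := γ * frame b hb) (h := frame b hb) (a := a') (b := a) h
  rw [simOrd_mul hϖ, simOrd_frame hϖ, Fin.sum_univ_four, Fin.sum_univ_four] at hvol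
  have k0 := hk 0
  have k1 := hk 1
  have k2 := hk 2
  have k3 := hk 3
  have hne : ∀ l : ℤ, ¬ (a 0 = a' 0 + l ∧ a 1 = a' 1 + l ∧ a 2 = a' 2 + l ∧ a 3 = a' 3 + l) := by
    rintro l ⟨l0, l1, l2, l3⟩
    refine hvw.1 (Subtype.ext ?_)
    rw [hv, hw]
    refine (cls_plat_eq_iff hϖ _ _ _).mpr ⟨l, fun i => ?_⟩
    fin_cases i
    exacts [l0, l1, l2, l3]
  have n0 := hne k
  have n1 := hne (k - 1)
  omega

theorem isCycle_iff (p : List (QEdge Γ)) :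
    IsCycle p ↔ IsClosedWalk (fun e e' : QEdge Γ => e.tgt = e'.src) p := Iff.rfl

/-- Tailless geodesic cycles are the closed walks for the relation `GeoStep`. -/
theorem isTaillessGeodesicCycle_iff (hϖ : IsUniformizer ϖ)
    (hΓ : Γ ≤ (G0 ϖ).map (QuotientGroup.mk' (Z F))) (p : List (QEdge Γ)) :
    IsTaillessGeodesicCycle ϖ p ↔ IsClosedWalk (GeoStep hϖ) p := by
  constructor
  · rintro ⟨hc, hgeo⟩
    have hp' := hc
    rw [isCycle_iff, isClosedWalk_iff_getElem] at hp'
    obtain ⟨hne, hcyc⟩ := hp'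
    have hlen : 0 < p.length := List.length_pos_iff.mpr hne
    have h2 : 2 ≤ p.length := by
      by_contra hlt
      have h1 : p.length = 1 := by omega
      -- A cycle of length one is a loop of `X_Γ`, and there are none.
      obtain ⟨v, hv, b, hb, a, ha, -⟩ := hgeo 0
      rw [List.rotate_zero] at hv ha
      obtain ⟨hadj, hv0⟩ := hv 0 hlen
      have hloop := hcyc 0 hlen
      have hidx : p[(0 + 1) % p.length]'(Nat.mod_lt _ hlen) = p[0] := by
        congr 1; rw [h1]
      rw [hidx] at hloop
      have hv0' : p[0] = (Quotient.mk (edgeRel Γ) ⟨(v 0, v (0 + 1)), hadj⟩ : QEdge Γ) := hv0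
      rw [hv0'] at hloop
      obtain ⟨γ, hγ, hγv⟩ : ∃ γ ∈ preim Γ, (γ : GL (Fin 4) F) • (v 1).1 = (v 0).1 :=
        Quotient.exact hloop
      exact tgt_ne_src hϖ hΓ hb (ha 0 (by omega)) (ha 1 (by omega)) hadj hγ hγv
    rw [isClosedWalk_iff_getElem]
    refine ⟨hne, fun i hi => ?_⟩
    obtain ⟨v, hv, hs⟩ := hgeo i
    obtain ⟨a0, e0⟩ := hv 0 (by rw [List.length_rotate]; omega)
    obtain ⟨a1, e1⟩ := hv 1 (by rw [List.length_rotate]; omega)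
    rw [List.get_eq_getElem, List.getElem_rotate] at e0 e1
    obtain ⟨τ, g, j, l0, l1, l2⟩ := hs.isLine3 hϖ (by rw [List.length_rotate]; omega) a0 a1
    refine ⟨τ, g, j, ?_, ?_⟩
    · have : p[i] = p[(0 + i) % p.length]'(Nat.mod_lt _ hlen) := by
        congr 1; rw [zero_add, Nat.mod_eq_of_lt hi]
      rw [this]
      exact e0.trans (congrArg (Quotient.mk (edgeRel Γ))
        (Subtype.ext (Prod.ext (Subtype.ext l0) (Subtype.ext l1))))
    · have : p[(i + 1) % p.length]'(Nat.mod_lt _ hlen) =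
          p[(1 + i) % p.length]'(Nat.mod_lt _ hlen) := by
        congr 2; rw [add_comm]
      rw [this]
      exact e1.trans (congrArg (Quotient.mk (edgeRel Γ))
        (Subtype.ext (Prod.ext (Subtype.ext l1) (Subtype.ext l2))))
  · intro hc
    have hp' := hc
    rw [isClosedWalk_iff_getElem] at hp'
    obtain ⟨hne, hstep⟩ := hp'
    have hlen : 0 < p.length := List.length_pos_iff.mpr hne
    refine ⟨(isClosedWalk_iff_getElem _ _).mpr ⟨hne, fun i hi => (hstep i hi).tgt_eq_src⟩,
      fun k => ?_⟩
    have hs : ∀ i, GeoStep hϖ (p[(i + k) % p.length]'(Nat.mod_lt _ hlen))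
        (p[(i + 1 + k) % p.length]'(Nat.mod_lt _ hlen)) := by
      intro i
      have h1 := hstep ((i + k) % p.length) (Nat.mod_lt _ hlen)
      have : p[(i + 1 + k) % p.length]'(Nat.mod_lt _ hlen) =
          p[((i + k) % p.length + 1) % p.length]'(Nat.mod_lt _ hlen) := by
        congr 1; rw [Nat.mod_add_mod]; congr 1; ring
      rwa [this]
    obtain ⟨τ, g, j, h⟩ := exists_line_of_geoStep hϖ hΓ p.length fun i _ => hs i
    refine ⟨fun i => lineV hϖ τ g (j + i), fun i hi => ?_, isStraight_lineV hϖ τ g j _⟩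
    rw [List.length_rotate] at hi
    have e1 : j + ((i + 1 : ℕ) : ℤ) = j + i + 1 := by push_cast; ring
    simp only [e1]
    refine ⟨adj_lineV hϖ τ g _, ?_⟩
    rw [List.get_eq_getElem, List.getElem_rotate]
    exact h i (by omega)

theorem isPrimitiveCycle_iff {p : List (QEdge Γ)} (hc : IsCycle p) :
    IsPrimitiveCycle p ↔ IsPrimitiveWord p := by
  refine not_congr ⟨?_, ?_⟩
  · rintro ⟨d, m, hm, hd, h⟩
    exact ⟨d, m, hm, hd.1, h⟩
  · rintro ⟨d, m, hm, hd, h⟩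
    obtain ⟨k, rfl⟩ : ∃ k, m = k + 1 := ⟨m - 1, by omega⟩
    rw [isCycle_iff, h, isClosedWalk_flatten_replicate_iff] at hc
    exact ⟨d, k + 1, hm, hc, h⟩

/-- The primes of `X_Γ` are the primitive closed walks of geodesic steps, up to rotation. -/
theorem primeCycle_iff (hϖ : IsUniformizer ϖ) (hΓ : Γ ≤ (G0 ϖ).map (QuotientGroup.mk' (Z F)))
    (C : Cycle (QEdge Γ)) :
    (∃ p : List (QEdge Γ), (p : Cycle (QEdge Γ)) = C ∧
      IsTaillessGeodesicCycle ϖ p ∧ IsPrimitiveCycle p) ↔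
    ∃ p : List (QEdge Γ), (p : Cycle (QEdge Γ)) = C ∧ IsClosedWalk (GeoStep hϖ) p ∧
      IsPrimitiveWord p := by
  refine exists_congr fun p => and_congr_right fun _ => ?_
  rw [isTaillessGeodesicCycle_iff hϖ hΓ]
  refine and_congr_right fun h => isPrimitiveCycle_iff ?_
  exact ((isTaillessGeodesicCycle_iff hϖ hΓ p).mpr h).1

end Quotient

/-! ### Congruence subgroups as stabilizers of edges -/

section Parahoric

variable {F : Type*} [Field F] [ValuativeRel F] [TopologicalSpace F] [IsNonarchimedeanLocalField F]
  {ϖ : Fˣ}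

local notation "ν" => valuation F

theorem residue_eq_zero_iff (x : 𝒪[F]) : IsLocalRing.residue 𝒪[F] x = 0 ↔ ν (x : F) < 1 := by
  rw [IsLocalRing.residue_eq_zero_iff, IsLocalRing.mem_maximalIdeal, mem_nonunits_iff,
    (Valuation.Integers.isUnit_iff_valuation_eq_one (Valuation.integer.integers ν))]
  exact ⟨fun h => lt_of_le_of_ne x.2 h, fun h => h.ne⟩

/-- The congruence subgroups in terms of valuations instead of residues. -/
theorem mem_parahoric_iff {b : Fin 4 → ℕ} {g : GSp4 F} : g ∈ parahoric b ↔
    (g : GL (Fin 4) F) ∈ K F ∧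
      ∀ r c, b c < b r → ν (((g : GL (Fin 4) F) : Matrix (Fin 4) (Fin 4) F) r c) < 1 := by
  constructor
  · rintro ⟨h, hg, hb⟩
    refine ⟨?_, fun r c hrc => ?_⟩
    · rw [← hg, mem_K, ← map_inv]
      exact ⟨fun i j => (h.1 i j).2, fun i j => ((h⁻¹).1 i j).2⟩
    · rw [← hg]
      exact (residue_eq_zero_iff (h.1 r c)).mp (hb hrc)
  · rintro ⟨hK, hlt⟩
    rw [mem_K] at hK
    set M : Matrix (Fin 4) (Fin 4) 𝒪[F] := Matrix.of fun i j => ⟨_, hK.1 i j⟩ with hM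
    set N : Matrix (Fin 4) (Fin 4) 𝒪[F] := Matrix.of fun i j => ⟨_, hK.2 i j⟩ with hN
    have inj : Function.Injective (fun A : Matrix (Fin 4) (Fin 4) 𝒪[F] =>
        A.map (algebraMap 𝒪[F] F)) := Matrix.map_injective Subtype.val_injective
    have eM : M.map (algebraMap 𝒪[F] F) = ((g : GL (Fin 4) F) : Matrix (Fin 4) (Fin 4) F) := by
      ext i j; rfl
    have eN : N.map (algebraMap 𝒪[F] F) =
        (((g : GL (Fin 4) F)⁻¹ : GL (Fin 4) F) : Matrix (Fin 4) (Fin 4) F) := by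
      ext i j; rfl
    have h1 : M * N = 1 := inj (by
      simp only
      rw [Matrix.map_mul, eM, eN, ← Units.val_mul, mul_inv_cancel]
      simp)
    refine ⟨⟨M, N, h1, mul_eq_one_comm.mp h1⟩, Units.ext eM, fun r c hrc => ?_⟩
    exact (residue_eq_zero_iff _).mpr (hlt r c hrc)

theorem stab_zero (ϖ : Fˣ) : stab ϖ (0 : Fin 4 → ℤ) = K F := by
  ext s
  rw [mem_stab, D_zero, inv_one, one_mul, mul_one]

/-- The congruence subgroup of type `lam τ` is the stabilizer of the two lattices on an edge. -/
theorem mem_parahoric_lam_iff (hϖ : IsUniformizer ϖ) (τ : Bool) (m : ℤ) {g : GSp4 F} :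
    g ∈ parahoric (lam τ) ↔ (g : GL (Fin 4) F) ∈ stab ϖ (lineX τ m 0) ∧
      (g : GL (Fin 4) F) ∈ stab ϖ (lineX τ m 1) := by
  rw [mem_parahoric_iff, lineX_zero, stab_zero]
  refine and_congr_right fun hK => ?_
  have hmu : ν (mu g : F) = 1 := val_mu_of_mem_stab (ϖ := ϖ) (a := 0) (by rwa [stab_zero])
  rw [mem_stab_iff_of_mu hmu]
  have hint := (mem_K.mp hK).1
  have hle1 : ∀ {x : F} {k : ℤ}, ν x ≤ 1 → k ≤ 0 → ν x ≤ ν (ϖ : F) ^ k := by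
    intro x k hx hk
    refine hx.trans ?_
    rw [← zpow_zero (ν (ϖ : F)), hϖ.zpow_le_iff]
    exact hk
  constructor
  · intro h r c
    have hle2 : ∀ {k : ℤ}, k ≤ 1 → (0 < k → lam τ c < lam τ r) →
        ν (((g : GL (Fin 4) F) : Matrix (Fin 4) (Fin 4) F) r c) ≤ ν (ϖ : F) ^ k := by
      intro k hk hlt
      rcases le_or_gt k 0 with h0 | h0
      · exact hle1 (hint r c) h0
      · obtain rfl : k = 1 := by omega
        rw [zpow_one]
        exact hϖ.val_le_of_lt_one (h r c (hlt h0))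
    obtain ⟨a1, a2⟩ := lineX_one_le τ m r c
    obtain ⟨b1, b2⟩ := lineX_one_le τ m (Fin.rev c) (Fin.rev r)
    exact ⟨hle2 a1 a2, hle2 b1 fun hk => lam_rev.mp (b2 hk)⟩
  · intro h r c hrc
    have hlt : ∀ {k : ℤ}, 1 ≤ k → ν (ϖ : F) ^ k < 1 := by
      intro k hk
      rw [← zpow_zero (ν (ϖ : F)), hϖ.zpow_lt_iff]
      omega
    rcases lineX_one_eq hrc m with hk | hk
    · exact (h r c).1.trans_lt (hlt hk)
    · exact (h r c).2.trans_lt (hlt hk)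

theorem simOrd_of_mem_parahoric (hϖ : IsUniformizer ϖ) {b : Fin 4 → ℕ} {p : GSp4 F}
    (hp : p ∈ parahoric b) : simOrd ϖ p = 0 := by
  rw [simOrd, hϖ.ord_eq_zero_iff]
  exact val_mu_of_mem_stab (ϖ := ϖ) (a := 0) (by rw [stab_zero]; exact (mem_parahoric_iff.mp hp).1)

theorem scalarG_mem_parahoric {z : Fˣ} (hz : ν (z : F) = 1) (b : Fin 4 → ℕ) :
    scalarG z ∈ parahoric b := by
  rw [mem_parahoric_iff]
  refine ⟨scalarGL_mem_K hz, fun r c hrc => ?_⟩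
  have : r ≠ c := by rintro rfl; exact lt_irrefl _ hrc
  have e : ((scalarG z : GL (Fin 4) F) : Matrix (Fin 4) (Fin 4) F) r c = 0 := by
    rw [show (scalarG z : GL (Fin 4) F) = scalarGL z from rfl, scalarGL_apply, if_neg this]
  rw [e, map_zero]
  exact zero_lt_one

theorem lineC_mul_scalarG (hϖ : IsUniformizer ϖ) (τ : Bool) (g : GSp4 F) (α : Fˣ) (j : ℤ) :
    lineC ϖ τ (g * scalarG α) j = lineC ϖ τ g j := by
  have hc : ((g * scalarG α : GSp4 F) : GL (Fin 4) F) = scalarGL α * (g : GL (Fin 4) F) :=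
    scalarGL_comm _ _
  rw [lineC, lineC, hc, scalarGL_cls, lineX_congr τ (m' := simOrd ϖ g)]
  rw [simOrd_mul hϖ, simOrd_scalarG hϖ]
  omega

/-- Two group elements define the same initial edge iff they agree modulo the congruence subgroup
and the center. -/
theorem edge_eq_iff (hϖ : IsUniformizer ϖ) (τ : Bool) (g h : GSp4 F) :
    (lineC ϖ τ g 0 = lineC ϖ τ h 0 ∧ lineC ϖ τ g (0 + 1) = lineC ϖ τ h (0 + 1)) ↔
      g⁻¹ * h ∈ parahoric (lam τ) ⊔ Z F := by
  constructor
  · rintro ⟨h0, h1⟩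
    have hp : simOrd ϖ h % 2 = simOrd ϖ g % 2 := by
      have := (lineC_parity hϖ h0 h1).2.2
      omega
    rw [lineC, lineC, lineX_congr τ hp] at h0 h1
    obtain ⟨α, hα⟩ := (cls_plat_eq_iff_stab _ _ _).mp h0
    obtain ⟨β, hβ⟩ := (cls_plat_eq_iff_stab _ _ _).mp h1
    have hα' := mul_mem (inv_mem (scalarGL_mem_stab (ϖ := ϖ) (val_scalar_eq hα hβ)
      (lineX τ (simOrd ϖ g) (0 + 1)))) hβ
    rw [scalarGL_inv, ← mul_assoc, ← scalarGL_mul, mul_inv_rev, inv_inv,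
      inv_mul_cancel_right] at hα'
    have hmem : scalarG α * (g⁻¹ * h) ∈ parahoric (lam τ) := by
      rw [mem_parahoric_lam_iff hϖ τ (simOrd ϖ g)]
      exact ⟨hα, hα'⟩
    have e : g⁻¹ * h = (scalarG α)⁻¹ * (scalarG α * (g⁻¹ * h)) := by group
    rw [e]
    exact mul_mem ((le_sup_right : Z F ≤ parahoric (lam τ) ⊔ Z F) (inv_mem (scalarG_mem_Z α)))
      ((le_sup_left : parahoric (lam τ) ≤ parahoric (lam τ) ⊔ Z F) hmem)
  · intro hmem
    obtain ⟨p, hp, z, hz, hpz⟩ := Subgroup.mem_sup_of_normal_right.mp hmem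
    obtain ⟨α, rfl⟩ := mem_Z.mp hz
    have hgh : h = g * p * scalarG α := by rw [mul_assoc, hpz]; group
    have hp' := (mem_parahoric_lam_iff hϖ τ (simOrd ϖ g)).mp hp
    have hm : simOrd ϖ h % 2 = simOrd ϖ g % 2 := by
      rw [hgh, simOrd_mul hϖ, simOrd_mul hϖ, simOrd_of_mem_parahoric hϖ hp, simOrd_scalarG hϖ]
      omega
    have hc : (h : GL (Fin 4) F) = scalarGL α * ((g : GL (Fin 4) F) * (p : GL (Fin 4) F)) := by
      rw [hgh, Subgroup.coe_mul, Subgroup.coe_mul]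
      exact scalarGL_comm _ _
    constructor
    · rw [lineC, lineC, lineX_congr τ hm, hc, scalarGL_cls, cls_plat_mul _ _ hp'.1]
    · rw [zero_add, lineC, lineC, lineX_congr τ hm, hc, scalarGL_cls, cls_plat_mul _ _ hp'.2]

variable {Γ : Subgroup (PGSp4 F)}

/-- The double cosets `Γ \ G / P Z` are the initial edges, modulo `Γ`. -/
theorem qLine_zero_eq_iff (hϖ : IsUniformizer ϖ)
    (hΓ : Γ ≤ (G0 ϖ).map (QuotientGroup.mk' (Z F))) (τ : Bool) (g h : GSp4 F) :
    qLine hϖ Γ τ g 0 = qLine hϖ Γ τ h 0 ↔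
      DoubleCoset.mk (preim Γ) (parahoric (lam τ) ⊔ Z F) g =
        DoubleCoset.mk (preim Γ) (parahoric (lam τ) ⊔ Z F) h := by
  rw [qLine_eq_iff hϖ hΓ, DoubleCoset.eq]
  refine exists_congr fun γ => and_congr_right fun _ => ?_
  rw [edge_eq_iff hϖ]
  constructor
  · intro hm
    exact ⟨_, hm, by group⟩
  · rintro ⟨k, hk, rfl⟩
    simpa [mul_assoc] using hk

/-- The edge of `X_Γ` attached to a double coset. -/
def edgeOf (hϖ : IsUniformizer ϖ) (hΓ : Γ ≤ (G0 ϖ).map (QuotientGroup.mk' (Z F))) (τ : Bool) :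
    CosetSpace Γ (parahoric (lam τ)) → QEdge Γ :=
  Quotient.lift (fun g => qLine hϖ Γ τ g 0) fun g h H =>
    (qLine_zero_eq_iff hϖ hΓ τ g h).mpr (Quotient.sound H)

theorem edgeOf_mk (hϖ : IsUniformizer ϖ) (hΓ : Γ ≤ (G0 ϖ).map (QuotientGroup.mk' (Z F)))
    (τ : Bool) (g : GSp4 F) :
    edgeOf hϖ hΓ τ (DoubleCoset.mk (preim Γ) (parahoric (lam τ) ⊔ Z F) g) = qLine hϖ Γ τ g 0 := rfl

theorem edgeOf_injective (hϖ : IsUniformizer ϖ)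
    (hΓ : Γ ≤ (G0 ϖ).map (QuotientGroup.mk' (Z F))) (τ : Bool) :
    Function.Injective (edgeOf hϖ hΓ τ) := by
  intro x y
  induction x using Quotient.inductionOn with | _ g
  induction y using Quotient.inductionOn with | _ h
  exact (qLine_zero_eq_iff hϖ hΓ τ g h).mp

end Parahoric

/-! ### Finiteness and freeness of the action -/

section Topological

open Topology Filter

variable {F : Type*} [Field F] [ValuativeRel F] [TopologicalSpace F] [IsNonarchimedeanLocalField F]
  {ϖ : Fˣ}

local notation "ν" => valuation F

theorem t2Space_of_isNonarchimedeanLocalField (F : Type*) [Field F] [ValuativeRel F]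
    [TopologicalSpace F] [IsNonarchimedeanLocalField F] : T2Space F := by
  let := IsTopologicalAddGroup.rightUniformSpace F
  have := isUniformAddGroup_of_addCommGroup (G := F)
  have : T0Space F := ValuedRing.separated
  infer_instance

theorem isOpen_val_le {γ : ValueGroupWithZero F} (hγ : γ ≠ 0) : IsOpen {x : F | ν x ≤ γ} := by
  let : TopologicalSpace (ValueGroupWithZero F) := WithZeroTopology.topologicalSpace
  have : IsOpen (Set.Iic γ) :=
    WithZeroTopology.isOpen_iff.mpr (Or.inr ⟨γ, hγ, fun x hx => (Set.mem_Iio.mp hx).le⟩)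
  exact this.preimage IsValuativeTopology.continuous_valuation

theorem isOpen_stab (ϖ : Fˣ) (a : Fin 4 → ℤ) : IsOpen (stab ϖ a : Set (GL (Fin 4) F)) := by
  have e : (stab ϖ a : Set (GL (Fin 4) F)) =
      (⋂ r, ⋂ c, {s : GL (Fin 4) F | ν ((s : Matrix (Fin 4) (Fin 4) F) r c) ≤
        ν (ϖ : F) ^ (a r - a c)}) ∩
      ⋂ r, ⋂ c, {s : GL (Fin 4) F | ν (((s⁻¹ : GL (Fin 4) F) : Matrix (Fin 4) (Fin 4) F) r c) ≤
        ν (ϖ : F) ^ (a r - a c)} := by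
    ext s
    simp only [SetLike.mem_coe, mem_stab_iff, Set.mem_inter_iff, Set.mem_iInter]
    rfl
  have hc : ∀ r c, Continuous fun s : GL (Fin 4) F => (s : Matrix (Fin 4) (Fin 4) F) r c :=
    fun r c => Units.continuous_val.matrix_elem r c
  rw [e]
  refine IsOpen.inter ?_ ?_
  · refine isOpen_iInter_of_finite fun r => isOpen_iInter_of_finite fun c => ?_
    exact (isOpen_val_le (zpow_ne_zero _ (val_unit_ne_zero ϖ))).preimage (hc r c)
  · refine isOpen_iInter_of_finite fun r => isOpen_iInter_of_finite fun c => ?_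
    exact (isOpen_val_le (zpow_ne_zero _ (val_unit_ne_zero ϖ))).preimage
      ((hc r c).comp continuous_inv)

variable {Γ : Subgroup (PGSp4 F)}

/-- A function on `G` that is left invariant under `Γ` and right invariant under the center and
a neighbourhood of `1` takes finitely many values, because `Γ` is cocompact. -/
theorem finite_range_of_invariant [CompactSpace (PGSp4 F ⧸ Γ)] {α : Type*} (f : GSp4 F → α)
    (hl : ∀ γ ∈ preim Γ, ∀ g, f (γ * g) = f g) (hz : ∀ z ∈ Z F, ∀ g, f (g * z) = f g)
    (U : Set (GSp4 F)) (hU : IsOpen U) (h1 : 1 ∈ U) (hr : ∀ g, ∀ u ∈ U, f (g * u) = f g) :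
    (Set.range f).Finite := by
  have hmk : ∀ g h : GSp4 F, (g : PGSp4 F) = h → f g = f h := by
    intro g h hgh
    have := hz _ (QuotientGroup.eq.mp hgh) g
    rwa [mul_inv_cancel_left, eq_comm] at this
  have hcoset : ∀ g h : GSp4 F, (((g : PGSp4 F)⁻¹ : PGSp4 F) : PGSp4 F ⧸ Γ) =
      (((h : PGSp4 F)⁻¹ : PGSp4 F) : PGSp4 F ⧸ Γ) → f g = f h := by
    intro g h hgh
    have h2 : ((g : PGSp4 F)⁻¹)⁻¹ * (h : PGSp4 F)⁻¹ ∈ Γ := QuotientGroup.eq.mp hgh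
    have h3 : g * h⁻¹ ∈ preim Γ := by
      rw [inv_inv] at h2
      exact h2
    have := hl _ h3 h
    rwa [inv_mul_cancel_right] at this
  let q : GSp4 F → PGSp4 F ⧸ Γ := fun g => (((g : PGSp4 F)⁻¹ : PGSp4 F) : PGSp4 F ⧸ Γ)
  have hq : Function.Surjective q := by
    intro x
    obtain ⟨y, rfl⟩ := QuotientGroup.mk_surjective x
    obtain ⟨g, hg⟩ := QuotientGroup.mk_surjective y⁻¹
    exact ⟨g, by simp only [q, hg, inv_inv]⟩
  have hqo : IsOpenMap q :=
    QuotientGroup.isOpenMap_coe.comp ((Homeomorph.inv (PGSp4 F)).isOpenMap.comp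
      QuotientGroup.isOpenMap_coe)
  let F' : PGSp4 F ⧸ Γ → α := fun x => f (hq x).choose
  have hF' : ∀ g, F' (q g) = f g := fun g => hcoset _ _ (hq (q g)).choose_spec
  have hloc : IsLocallyConstant F' := by
    rw [IsLocallyConstant.iff_exists_open]
    intro x
    obtain ⟨g, rfl⟩ := hq x
    refine ⟨q '' ((fun u => g * u) '' U), hqo _ ((isOpenMap_mul_left g) _ hU),
      ⟨g, ⟨1, h1, mul_one g⟩, rfl⟩, ?_⟩
    rintro _ ⟨_, ⟨u, hu, rfl⟩, rfl⟩
    rw [hF', hF', hr g u hu]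
  refine hloc.range_finite.subset ?_
  rintro _ ⟨g, rfl⟩
  exact ⟨q g, hF' g⟩

/-- `GL₄(𝒪)` is compact. -/
theorem isCompact_K : IsCompact (K F : Set (GL (Fin 4) F)) := by
  have := t2Space_of_isNonarchimedeanLocalField F
  have hI : IsCompact {M : Matrix (Fin 4) (Fin 4) F | IntM M} := by
    have e : {M : Matrix (Fin 4) (Fin 4) F | IntM M} =
        Set.univ.pi fun _ => Set.univ.pi fun _ => {x : F | ν x ≤ 1} := by
      ext M
      exact ⟨fun h i _ j _ => h i j, fun h i j => h i trivial j trivial⟩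
    rw [e]
    exact isCompact_univ_pi fun _ => isCompact_univ_pi fun _ =>
      IsNonarchimedeanLocalField.isCompact_closedBall F 1
  have hcl : IsClosedEmbedding (Units.embedProduct (Matrix (Fin 4) (Fin 4) F)) :=
    Units.isClosedEmbedding_embedProduct
  have e : (K F : Set (GL (Fin 4) F)) = Units.embedProduct (Matrix (Fin 4) (Fin 4) F) ⁻¹'
      ({M : Matrix (Fin 4) (Fin 4) F | IntM M} ×ˢ
        (MulOpposite.unop ⁻¹' {M : Matrix (Fin 4) (Fin 4) F | IntM M})) := by
    ext s
    simp only [SetLike.mem_coe, mem_K]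
    rfl
  rw [e]
  exact hcl.isCompact_preimage (hI.prod (MulOpposite.opHomeomorph.symm.isClosedEmbedding.isCompact_preimage hI))

/-- `Γ` acts freely on vertices, modulo scalars: stabilizers are finite, being the intersection of
a discrete and a compact group, and `Γ` is torsion-free. -/
theorem mem_Z_of_fixes (hdiscrete : DiscreteTopology Γ)
    (htf : ∀ γ ∈ Γ, IsOfFinOrder γ → γ = 1) {γ : GSp4 F} (hγ : γ ∈ preim Γ) {h : GL (Fin 4) F}
    (hfix : (γ : GL (Fin 4) F) • (lat h).cls = (lat h).cls) : γ ∈ Z F := by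
  rw [smul_cls, smul_lat] at hfix
  obtain ⟨α, hα⟩ := (cls_lat_eq_iff _ _).mp hfix.symm
  set k : K F := ⟨_, hα⟩ with hk
  set s : GSp4 F := scalarG α * γ with hs
  have hsk : (s : GL (Fin 4) F) = h * k * h⁻¹ := by
    rw [hs, coe_scalarG_mul, hk]
    simp only [← mul_assoc]
    rw [scalarGL_comm h]
    group
  have hmk : ((s : GSp4 F) : PGSp4 F) = (γ : PGSp4 F) := by
    rw [QuotientGroup.eq, hs, mul_inv_rev, mul_assoc]
    have := (inferInstance : (Z F).Normal).conj_mem _ (inv_mem (scalarG_mem_Z α)) γ⁻¹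
    simpa [mul_assoc] using this
  have hγΓ : (γ : PGSp4 F) ∈ Γ := hγ
  -- powers of `k` return to every neighbourhood of the identity
  have : CompactSpace (K F) := isCompact_iff_compactSpace.mp isCompact_K
  have hcl := mapClusterPt_one_atTop_pow k
  obtain ⟨V, hV, hVΓ⟩ : ∃ V : Set (PGSp4 F), IsOpen V ∧ Subtype.val ⁻¹' V = ({1} : Set Γ) :=
    isOpen_induced_iff.mp (isOpen_discrete ({1} : Set Γ))
  have h1V : (1 : PGSp4 F) ∈ V := by
    have : (1 : Γ) ∈ Subtype.val ⁻¹' V := by rw [hVΓ]; rfl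
    exact this
  obtain ⟨W, hW, hWV⟩ : ∃ W : Set (GL (Fin 4) F), IsOpen W ∧
      Subtype.val ⁻¹' W = (fun g : GSp4 F => (g : PGSp4 F)) ⁻¹' V :=
    isOpen_induced_iff.mp (hV.preimage QuotientGroup.continuous_mk)
  have h1W : (1 : GL (Fin 4) F) ∈ W := by
    have : (1 : GSp4 F) ∈ Subtype.val ⁻¹' W := by rw [hWV]; exact h1V
    exact this
  have hcont : Continuous fun x : K F => h * (x : GL (Fin 4) F) * h⁻¹ := by fun_prop
  have hnhds : (fun x : K F => h * (x : GL (Fin 4) F) * h⁻¹) ⁻¹' W ∈ 𝓝 (1 : K F) :=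
    (hW.preimage hcont).mem_nhds (by simpa using h1W)
  obtain ⟨n, hn, hmem⟩ := (frequently_atTop.mp (mapClusterPt_iff_frequently.mp hcl _ hnhds)) 1
  have hsn : ((s ^ n : GSp4 F) : GL (Fin 4) F) ∈ W := by
    have e : h * ((k ^ n : K F) : GL (Fin 4) F) * h⁻¹ = ((s ^ n : GSp4 F) : GL (Fin 4) F) := by
      rw [Subgroup.coe_pow, Subgroup.coe_pow, hsk, conj_pow]
    rw [← e]
    exact hmem
  have hV' : ((s ^ n : GSp4 F) : PGSp4 F) ∈ V := by
    have : s ^ n ∈ Subtype.val ⁻¹' W := hsn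
    rw [hWV] at this
    exact this
  have hpow : ((s ^ n : GSp4 F) : PGSp4 F) = (γ : PGSp4 F) ^ n := by
    rw [QuotientGroup.mk_pow, hmk]
  rw [hpow] at hV'
  have h1 : (⟨(γ : PGSp4 F), hγΓ⟩ : Γ) ^ n ∈ ({1} : Set Γ) := by
    rw [← hVΓ]; exact hV'
  have hone : (γ : PGSp4 F) ^ n = 1 := congrArg Subtype.val h1
  exact (QuotientGroup.eq_one_iff γ).mp
    (htf _ hγΓ (isOfFinOrder_iff_pow_eq_one.mpr ⟨n, by omega, hone⟩))

/-- There are finitely many edges of given type and parity modulo `Γ`. -/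
theorem finite_range_qLine [CompactSpace (PGSp4 F ⧸ Γ)] (hϖ : IsUniformizer ϖ)
    (hΓ : Γ ≤ (G0 ϖ).map (QuotientGroup.mk' (Z F))) (τ : Bool) (j : ℤ) :
    (Set.range fun g => qLine hϖ Γ τ g j).Finite := by
  have hst : ∀ m i, IsOpen {u : GSp4 F | (u : GL (Fin 4) F) ∈ stab ϖ (lineX τ m i)} :=
    fun m i => (isOpen_stab ϖ _).preimage continuous_subtype_val
  refine finite_range_of_invariant (Γ := Γ) _ (fun γ hγ g => ?_) (fun z hz g => ?_)
    (⋂ m : Fin 2, {u : GSp4 F | (u : GL (Fin 4) F) ∈ stab ϖ (lineX τ (m : ℕ) j)} ∩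
      {u : GSp4 F | (u : GL (Fin 4) F) ∈ stab ϖ (lineX τ (m : ℕ) (j + 1))})
    (isOpen_iInter_of_finite fun m => (hst _ _).inter (hst _ _)) ?_ (fun g u hu => ?_)
  · exact ((qLine_eq_iff hϖ hΓ).mpr ⟨γ, hγ, rfl, rfl⟩).symm
  · obtain ⟨α, rfl⟩ := mem_Z.mp hz
    exact qLine_congr hϖ (lineC_mul_scalarG hϖ _ _ _ _) (lineC_mul_scalarG hϖ _ _ _ _)
  · exact Set.mem_iInter.mpr fun m => ⟨one_mem (stab ϖ _), one_mem (stab ϖ _)⟩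
  · have hm : simOrd ϖ (g * u) = simOrd ϖ g := by
      rw [simOrd_mul hϖ, simOrd, simOrd, (hϖ.ord_eq_zero_iff (mu u)).mpr
        (val_mu_of_mem_stab (Set.mem_iInter.mp hu 0).1), add_zero]
    obtain ⟨m, hm2⟩ : ∃ m : Fin 2, simOrd ϖ g % 2 = ((m : ℕ) : ℤ) % 2 := by
      rcases Int.emod_two_eq_zero_or_one (simOrd ϖ g) with h | h
      · exact ⟨0, by simpa using h⟩
      · exact ⟨1, by simpa using h⟩
    obtain ⟨u0, u1⟩ := Set.mem_iInter.mp hu m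
    refine qLine_congr hϖ ?_ ?_
    · rw [lineC, lineC, hm, lineX_congr τ hm2, Subgroup.coe_mul, cls_plat_mul _ _ u0]
    · rw [lineC, lineC, hm, lineX_congr τ hm2, Subgroup.coe_mul, cls_plat_mul _ _ u1]

theorem finite_cosetSpace [CompactSpace (PGSp4 F ⧸ Γ)] (hϖ : IsUniformizer ϖ)
    (hΓ : Γ ≤ (G0 ϖ).map (QuotientGroup.mk' (Z F))) (τ : Bool) :
    Finite (CosetSpace Γ (parahoric (lam τ) : Subgroup (GSp4 F))) := by
  have := (finite_range_qLine (Γ := Γ) hϖ hΓ τ 0).to_subtype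
  refine Finite.of_injective (fun x => (⟨edgeOf hϖ hΓ τ x, ?_⟩ :
    Set.range fun g => qLine hϖ Γ τ g 0)) fun x y hxy =>
      edgeOf_injective hϖ hΓ τ (congrArg Subtype.val hxy)
  induction x using Quotient.inductionOn with | _ g
  exact ⟨g, rfl⟩

end Topological

/-! ### The Hecke operators count geodesic steps -/

section Hecke

variable {F : Type*} [Field F] [ValuativeRel F] [TopologicalSpace F] [IsNonarchimedeanLocalField F]
  {ϖ : Fˣ} {Γ : Subgroup (PGSp4 F)}

local notation "ν" => valuation F

/-- The number of steps along a line after which its vertices are of the same type again. -/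
def period (τ : Bool) : ℤ := if τ then 2 else 1

/-- The translation `diag(1, 1, ϖ, ϖ)` or `diag(1, ϖ, ϖ, ϖ²)` along a line. -/
def stepG (ϖ : Fˣ) (τ : Bool) : GSp4 F := if τ then d2 ϖ else d1 ϖ

theorem d1_eq (ϖ : Fˣ) : d1 ϖ = DG ϖ ![0, 0, 1, 1] (by decide) := by
  refine Subtype.ext (Units.ext ?_)
  change Matrix.diagonal _ = Matrix.diagonal _
  congr 1
  ext i
  fin_cases i <;> simp

theorem d2_eq (ϖ : Fˣ) : d2 ϖ = DG ϖ ![0, 1, 1, 2] (by decide) := by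
  refine Subtype.ext (Units.ext ?_)
  change Matrix.diagonal _ = Matrix.diagonal _
  congr 1
  ext i
  fin_cases i <;> simp

theorem lineC_mul_stepG (hϖ : IsUniformizer ϖ) (τ : Bool) (g : GSp4 F) (j : ℤ) :
    lineC ϖ τ (g * stepG ϖ τ) j = lineC ϖ τ g (j + period τ) := by
  cases τ
  · rw [stepG, if_neg (by simp), d1_eq, lineC_mul_DG hϖ, lineC]
    congr 2
    ext i
    fin_cases i <;> simp [lineX, period] <;> ring
  · rw [stepG, if_pos rfl, d2_eq, lineC_mul_DG hϖ, lineC]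
    congr 2
    ext i
    fin_cases i <;> simp [lineX, period] <;> omega

theorem qLine_mul_stepG (hϖ : IsUniformizer ϖ) (τ : Bool) (g : GSp4 F) (j : ℤ) :
    qLine hϖ Γ τ (g * stepG ϖ τ) j = qLine hϖ Γ τ g (j + period τ) :=
  qLine_congr hϖ (lineC_mul_stepG hϖ τ g j)
    ((lineC_mul_stepG hϖ τ g (j + 1)).trans (by congr 1; ring))

theorem lineC_mul_parahoric (hϖ : IsUniformizer ϖ) (τ : Bool) (g : GSp4 F) {p : GSp4 F}
    (hp : p ∈ parahoric (lam τ)) :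
    lineC ϖ τ (g * p) 0 = lineC ϖ τ g 0 ∧ lineC ϖ τ (g * p) (0 + 1) = lineC ϖ τ g (0 + 1) := by
  have h := (edge_eq_iff hϖ τ g (g * p)).mpr (by
    rw [inv_mul_cancel_left]
    exact (le_sup_left : parahoric (lam τ) ≤ parahoric (lam τ) ⊔ Z F) hp)
  exact ⟨h.1.symm, h.2.symm⟩

theorem mem_parahoric_of_mem_sup (hϖ : IsUniformizer ϖ) {b : Fin 4 → ℕ} {x : GSp4 F}
    (hx : x ∈ parahoric b ⊔ Z F) (h0 : simOrd ϖ x = 0) : x ∈ parahoric b := by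
  obtain ⟨p, hp, z, hz, rfl⟩ := Subgroup.mem_sup_of_normal_right.mp hx
  obtain ⟨α, rfl⟩ := mem_Z.mp hz
  rw [simOrd_mul hϖ, simOrd_of_mem_parahoric hϖ hp, simOrd_scalarG hϖ] at h0
  exact mul_mem hp (scalarG_mem_parahoric ((hϖ.ord_eq_zero_iff α).mp (by omega)) b)

/-- The left cosets in `P d P` correspond to the translates by `d` of the edge. -/
theorem coset_eq_iff (hϖ : IsUniformizer ϖ) (τ : Bool) (g : GSp4 F) {p p' : GSp4 F}
    (hp : p ∈ parahoric (lam τ)) (hp' : p' ∈ parahoric (lam τ)) (d : GSp4 F) :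
    ((p * d : GSp4 F) : GSp4 F ⧸ parahoric (F := F) (lam τ)) = ((p' * d : GSp4 F)) ↔
      lineC ϖ τ (g * (p * d)) 0 = lineC ϖ τ (g * (p' * d)) 0 ∧
        lineC ϖ τ (g * (p * d)) (0 + 1) = lineC ϖ τ (g * (p' * d)) (0 + 1) := by
  rw [edge_eq_iff hϖ, QuotientGroup.eq]
  have e : (g * (p * d))⁻¹ * (g * (p' * d)) = (p * d)⁻¹ * (p' * d) := by group
  rw [e]
  refine ⟨fun h => (le_sup_left : parahoric (lam τ) ≤ parahoric (lam τ) ⊔ Z F) h,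
    fun h => mem_parahoric_of_mem_sup hϖ h ?_⟩
  have hi : ∀ x : GSp4 F, simOrd ϖ x⁻¹ = -simOrd ϖ x := fun x => by
    rw [simOrd, mu_inv, hϖ.ord_inv, simOrd]
  rw [simOrd_mul hϖ, hi, simOrd_mul hϖ, simOrd_mul hϖ, simOrd_of_mem_parahoric hϖ hp,
    simOrd_of_mem_parahoric hϖ hp']
  ring

/-- A line in `X_Γ` through the initial edge of `g` lifts to a line through this edge in `X`. -/
theorem exists_mem_parahoric_of_qLine_eq (hϖ : IsUniformizer ϖ)
    (hΓ : Γ ≤ (G0 ϖ).map (QuotientGroup.mk' (Z F))) {τ τ' : Bool} {g g' : GSp4 F} {j : ℤ}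
    (h : qLine hϖ Γ τ' g' j = qLine hϖ Γ τ g 0) :
    τ' = τ ∧ ∃ p ∈ parahoric (lam τ),
      ∀ i, qLine hϖ Γ τ' g' (j + i) = qLine hϖ Γ τ (g * p) i := by
  obtain ⟨γ, hγ, h0, h1⟩ := (qLine_eq_iff hϖ hΓ).mp h
  obtain ⟨rfl, hpar, -⟩ := lineC_parity hϖ h0 h1
  obtain ⟨k, hk⟩ := exists_lineC_shift hϖ τ' (γ * g') j (by simpa using hpar)
  have hmem : g⁻¹ * k ∈ parahoric (lam τ') ⊔ Z F := by
    rw [← edge_eq_iff hϖ, hk, hk, zero_add, h0, ← h1, add_comm (0 + 1 : ℤ) j, zero_add]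
    exact ⟨rfl, rfl⟩
  obtain ⟨p, hp, z, hz, hpz⟩ := Subgroup.mem_sup_of_normal_right.mp hmem
  obtain ⟨α, rfl⟩ := mem_Z.mp hz
  have hk' : k = g * p * scalarG α := by rw [mul_assoc, hpz]; group
  refine ⟨rfl, p, hp, fun i => (qLine_eq_iff hϖ hΓ).mpr ⟨γ, hγ, ?_, ?_⟩⟩
  · rw [← lineC_mul_scalarG hϖ τ' (g * p) α, ← hk', hk, add_comm]
  · rw [← lineC_mul_scalarG hϖ τ' (g * p) α, ← hk', hk]
    congr 1; ring

/-- An element of `P` representing a coset in the orbit `P d P / P`. -/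
def rep {τ : Bool} {d : GSp4 F}
    (x : MulAction.orbit (parahoric (F := F) (lam τ)) (d : GSp4 F ⧸ parahoric (F := F) (lam τ))) :
    GSp4 F :=
  (MulAction.mem_orbit_iff.mp x.2).choose

theorem rep_mem {τ : Bool} {d : GSp4 F}
    (x : MulAction.orbit (parahoric (F := F) (lam τ)) (d : GSp4 F ⧸ parahoric (F := F) (lam τ))) :
    rep x ∈ parahoric (lam τ) :=
  (MulAction.mem_orbit_iff.mp x.2).choose.2

theorem mk_rep {τ : Bool} {d : GSp4 F}
    (x : MulAction.orbit (parahoric (F := F) (lam τ)) (d : GSp4 F ⧸ parahoric (F := F) (lam τ))) :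
    ((rep x * d : GSp4 F) : GSp4 F ⧸ parahoric (F := F) (lam τ)) = x.1 :=
  (MulAction.mem_orbit_iff.mp x.2).choose_spec

theorem translate_eq {τ : Bool} {d : GSp4 F} (g : GSp4 F)
    (x : MulAction.orbit (parahoric (F := F) (lam τ)) (d : GSp4 F ⧸ parahoric (F := F) (lam τ))) :
    translate Γ (parahoric (lam τ)) g x =
      DoubleCoset.mk (preim Γ) (parahoric (lam τ) ⊔ Z F) (g * (rep x * d)) := by
  rw [← mk_rep x]
  rfl

theorem lineC_mul_left_Z (hϖ : IsUniformizer ϖ) (τ : Bool) (g : GSp4 F) {z : GSp4 F}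
    (hz : z ∈ Z F) (j : ℤ) : lineC ϖ τ (z * g) j = lineC ϖ τ g j := by
  obtain ⟨α, rfl⟩ := mem_Z.mp hz
  have : scalarG α * g = g * scalarG α := Subtype.ext (scalarGL_comm _ _).symm
  rw [this, lineC_mul_scalarG hϖ]

/-- An element of `Γ` fixing a vertex of a line is central, so it fixes the whole line. -/
theorem lineC_eq_of_fixes (hϖ : IsUniformizer ϖ)
    (hΓ : Γ ≤ (G0 ϖ).map (QuotientGroup.mk' (Z F))) (hdiscrete : DiscreteTopology Γ)
    (htf : ∀ γ ∈ Γ, IsOfFinOrder γ → γ = 1) {τ : Bool} {γ g h : GSp4 F} (hγ : γ ∈ preim Γ)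
    {i j : ℤ} (hv : lineC ϖ τ (γ * g) j = lineC ϖ τ g j)
    (hj : lineC ϖ τ (γ * g) i = lineC ϖ τ h i) : lineC ϖ τ g i = lineC ϖ τ h i := by
  have hz : γ ∈ Z F := by
    refine mem_Z_of_fixes hdiscrete htf hγ
      (h := (g : GL (Fin 4) F) * D ϖ (lineX τ (simOrd ϖ g) j)) ?_
    exact (smul_lineC g γ hϖ (simOrd_even hϖ hΓ hγ) τ j).trans hv
  rw [← hj, lineC_mul_left_Z hϖ τ g hz]

variable (hϖ : IsUniformizer ϖ) (hΓ : Γ ≤ (G0 ϖ).map (QuotientGroup.mk' (Z F)))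
  (hdiscrete : DiscreteTopology Γ) (htf : ∀ γ ∈ Γ, IsOfFinOrder γ → γ = 1)

include hΓ hdiscrete htf in
/-- A coset in `P d P / P` is determined by the next edge of the line and the edge reached. -/
theorem orbit_ext {τ : Bool} (g : GSp4 F)
    {x y : MulAction.orbit (parahoric (F := F) (lam τ))
      (stepG ϖ τ : GSp4 F ⧸ parahoric (F := F) (lam τ))}
    (ht : translate Γ (parahoric (lam τ)) g x = translate Γ (parahoric (lam τ)) g y)
    (hs : qLine hϖ Γ τ (g * rep x) 1 = qLine hϖ Γ τ (g * rep y) 1) : x = y := by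
  have hx := lineC_mul_parahoric hϖ τ g (rep_mem x)
  have hy := lineC_mul_parahoric hϖ τ g (rep_mem y)
  rw [zero_add] at hx hy
  have h1 : lineC ϖ τ (g * rep x) (period τ) = lineC ϖ τ (g * rep y) (period τ) := by
    cases τ
    · exact hx.2.trans hy.2.symm
    · obtain ⟨γ, hγ, h1, h2⟩ := (qLine_eq_iff hϖ hΓ).mp hs
      exact lineC_eq_of_fixes hϖ hΓ hdiscrete htf hγ (h1.trans (hy.2.trans hx.2.symm)) h2
  have h2 : lineC ϖ τ (g * (rep x * stepG ϖ τ)) 0 = lineC ϖ τ (g * (rep y * stepG ϖ τ)) 0 := by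
    rw [← mul_assoc, ← mul_assoc, lineC_mul_stepG hϖ, lineC_mul_stepG hϖ, zero_add, h1]
  rw [translate_eq, translate_eq, ← qLine_zero_eq_iff hϖ hΓ, qLine_eq_iff hϖ hΓ] at ht
  obtain ⟨γ, hγ, h3, h4⟩ := ht
  refine Subtype.ext ?_
  rw [← mk_rep x, ← mk_rep y, coset_eq_iff hϖ τ g (rep_mem x) (rep_mem y)]
  exact ⟨h2, lineC_eq_of_fixes hϖ hΓ hdiscrete htf hγ (h3.trans h2.symm) h4⟩

include hϖ hΓ hdiscrete htf in
theorem finite_orbit [CompactSpace (PGSp4 F ⧸ Γ)] (τ : Bool) :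
    Finite (MulAction.orbit (parahoric (F := F) (lam τ))
      (stepG ϖ τ : GSp4 F ⧸ parahoric (F := F) (lam τ))) := by
  have := finite_cosetSpace (Γ := Γ) hϖ hΓ τ
  have := (finite_range_qLine (Γ := Γ) hϖ hΓ τ 1).to_subtype
  refine Finite.of_injective (fun x => ((translate Γ (parahoric (lam τ)) 1 x,
    ⟨qLine hϖ Γ τ (1 * rep x) 1, ⟨_, rfl⟩⟩) : CosetSpace Γ (parahoric (lam τ)) ×
      Set.range fun g => qLine hϖ Γ τ g 1)) fun x y hxy => ?_
  exact orbit_ext hϖ hΓ hdiscrete htf 1 (congrArg Prod.fst hxy)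
    (congrArg Subtype.val (congrArg Prod.snd hxy))

/-- Geodesics of two steps from the initial edge of `g` are lines. -/
theorem exists_of_geoStep_geoStep {τ : Bool} {g : GSp4 F} {e e' : QEdge Γ}
    (hΓ : Γ ≤ (G0 ϖ).map (QuotientGroup.mk' (Z F)))
    (h : GeoStep hϖ (qLine hϖ Γ τ g 0) e) (h' : GeoStep hϖ e e') :
    ∃ p ∈ parahoric (lam τ), e = qLine hϖ Γ τ (g * p) 1 ∧ e' = qLine hϖ Γ τ (g * p) 2 := by
  obtain ⟨τ', g', j, hl⟩ := exists_line_of_geoStep hϖ hΓ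
    (e := fun i => if i = 0 then qLine hϖ Γ τ g 0 else if i = 1 then e else e') 1
    (fun i hi => by interval_cases i <;> simpa)
  have h0 := hl 0 (by omega)
  have h1 := hl 1 (by omega)
  have h2 := hl 2 (by omega)
  simp only [if_true, one_ne_zero, if_false, Nat.cast_zero, add_zero, Nat.cast_one,
    OfNat.ofNat_ne_zero, Nat.cast_ofNat, OfNat.ofNat_ne_one] at h0 h1 h2
  obtain ⟨rfl, p, hp, hpi⟩ := exists_mem_parahoric_of_qLine_eq hϖ hΓ h0.symm
  exact ⟨p, hp, h1.trans (hpi 1), h2.trans (hpi 2)⟩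

theorem exists_of_geoStep {τ : Bool} {g : GSp4 F} {e : QEdge Γ}
    (hΓ : Γ ≤ (G0 ϖ).map (QuotientGroup.mk' (Z F)))
    (h : GeoStep hϖ (qLine hϖ Γ τ g 0) e) :
    ∃ p ∈ parahoric (lam τ), e = qLine hϖ Γ τ (g * p) 1 := by
  obtain ⟨τ', g', j, h0, h1⟩ := h
  obtain ⟨rfl, p, hp, hpi⟩ := exists_mem_parahoric_of_qLine_eq hϖ hΓ h0.symm
  exact ⟨p, hp, h1.trans (hpi 1)⟩

theorem qLine_mul_parahoric (τ : Bool) (g : GSp4 F) {p : GSp4 F}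
    (hp : p ∈ parahoric (lam τ)) : qLine hϖ Γ τ (g * p) 0 = qLine hϖ Γ τ g 0 :=
  qLine_congr hϖ (lineC_mul_parahoric hϖ τ g hp).1 (lineC_mul_parahoric hϖ τ g hp).2

theorem edgeOf_translate {τ : Bool} (g : GSp4 F)
    (x : MulAction.orbit (parahoric (F := F) (lam τ))
      (stepG ϖ τ : GSp4 F ⧸ parahoric (F := F) (lam τ))) :
    edgeOf hϖ hΓ τ (translate Γ (parahoric (lam τ)) g x) =
      qLine hϖ Γ τ (g * rep x) (period τ) := by
  rw [translate_eq, edgeOf_mk, ← mul_assoc, qLine_mul_stepG, zero_add]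

/-- The orbit point of `p d P`. -/
def orbitPt (ϖ : Fˣ) {τ : Bool} {p : GSp4 F} (hp : p ∈ parahoric (lam τ)) :
    MulAction.orbit (parahoric (F := F) (lam τ))
      (stepG ϖ τ : GSp4 F ⧸ parahoric (F := F) (lam τ)) :=
  ⟨((p * stepG ϖ τ : GSp4 F)), ⟨⟨p, hp⟩, rfl⟩⟩

theorem translate_orbitPt {τ : Bool} (g : GSp4 F) {p : GSp4 F} (hp : p ∈ parahoric (lam τ)) :
    edgeOf hϖ hΓ τ (translate Γ (parahoric (lam τ)) g (orbitPt ϖ hp)) =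
      qLine hϖ Γ τ (g * p) (period τ) := by
  have : translate Γ (parahoric (lam τ)) g (orbitPt ϖ hp) =
    DoubleCoset.mk (preim Γ) (parahoric (lam τ) ⊔ Z F) (g * (p * stepG ϖ τ)) := rfl
  rw [this, edgeOf_mk, ← mul_assoc, qLine_mul_stepG, zero_add]

theorem qLine_rep_orbitPt {τ : Bool} (g : GSp4 F) {p : GSp4 F} (hp : p ∈ parahoric (lam τ)) :
    qLine hϖ Γ τ (g * rep (orbitPt ϖ hp)) 1 = qLine hϖ Γ τ (g * p) 1 := by
  have h := (coset_eq_iff hϖ τ g (rep_mem (orbitPt ϖ hp)) hp (stepG ϖ τ)).mp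
    (mk_rep (orbitPt ϖ hp))
  rw [← mul_assoc, ← mul_assoc, lineC_mul_stepG hϖ, lineC_mul_stepG hϖ, lineC_mul_stepG hϖ,
    lineC_mul_stepG hϖ] at h
  have h1 := lineC_mul_parahoric hϖ τ g (rep_mem (orbitPt ϖ hp))
  have h2 := lineC_mul_parahoric hϖ τ g hp
  rw [zero_add] at h1 h2
  cases τ
  · exact qLine_congr hϖ (h1.2.trans h2.2.symm) h.2
  · exact qLine_congr hϖ (h1.2.trans h2.2.symm) h.1

include hΓ hdiscrete htf in
/-- The number of cosets of `P₁ d₁ P₁ / P₁` leading from one double coset to another is the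
number of geodesic steps between the corresponding edges. -/
theorem card_fiber_false (g : GSp4 F) (z : CosetSpace Γ (parahoric (lam false)))
    [Decidable (GeoStep hϖ (qLine hϖ Γ false g 0) (edgeOf hϖ hΓ false z))] :
    Nat.card {x : MulAction.orbit (parahoric (F := F) (lam false))
      (stepG ϖ false : GSp4 F ⧸ parahoric (F := F) (lam false)) //
        translate Γ (parahoric (lam false)) g x = z} =
      if GeoStep hϖ (qLine hϖ Γ false g 0) (edgeOf hϖ hΓ false z) then 1 else 0 := by
  split_ifs with h
  · rw [Nat.card_eq_one_iff_unique]
    constructor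
    · refine ⟨fun x y => Subtype.ext (orbit_ext hϖ hΓ hdiscrete htf g (x.2.trans y.2.symm) ?_)⟩
      have hx := edgeOf_translate hϖ hΓ g x.1
      have hy := edgeOf_translate hϖ hΓ g y.1
      rw [x.2] at hx
      rw [y.2] at hy
      exact hx.symm.trans hy
    · obtain ⟨p, hp, he⟩ := exists_of_geoStep hϖ hΓ h
      exact ⟨⟨orbitPt ϖ hp, edgeOf_injective hϖ hΓ false
        ((translate_orbitPt hϖ hΓ g hp).trans he.symm)⟩⟩
  · rw [Nat.card_eq_zero]
    left
    refine ⟨fun x => h ⟨false, g * rep x.1, 0, ?_, ?_⟩⟩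
    · exact (qLine_mul_parahoric hϖ false g (rep_mem x.1)).symm
    · exact (congrArg (edgeOf hϖ hΓ false) x.2).symm.trans (edgeOf_translate hϖ hΓ g x.1)

include hΓ hdiscrete htf in
/-- The cosets of `P₂ d₂ P₂ / P₂` leading from one double coset to another correspond to the
geodesics of two steps between the corresponding edges. -/
theorem card_fiber_true (g : GSp4 F) (z : CosetSpace Γ (parahoric (lam true))) :
    Nat.card {x : MulAction.orbit (parahoric (F := F) (lam true))
      (stepG ϖ true : GSp4 F ⧸ parahoric (F := F) (lam true)) //
        translate Γ (parahoric (lam true)) g x = z} =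
    Nat.card {y : Set.range fun g => qLine hϖ Γ true g 1 //
      GeoStep hϖ (qLine hϖ Γ true g 0) y ∧ GeoStep hϖ y (edgeOf hϖ hΓ true z)} := by
  refine Nat.card_eq_of_bijective (fun x => ⟨⟨qLine hϖ Γ true (g * rep x.1) 1, ⟨_, rfl⟩⟩,
    ⟨true, g * rep x.1, 0, (qLine_mul_parahoric hϖ true g (rep_mem x.1)).symm, rfl⟩,
    ⟨true, g * rep x.1, 1, rfl, ?_⟩⟩) ⟨fun x y hxy => ?_, fun y => ?_⟩
  · exact (congrArg (edgeOf hϖ hΓ true) x.2).symm.trans (edgeOf_translate hϖ hΓ g x.1)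
  · exact Subtype.ext (orbit_ext hϖ hΓ hdiscrete htf g (x.2.trans y.2.symm)
      (congrArg Subtype.val (congrArg Subtype.val hxy)))
  · obtain ⟨⟨y, hy⟩, h1, h2⟩ := y
    obtain ⟨p, hp, e1, e2⟩ := exists_of_geoStep_geoStep hϖ hΓ h1 h2
    refine ⟨⟨orbitPt ϖ hp, edgeOf_injective hϖ hΓ true
        ((translate_orbitPt hϖ hΓ g hp).trans e2.symm)⟩, Subtype.ext (Subtype.ext ?_)⟩
    exact (qLine_rep_orbitPt hϖ g hp).trans e1.symm

/-- The entries of the matrix of a Hecke operator count cosets. -/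
theorem heckeOp_single {H : Subgroup (GSp4 F)} {d : GSp4 F}
    [Finite (MulAction.orbit H (d : GSp4 F ⧸ H))] [DecidableEq (CosetSpace Γ H)] (g : GSp4 F)
    (z : CosetSpace Γ H) :
    heckeOp Γ H d (Pi.single z 1) (DoubleCoset.mk (preim Γ) (H ⊔ Z F) g) =
      Nat.card {x : MulAction.orbit H (d : GSp4 F ⧸ H) // translate Γ H g x = z} := by
  have := Fintype.ofFinite (MulAction.orbit H (d : GSp4 F ⧸ H))
  have e : heckeOp Γ H d (Pi.single z 1) (DoubleCoset.mk (preim Γ) (H ⊔ Z F) g) =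
    heckeRow Γ H d g (Pi.single z 1) := rfl
  rw [e, heckeRow, finsum_eq_sum_of_fintype, LinearMap.sum_apply, Nat.card_eq_fintype_card,
    Fintype.card_subtype, Finset.card_filter, Nat.cast_sum]
  refine Finset.sum_congr rfl fun x _ => ?_
  rw [LinearMap.proj_apply, Pi.single_apply, Nat.cast_ite, Nat.cast_one, Nat.cast_zero]

end Hecke

/-! ### Closed walks and injective relabelings -/

section Relabel

variable {α β : Type*} {T : α → α → Prop} {ι : β → α}

theorem isClosedWalk_map_iff (w : List β) :
    IsClosedWalk T (w.map ι) ↔ IsClosedWalk (fun x y => T (ι x) (ι y)) w := by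
  rw [isClosedWalk_iff_getElem, isClosedWalk_iff_getElem]
  simp

theorem isPrimitiveWord_map_iff (hι : Function.Injective ι) (w : List β) :
    IsPrimitiveWord (w.map ι) ↔ IsPrimitiveWord w := by
  refine not_congr ⟨?_, ?_⟩
  · rintro ⟨d, m, hm, hd, h⟩
    obtain ⟨k, rfl⟩ : ∃ k, m = k + 1 := ⟨m - 1, by omega⟩
    have hd' : d = (w.take d.length).map ι := by
      rw [List.map_take, h, List.replicate_succ, List.flatten_cons, List.take_left]
    refine ⟨w.take d.length, k + 1, hm, fun h0 => hd (by rw [hd', h0, List.map_nil]), ?_⟩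
    apply List.map_injective_iff.mpr hι
    rw [List.map_flatten, List.map_replicate, ← hd', h]
  · rintro ⟨d, m, hm, hd, rfl⟩
    refine ⟨d.map ι, m, hm, fun h0 => hd (List.map_eq_nil_iff.mp h0), ?_⟩
    rw [List.map_flatten, List.map_replicate]

theorem cycle_map_injective (hι : Function.Injective ι) : Function.Injective (Cycle.map ι) := by
  intro x y
  induction x using Quotient.inductionOn' with | _ v
  induction y using Quotient.inductionOn' with | _ w
  intro h
  obtain ⟨n, hn⟩ : (v.map ι).IsRotated (w.map ι) := Quotient.exact h
  rw [← List.map_rotate] at hn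
  exact Quotient.sound ⟨n, List.map_injective_iff.mpr hι hn⟩

/-- Prime walks may be counted in any set of labels containing the sources of all steps. -/
def primeWalkEquiv (hι : Function.Injective ι) (hT : ∀ a a', T a a' → a ∈ Set.range ι) :
    PrimeWalk (fun x y => T (ι x) (ι y)) ≃ PrimeWalk T :=
  Equiv.ofBijective (fun C => ⟨C.1.map ι, by
    obtain ⟨w, hw, h1, h2⟩ := C.2
    exact ⟨w.map ι, by rw [← hw]; rfl, (isClosedWalk_map_iff w).mpr h1,
      (isPrimitiveWord_map_iff hι w).mpr h2⟩⟩) (by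
    constructor
    · intro C C' h
      exact Subtype.ext (cycle_map_injective hι (congrArg Subtype.val h))
    · rintro ⟨C, v, rfl, h1, h2⟩
      obtain ⟨w, rfl⟩ : ∃ w : List β, w.map ι = v := by
        rw [← Set.mem_range, Set.range_list_map]
        intro a ha
        obtain ⟨i, hi, rfl⟩ := List.getElem_of_mem ha
        exact hT _ _ (((isClosedWalk_iff_getElem T v).mp h1).2 i hi)
      exact ⟨⟨w, w, rfl, (isClosedWalk_map_iff w).mp h1, (isPrimitiveWord_map_iff hι w).mp h2⟩,
        rfl⟩)

theorem primeWalkEquiv_length (hι : Function.Injective ι)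
    (hT : ∀ a a', T a a' → a ∈ Set.range ι) (C : PrimeWalk fun x y => T (ι x) (ι y)) :
    (primeWalkEquiv hι hT C).1.length = C.1.length := by
  obtain ⟨C, w, rfl, -⟩ := C
  exact List.length_map _

end Relabel

/-! ### The determinant of the edge matrix -/

theorem det_one_sub_fromBlocks {m n o : Type*} [Fintype m] [Fintype n] [Fintype o]
    [DecidableEq m] [DecidableEq n] [DecidableEq o] (A : Matrix m m ℂ) (B : Matrix n o ℂ)
    (C : Matrix o n ℂ) (u : ℂ) :
    (1 - u • Matrix.fromBlocks A 0 0 (Matrix.fromBlocks 0 B C 0)).det =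
      (1 - u • A).det * (1 - u ^ 2 • (B * C)).det := by
  have e : 1 - u • Matrix.fromBlocks A 0 0 (Matrix.fromBlocks 0 B C 0) =
      Matrix.fromBlocks (1 - u • A) 0 0 (Matrix.fromBlocks 1 (-(u • B)) (-(u • C)) 1) := by
    rw [← Matrix.fromBlocks_one, ← Matrix.fromBlocks_one, Matrix.fromBlocks_smul,
      Matrix.fromBlocks_smul, sub_eq_add_neg, Matrix.fromBlocks_neg, Matrix.fromBlocks_neg,
      Matrix.fromBlocks_add, Matrix.fromBlocks_add]
    simp [sub_eq_add_neg]
  rw [e, Matrix.det_fromBlocks_zero₂₁, Matrix.det_fromBlocks_one₂₂]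
  simp [pow_two, smul_smul]

theorem det_one_sub_smul {n : Type*} [Fintype n] [DecidableEq n]
    (L : (n → ℂ) →ₗ[ℂ] (n → ℂ)) (u : ℂ) :
    LinearMap.det (1 - u • L) = (1 - u • LinearMap.toMatrix' L).det := by
  rw [← LinearMap.det_toMatrix', map_sub, map_smul]
  congr 2
  exact LinearMap.toMatrix'_one

theorem toMatrix_apply_single {n : Type*} [Fintype n] [DecidableEq n]
    (L : (n → ℂ) →ₗ[ℂ] (n → ℂ)) (i j : n) :
    LinearMap.toMatrix' L i j = L (Pi.single j 1) i := by
  rw [LinearMap.toMatrix'_apply]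

section EdgeMatrix

variable {F : Type*} [Field F] [ValuativeRel F] [TopologicalSpace F] [IsNonarchimedeanLocalField F]
  {ϖ : Fˣ} {Γ : Subgroup (PGSp4 F)}

theorem qLine_type (hϖ : IsUniformizer ϖ) (hΓ : Γ ≤ (G0 ϖ).map (QuotientGroup.mk' (Z F)))
    {τ τ' : Bool} {g g' : GSp4 F} {j j' : ℤ} (h : qLine hϖ Γ τ g j = qLine hϖ Γ τ' g' j') :
    τ = τ' ∧ (τ = true → (j - j') % 2 = 0) := by
  obtain ⟨γ, hγ, h0, h1⟩ := (qLine_eq_iff hϖ hΓ).mp h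
  exact ⟨(lineC_parity hϖ h0 h1).1, (lineC_parity hϖ h0 h1).2.1⟩

/-- The edges of `X_Γ`: hypotenuses, legs starting at a special vertex, and legs ending at one. -/
abbrev EdgeIndex (hϖ : IsUniformizer ϖ) (Γ : Subgroup (PGSp4 F)) : Type _ :=
  CosetSpace Γ (parahoric (F := F) (lam false)) ⊕
    (CosetSpace Γ (parahoric (F := F) (lam true)) ⊕ Set.range fun g => qLine hϖ Γ true g 1)

/-- The edge with a given index. -/
def edge (hϖ : IsUniformizer ϖ) (hΓ : Γ ≤ (G0 ϖ).map (QuotientGroup.mk' (Z F))) :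
    EdgeIndex hϖ Γ → QEdge Γ :=
  Sum.elim (edgeOf hϖ hΓ false) (Sum.elim (edgeOf hϖ hΓ true) Subtype.val)

theorem exists_edgeOf_eq (hϖ : IsUniformizer ϖ) (hΓ : Γ ≤ (G0 ϖ).map (QuotientGroup.mk' (Z F)))
    {τ : Bool} (x : CosetSpace Γ (parahoric (F := F) (lam τ))) :
    ∃ g, edgeOf hϖ hΓ τ x = qLine hϖ Γ τ g 0 := by
  induction x using Quotient.inductionOn with | _ g
  exact ⟨g, rfl⟩

theorem edge_injective (hϖ : IsUniformizer ϖ)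
    (hΓ : Γ ≤ (G0 ϖ).map (QuotientGroup.mk' (Z F))) : Function.Injective (edge hϖ hΓ) := by
  refine (edgeOf_injective hϖ hΓ false).sumElim ((edgeOf_injective hϖ hΓ true).sumElim
    Subtype.val_injective ?_) ?_
  · rintro x ⟨_, g, rfl⟩ h
    obtain ⟨g', hg'⟩ := exists_edgeOf_eq hϖ hΓ x
    have := (qLine_type hϖ hΓ (hg'.symm.trans h)).2 rfl
    omega
  · rintro x (y | ⟨_, g, rfl⟩) h
    · obtain ⟨g', hg'⟩ := exists_edgeOf_eq hϖ hΓ x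
      obtain ⟨g, hg⟩ := exists_edgeOf_eq hϖ hΓ y
      exact Bool.false_ne_true (qLine_type hϖ hΓ (hg'.symm.trans (h.trans hg))).1
    · obtain ⟨g', hg'⟩ := exists_edgeOf_eq hϖ hΓ x
      exact Bool.false_ne_true (qLine_type hϖ hΓ (hg'.symm.trans h)).1

theorem qLine_mem_range_edge (hϖ : IsUniformizer ϖ)
    (hΓ : Γ ≤ (G0 ϖ).map (QuotientGroup.mk' (Z F))) (τ : Bool) (g : GSp4 F) (j : ℤ) :
    qLine hϖ Γ τ g j ∈ Set.range (edge hϖ hΓ) := by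
  have key : ∀ i : ℤ, (τ = true → (j - i) % 2 = 0) → ∃ g', qLine hϖ Γ τ g' i = qLine hϖ Γ τ g j := by
    intro i hi
    obtain ⟨g', hg'⟩ := exists_lineC_shift hϖ τ g (j - i) hi
    refine ⟨g', qLine_congr hϖ ?_ ?_⟩
    · rw [hg']; congr 1; ring
    · rw [hg']; congr 1; ring
  cases τ
  · obtain ⟨g', hg'⟩ := key 0 (by simp)
    exact ⟨Sum.inl (DoubleCoset.mk _ _ g'), hg'⟩
  · rcases Int.emod_two_eq_zero_or_one j with hj | hj
    · obtain ⟨g', hg'⟩ := key 0 fun _ => by omega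
      exact ⟨Sum.inr (Sum.inl (DoubleCoset.mk _ _ g')), hg'⟩
    · obtain ⟨g', hg'⟩ := key 1 fun _ => by omega
      exact ⟨Sum.inr (Sum.inr ⟨_, g', rfl⟩), hg'⟩

open Classical in
/-- The `0`-`1` matrix of the steps from legs starting at a special vertex to legs ending at one. -/
def outMat (hϖ : IsUniformizer ϖ) (hΓ : Γ ≤ (G0 ϖ).map (QuotientGroup.mk' (Z F))) :
    Matrix (CosetSpace Γ (parahoric (F := F) (lam true)))
      (Set.range fun g => qLine hϖ Γ true g 1) ℂ :=
  Matrix.of fun x y => if GeoStep hϖ (edgeOf hϖ hΓ true x) y then 1 else 0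

open Classical in
/-- The `0`-`1` matrix of the steps from legs ending at a special vertex to legs starting at one. -/
def backMat (hϖ : IsUniformizer ϖ) (hΓ : Γ ≤ (G0 ϖ).map (QuotientGroup.mk' (Z F))) :
    Matrix (Set.range fun g => qLine hϖ Γ true g 1)
      (CosetSpace Γ (parahoric (F := F) (lam true))) ℂ :=
  Matrix.of fun y x => if GeoStep hϖ y (edgeOf hϖ hΓ true x) then 1 else 0

theorem not_geoStep_of_type (hϖ : IsUniformizer ϖ)
    (hΓ : Γ ≤ (G0 ϖ).map (QuotientGroup.mk' (Z F))) {τ τ' : Bool} {g g' : GSp4 F} {j j' : ℤ}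
    (h : τ ≠ τ' ∨ (τ = true ∧ (j + 1 - j') % 2 ≠ 0)) :
    ¬ GeoStep hϖ (qLine hϖ Γ τ g j) (qLine hϖ Γ τ' g' j') := by
  rintro ⟨σ, k, i, h1, h2⟩
  obtain ⟨rfl, h3⟩ := qLine_type hϖ hΓ h1
  obtain ⟨rfl, h4⟩ := qLine_type hϖ hΓ h2
  rcases h with h | ⟨rfl, h⟩
  · exact h rfl
  · have := h3 rfl
    have := h4 rfl
    omega

/-- The Hecke operator of the Siegel congruence subgroup is the adjacency matrix of the
hypotenuses. -/
theorem toMatrix_heckeOp_false [CompactSpace (PGSp4 F ⧸ Γ)] (hϖ : IsUniformizer ϖ)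
    (hΓ : Γ ≤ (G0 ϖ).map (QuotientGroup.mk' (Z F))) (hdiscrete : DiscreteTopology Γ)
    (htf : ∀ γ ∈ Γ, IsOfFinOrder γ → γ = 1)
    [Fintype (CosetSpace Γ (parahoric (F := F) (lam false)))]
    [DecidableEq (CosetSpace Γ (parahoric (F := F) (lam false)))] :
    LinearMap.toMatrix' (heckeOp Γ (parahoric (lam false)) (stepG ϖ false)) =
      relMatrix fun x y => GeoStep hϖ (edgeOf hϖ hΓ false x) (edgeOf hϖ hΓ false y) := by
  classical
  have := finite_orbit hϖ hΓ hdiscrete htf false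
  ext x z
  induction x using Quotient.inductionOn with | _ g
  refine (toMatrix_apply_single _ _ _).trans ((heckeOp_single g z).trans ?_)
  rw [card_fiber_false hϖ hΓ hdiscrete htf, Nat.cast_ite, Nat.cast_one, Nat.cast_zero]
  exact if_congr Iff.rfl rfl rfl

/-- The Hecke operator of the Klingen congruence subgroup counts the geodesics of two legs. -/
theorem toMatrix_heckeOp_true [CompactSpace (PGSp4 F ⧸ Γ)] (hϖ : IsUniformizer ϖ)
    (hΓ : Γ ≤ (G0 ϖ).map (QuotientGroup.mk' (Z F))) (hdiscrete : DiscreteTopology Γ)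
    (htf : ∀ γ ∈ Γ, IsOfFinOrder γ → γ = 1)
    [Fintype (CosetSpace Γ (parahoric (F := F) (lam true)))]
    [DecidableEq (CosetSpace Γ (parahoric (F := F) (lam true)))]
    [Fintype (Set.range fun g => qLine hϖ Γ true g 1)] :
    LinearMap.toMatrix' (heckeOp Γ (parahoric (lam true)) (stepG ϖ true)) =
      outMat hϖ hΓ * backMat hϖ hΓ := by
  classical
  have := finite_orbit hϖ hΓ hdiscrete htf true
  ext x z
  induction x using Quotient.inductionOn with | _ g
  refine (toMatrix_apply_single _ _ _).trans ((heckeOp_single g z).trans ?_)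
  rw [card_fiber_true hϖ hΓ hdiscrete htf, Nat.card_eq_fintype_card, Fintype.card_subtype,
    Finset.card_filter, Nat.cast_sum]
  refine Eq.trans (Finset.sum_congr rfl fun y _ => ?_) Matrix.mul_apply.symm
  rw [Nat.cast_ite, Nat.cast_one, Nat.cast_zero]
  exact (if_congr Iff.rfl (mul_one 1).symm rfl).trans (ite_zero_mul_ite_zero ..).symm

/-- The matrix of geodesic steps on the edges of `X_Γ` is block diagonal, with one block for the
hypotenuses and one, with zero diagonal blocks, for the legs. -/
theorem relMatrix_edge (hϖ : IsUniformizer ϖ)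
    (hΓ : Γ ≤ (G0 ϖ).map (QuotientGroup.mk' (Z F))) :
    relMatrix (fun x y => GeoStep hϖ (edge hϖ hΓ x) (edge hϖ hΓ y)) =
      Matrix.fromBlocks
        (relMatrix fun x y => GeoStep hϖ (edgeOf hϖ hΓ false x) (edgeOf hϖ hΓ false y)) 0 0
        (Matrix.fromBlocks 0 (outMat hϖ hΓ) (backMat hϖ hΓ) 0) := by
  have e := fun {τ : Bool} => exists_edgeOf_eq (Γ := Γ) hϖ hΓ (τ := τ)
  ext x y
  rcases x with x | x | ⟨_, g, rfl⟩ <;> rcases y with y | y | ⟨_, g', rfl⟩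
  · rfl
  · obtain ⟨g, hg⟩ := e x
    obtain ⟨g', hg'⟩ := e y
    refine if_neg ?_
    simp only [edge, Sum.elim_inl, Sum.elim_inr, hg, hg']
    exact not_geoStep_of_type hϖ hΓ (Or.inl (by simp))
  · obtain ⟨g, hg⟩ := e x
    refine if_neg ?_
    simp only [edge, Sum.elim_inl, Sum.elim_inr, hg]
    exact not_geoStep_of_type hϖ hΓ (Or.inl (by simp))
  · obtain ⟨g, hg⟩ := e x
    obtain ⟨g', hg'⟩ := e y
    refine if_neg ?_
    simp only [edge, Sum.elim_inl, Sum.elim_inr, hg, hg']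
    exact not_geoStep_of_type hϖ hΓ (Or.inl (by simp))
  · obtain ⟨g, hg⟩ := e x
    obtain ⟨g', hg'⟩ := e y
    refine if_neg ?_
    simp only [edge, Sum.elim_inl, Sum.elim_inr, hg, hg']
    exact not_geoStep_of_type hϖ hΓ (Or.inr ⟨rfl, by decide⟩)
  · rfl
  · obtain ⟨g', hg'⟩ := e y
    refine if_neg ?_
    simp only [edge, Sum.elim_inl, Sum.elim_inr, hg']
    exact not_geoStep_of_type hϖ hΓ (Or.inl (by simp))
  · rfl
  · refine if_neg ?_
    simp only [edge, Sum.elim_inr]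
    exact not_geoStep_of_type hϖ hΓ (Or.inr ⟨rfl, by decide⟩)

end EdgeMatrix

end Sp4Zeta

end

open Sp4Zeta in
theorem theorem4p1 {F : Type*} [Field F] [ValuativeRel F] [TopologicalSpace F]
    [IsNonarchimedeanLocalField F] (ϖ : Fˣ) (hϖ : IsUniformizer ϖ)
    (Γ : Subgroup (PGSp4 F))
    (hG0 : Γ ≤ (G0 ϖ).map (QuotientGroup.mk' (Z F)))
    (hdiscrete : DiscreteTopology Γ)
    (htorsionfree : ∀ γ ∈ Γ, IsOfFinOrder γ → γ = 1)
    (hcocompact : CompactSpace (PGSp4 F ⧸ Γ)) :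
    Finite (CosetSpace Γ (P1 F)) ∧ Finite (CosetSpace Γ (P2 F)) ∧
    ∃ r : ℝ, 0 < r ∧ ∀ u : ℂ, ‖u‖ < r →
      Multipliable (eulerFactor ϖ Γ u) ∧
      LinearMap.det (1 - u • LP1 Γ ϖ) ≠ 0 ∧
      LinearMap.det (1 - u ^ 2 • LP2 Γ ϖ) ≠ 0 ∧
      zeta ϖ Γ u =
        1 / (LinearMap.det (1 - u • LP1 Γ ϖ) * LinearMap.det (1 - u ^ 2 • LP2 Γ ϖ)) := by
  classical
  have f1 : Finite (CosetSpace Γ (parahoric (F := F) (lam false))) :=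
    finite_cosetSpace hϖ hG0 false
  have f2 : Finite (CosetSpace Γ (parahoric (F := F) (lam true))) :=
    finite_cosetSpace hϖ hG0 true
  have f3 : Finite (Set.range fun g => qLine hϖ Γ true g 1) :=
    (finite_range_qLine hϖ hG0 true 1).to_subtype
  have := Fintype.ofFinite (CosetSpace Γ (parahoric (F := F) (lam false)))
  have := Fintype.ofFinite (CosetSpace Γ (parahoric (F := F) (lam true)))
  have := Fintype.ofFinite (Set.range fun g => qLine hϖ Γ true g 1)
  refine ⟨f1, f2, ?_⟩
  obtain ⟨r, hr, H⟩ := exists_hasProd_primeWalk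
    (fun x y : EdgeIndex hϖ Γ => GeoStep hϖ (edge hϖ hG0 x) (edge hϖ hG0 y))
  refine ⟨r, hr, fun u hu => ?_⟩
  obtain ⟨hdet, hprod⟩ := H u hu
  have hdets : (1 - u • relMatrix
      (fun x y : EdgeIndex hϖ Γ => GeoStep hϖ (edge hϖ hG0 x) (edge hϖ hG0 y))).det =
      LinearMap.det (1 - u • LP1 Γ ϖ) * LinearMap.det (1 - u ^ 2 • LP2 Γ ϖ) := by
    rw [relMatrix_edge, det_one_sub_fromBlocks,
      ← toMatrix_heckeOp_false hϖ hG0 hdiscrete htorsionfree,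
      ← toMatrix_heckeOp_true hϖ hG0 hdiscrete htorsionfree, ← det_one_sub_smul,
      ← det_one_sub_smul]
    rfl
  rw [hdets] at hdet hprod
  have hsrc : ∀ e e' : QEdge Γ, GeoStep hϖ e e' → e ∈ Set.range (edge hϖ hG0) := by
    rintro _ _ ⟨τ, g, j, rfl, -⟩
    exact qLine_mem_range_edge hϖ hG0 τ g j
  let E : PrimeWalk (fun x y : EdgeIndex hϖ Γ => GeoStep hϖ (edge hϖ hG0 x) (edge hϖ hG0 y)) ≃
      PrimeCycle ϖ Γ := (primeWalkEquiv (edge_injective hϖ hG0) hsrc).trans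
    (Equiv.subtypeEquivRight fun C => (primeCycle_iff hϖ hG0 C).symm)
  have hE : HasProd (eulerFactor ϖ Γ u)
      (LinearMap.det (1 - u • LP1 Γ ϖ) * LinearMap.det (1 - u ^ 2 • LP2 Γ ϖ))⁻¹ := by
    rw [← E.hasProd_iff]
    refine (congrArg (HasProd · _) (funext fun C => ?_)).mpr hprod
    exact congrArg (fun n => (1 - u ^ n)⁻¹) (primeWalkEquiv_length (edge_injective hϖ hG0) hsrc C)
  refine ⟨hE.multipliable, left_ne_zero_of_mul hdet, right_ne_zero_of_mul hdet, ?_⟩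
  rw [zeta, hE.tprod_eq, one_div]
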